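/- Let $X$ be a compact complex manifold of dimension $n$, let $\alpha$ be a smooth closed real $(1,1)$-form and $\omega$ a Kähler form on $X$. Assume that $\theta_0:=\arg\int_X(\alpha+\sqrt{-1}\,\omega)^n$ satisfies $0<\theta_0<\pi$. For $\varphi\in C^\infty(X,\mathbb R)$ put $\alpha_\varphi:=\alpha+\sqrt{-1}\partial\bar\partial\varphi$, and let $\theta_\omega(\alpha_\varphi):=\sum_{i=1}^n\operatorname{arccot}\lambda_i$, where $\lambda_1,\dots,\lambda_n$ are the eigenvalues of $\omega^{-1}\alpha_\varphi$ and $\operatorname{arccot}$ takes values in $(0,\pi)$. Let $\mathcal J$ be the functional on $C^\infty(X,\mathbb R)$ defined by $$\mathcal J(\varphi)=\int_0^1\!\int_X\varphi\,\mathrm{Im}\left(e^{-\sqrt{-1}\theta_0}(\alpha_{s\varphi}+\sqrt{-1}\,\omega)^n\right)ds .$$ (1) $\mathcal J(0)=0$, and for all $\varphi,\psi\in C^\infty(X,\mathbb R)$ the derivative of $s\mapsto\mathcal J(\varphi+s\psi)$ at $s=0$ exists and equals $$d\mathcal J(\varphi)(\psi)=\int_X\psi\,\mathrm{Im}\left(e^{-\sqrt{-1}\theta_0}(\alpha_\varphi+\sqrt{-1}\,\omega)^n\right).$$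 (2) Let $0\le T\le\infty$ and let $(\varphi_t)_{t\in[0,T)}$ be a smooth solution on $X\times[0,T)$ of the deformed Hermitian-Yang-Mills flow $$\dot\varphi_t=\cot\theta_\omega(\alpha_{\varphi_t})-\cot\theta_0$$ whose initial point $\varphi_0$ satisfies $0<\theta_\omega(\alpha_{\varphi_0})<\pi$ everywhere on $X$. Then $t\mapsto\mathcal J(\varphi_t)$ is convex on $[0,T)$. -/

import Mathlib

open scoped Manifold ContDiff

noncomputable section

namespace DHYM

/-! ## Differential forms on a complex manifold

`X` is a complex manifold of dimension `n`, modelled on `ℂⁿ`. It is also a real manifold with the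
same charts, and `TangentSpace 𝓘(ℝ, Fin n → ℂ) x` is its real tangent space at `x`. -/

/-- Holomorphic coordinate changes are real smooth: a complex manifold is a real smooth one. -/
instance isManifold_real {n : ℕ} {X : Type*} [TopologicalSpace X] [ChartedSpace (Fin n → ℂ) X]
    [IsManifold 𝓘(ℂ, Fin n → ℂ) ω X] : IsManifold 𝓘(ℝ, Fin n → ℂ) ∞ X := by
  apply isManifold_of_contDiffOn
  intro e e' he he'
  have h := (mem_groupoid_of_pregroupoid.1
    ((contDiffGroupoid ω 𝓘(ℂ, Fin n → ℂ)).compatible he he')).1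
  have h' : ContDiffOn ℂ ω (e.symm ≫ₕ e') (e.symm ≫ₕ e').source := by
    simpa [contDiffPregroupoid] using h
  simpa using (h'.restrict_scalars ℝ).of_le le_top

/-- The complex structure of the tangent space at `x`: multiplication by `i` in holomorphic
coordinates. -/
def J {n : ℕ} {X : Type*} [TopologicalSpace X] [ChartedSpace (Fin n → ℂ) X] (x : X) :
    TangentSpace 𝓘(ℝ, Fin n → ℂ) x →L[ℝ] TangentSpace 𝓘(ℝ, Fin n → ℂ) x :=
  (Complex.I • ContinuousLinearMap.id ℝ (Fin n → ℂ) : (Fin n → ℂ) →L[ℝ] (Fin n → ℂ))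

/-- Differential `k`-forms (not necessarily smooth) on `X` with values in `F`. -/
abbrev DForm (n : ℕ) (X : Type*) [TopologicalSpace X] [ChartedSpace (Fin n → ℂ) X] (k : ℕ)
    (F : Type*) [NormedAddCommGroup F] [NormedSpace ℝ F] : Type _ :=
  ∀ x : X, TangentSpace 𝓘(ℝ, Fin n → ℂ) x [⋀^Fin k]→L[ℝ] F

/-- The expression of a form in a chart `e`: its pullback under `e.symm`. -/
def DForm.inChart {n : ℕ} {X : Type*} [TopologicalSpace X] [ChartedSpace (Fin n → ℂ) X] {k : ℕ}
    {F : Type*} [NormedAddCommGroup F] [NormedSpace ℝ F] (η : DForm n X k F)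
    (e : OpenPartialHomeomorph X (Fin n → ℂ)) (y : Fin n → ℂ) :
    (Fin n → ℂ) [⋀^Fin k]→L[ℝ] F :=
  (η (e.symm y)).compContinuousLinearMap
    (mfderiv 𝓘(ℝ, Fin n → ℂ) 𝓘(ℝ, Fin n → ℂ) e.symm y)

/-- A form is smooth if its expression in every chart of the atlas is smooth. -/
def DForm.IsSmooth {n : ℕ} {X : Type*} [TopologicalSpace X] [ChartedSpace (Fin n → ℂ) X] {k : ℕ}
    {F : Type*} [NormedAddCommGroup F] [NormedSpace ℝ F] (η : DForm n X k F) : Prop :=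
  ∀ e ∈ atlas (Fin n → ℂ) X, ContDiffOn ℝ ∞ (η.inChart e) e.target

/-- The exterior derivative, computed at `x` in the chart around `x`. -/
def DForm.d {n : ℕ} {X : Type*} [TopologicalSpace X] [ChartedSpace (Fin n → ℂ) X] {k : ℕ}
    {F : Type*} [NormedAddCommGroup F] [NormedSpace ℝ F] (η : DForm n X k F) :
    DForm n X (k + 1) F := fun x =>
  (extDeriv (η.inChart (chartAt (Fin n → ℂ) x)) (chartAt (Fin n → ℂ) x x)).compContinuousLinearMap
    (mfderiv 𝓘(ℝ, Fin n → ℂ) 𝓘(ℝ, Fin n → ℂ) (chartAt (Fin n → ℂ) x) x)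

/-- A closed real `(1,1)`-form of class `C^∞`: a smooth real two-form that is `d`-closed and
invariant under the complex structure. -/
structure IsClosedRealOneOne {n : ℕ} {X : Type*} [TopologicalSpace X]
    [ChartedSpace (Fin n → ℂ) X] (α : DForm n X 2 ℝ) : Prop where
  smooth : α.IsSmooth
  closed : α.d = 0
  oneOne : ∀ (x : X) (u v : TangentSpace 𝓘(ℝ, Fin n → ℂ) x), α x ![J x u, J x v] = α x ![u, v]

/-- A Kähler form: a smooth closed real `(1,1)`-form that is positive. -/
structure IsKahlerForm {n : ℕ} {X : Type*} [TopologicalSpace X]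
    [ChartedSpace (Fin n → ℂ) X] (Ω : DForm n X 2 ℝ) : Prop extends IsClosedRealOneOne Ω where
  pos : ∀ (x : X) (v : TangentSpace 𝓘(ℝ, Fin n → ℂ) x), v ≠ 0 → 0 < Ω x ![v, J x v]

/-- Smooth real functions on `X`. -/
def SmoothFun (n : ℕ) {X : Type*} [TopologicalSpace X] [ChartedSpace (Fin n → ℂ) X]
    (φ : X → ℝ) : Prop :=
  ContMDiff 𝓘(ℝ, Fin n → ℂ) 𝓘(ℝ, ℝ) ∞ φ

/-- The real one-form `dᶜφ = i(∂̄ - ∂)φ = -dφ ∘ J`. -/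
def dc (n : ℕ) {X : Type*} [TopologicalSpace X] [ChartedSpace (Fin n → ℂ) X] (φ : X → ℝ) :
    DForm n X 1 ℝ := fun x =>
  ContinuousAlternatingMap.ofSubsingleton ℝ (TangentSpace 𝓘(ℝ, Fin n → ℂ) x) ℝ (0 : Fin 1)
    (-((mfderiv 𝓘(ℝ, Fin n → ℂ) 𝓘(ℝ, ℝ) φ x : TangentSpace 𝓘(ℝ, Fin n → ℂ) x →L[ℝ] ℝ).comp
      (J x)))

/-- The real `(1,1)`-form `i∂∂̄φ = (1/2) d dᶜφ`. -/
def iddbar (n : ℕ) {X : Type*} [TopologicalSpace X] [ChartedSpace (Fin n → ℂ) X] (φ : X → ℝ) :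
    DForm n X 2 ℝ :=
  (1 / 2 : ℝ) • (dc n φ).d

/-- The form `α_φ = α + i∂∂̄φ`. -/
def twist {n : ℕ} {X : Type*} [TopologicalSpace X] [ChartedSpace (Fin n → ℂ) X]
    (α : DForm n X 2 ℝ) (φ : X → ℝ) : DForm n X 2 ℝ :=
  α + iddbar n φ

/-- The complex-valued two-form `α + iΩ`. -/
def cplx {n : ℕ} {X : Type*} [TopologicalSpace X] [ChartedSpace (Fin n → ℂ) X]
    (α Ω : DForm n X 2 ℝ) : DForm n X 2 ℂ := fun x =>
  Complex.ofRealCLM.compContinuousAlternatingMap (α x) +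
    Complex.I • Complex.ofRealCLM.compContinuousAlternatingMap (Ω x)

/-! ## Forms of top degree and their integrals -/

/-- Forms of degree `2n` on `X` with values in `F`. The `2n` arguments are indexed by
`Fin n × Fin 2` (in lexicographic order). -/
abbrev TopForm (n : ℕ) (X : Type*) [TopologicalSpace X] [ChartedSpace (Fin n → ℂ) X]
    (F : Type*) [NormedAddCommGroup F] [NormedSpace ℝ F] : Type _ :=
  ∀ x : X, TangentSpace 𝓘(ℝ, Fin n → ℂ) x [⋀^Fin n × Fin 2]→ₗ[ℝ] F

/-- For an alternating two-form `b`, the multilinear map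
`(v₁, w₁, …, vₖ, wₖ) ↦ b(v₁, w₁) ⋯ b(vₖ, wₖ)`. -/
def prodTwo {V : Type*} [AddCommGroup V] [Module ℝ V] [TopologicalSpace V] (k : ℕ)
    (b : V [⋀^Fin 2]→L[ℝ] ℂ) : MultilinearMap ℝ (fun _ : Fin k × Fin 2 => V) ℂ where
  toFun v := ∏ j : Fin k, b ![v (j, 0), v (j, 1)]
  map_update_add' {inst} v i x y := by
    obtain rfl : inst = instDecidableEqProd := Subsingleton.elim _ _
    obtain ⟨i, c⟩ := i
    have h : ∀ z : V, ∏ j ∈ Finset.univ.erase i, b ![Function.update v (i, c) z (j, 0),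
        Function.update v (i, c) z (j, 1)] =
        ∏ j ∈ Finset.univ.erase i, b ![v (j, 0), v (j, 1)] := fun z =>
      Finset.prod_congr rfl fun j hj => by
        have hj' : j ≠ i := Finset.ne_of_mem_erase hj
        simp [Function.update_of_ne, hj']
    simp only [← Finset.mul_prod_erase Finset.univ _ (Finset.mem_univ i), h, ← add_mul]
    congr 1
    fin_cases c
    · have h0 : ∀ z : V, ![z, v (i, 1)] = Function.update ![x, v (i, 1)] 0 z :=
        fun z => by ext i; fin_cases i <;> rfl
      have h1 := b.map_update_add ![x, v (i, 1)] 0 x y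
      rw [← h0, ← h0, ← h0] at h1
      simpa using h1
    · have h0 : ∀ z : V, ![v (i, 0), z] = Function.update ![v (i, 0), x] 1 z :=
        fun z => by ext i; fin_cases i <;> rfl
      have h1 := b.map_update_add ![v (i, 0), x] 1 x y
      rw [← h0, ← h0, ← h0] at h1
      simpa using h1
  map_update_smul' {inst} v i r x := by
    obtain rfl : inst = instDecidableEqProd := Subsingleton.elim _ _
    obtain ⟨i, c⟩ := i
    have h : ∀ z : V, ∏ j ∈ Finset.univ.erase i, b ![Function.update v (i, c) z (j, 0),
        Function.update v (i, c) z (j, 1)] =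
        ∏ j ∈ Finset.univ.erase i, b ![v (j, 0), v (j, 1)] := fun z =>
      Finset.prod_congr rfl fun j hj => by
        have hj' : j ≠ i := Finset.ne_of_mem_erase hj
        simp [Function.update_of_ne, hj']
    simp only [← Finset.mul_prod_erase Finset.univ _ (Finset.mem_univ i), h, ← smul_mul_assoc]
    congr 1
    fin_cases c
    · have h0 : ∀ z : V, ![z, v (i, 1)] = Function.update ![x, v (i, 1)] 0 z :=
        fun z => by ext i; fin_cases i <;> rfl
      have h1 := b.map_update_smul ![x, v (i, 1)] 0 r x
      rw [← h0, ← h0] at h1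
      simpa using h1
    · have h0 : ∀ z : V, ![v (i, 0), z] = Function.update ![v (i, 0), x] 1 z :=
        fun z => by ext i; fin_cases i <;> rfl
      have h1 := b.map_update_smul ![v (i, 0), x] 1 r x
      rw [← h0, ← h0] at h1
      simpa using h1

/-- The `k`-fold wedge power `b ∧ ⋯ ∧ b` of a two-form:
`bᵏ(v₁, …, v₂ₖ) = 2⁻ᵏ ∑_σ sgn(σ) ∏_j b(v_{σ(2j-1)}, v_{σ(2j)})`. -/
def wedgePow {V : Type*} [AddCommGroup V] [Module ℝ V] [TopologicalSpace V] (k : ℕ)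
    (b : V [⋀^Fin 2]→L[ℝ] ℂ) : V [⋀^Fin k × Fin 2]→ₗ[ℝ] ℂ :=
  ((2 : ℝ) ^ k)⁻¹ • MultilinearMap.alternatization (prodTwo k b)

/-- The standard oriented real frame `∂/∂x₁, ∂/∂y₁, …, ∂/∂xₙ, ∂/∂yₙ` of `ℂⁿ`. -/
def stdFrame (n : ℕ) (p : Fin n × Fin 2) : Fin n → ℂ :=
  Pi.single p.1 (![1, Complex.I] p.2)

/-- The coefficient of a form of top degree with respect to `dx₁ ∧ dy₁ ∧ ⋯ ∧ dxₙ ∧ dyₙ` in the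
chart `e`. -/
def TopForm.coeff {n : ℕ} {X : Type*} [TopologicalSpace X] [ChartedSpace (Fin n → ℂ) X]
    {F : Type*} [NormedAddCommGroup F] [NormedSpace ℝ F] (η : TopForm n X F)
    (e : OpenPartialHomeomorph X (Fin n → ℂ)) (y : Fin n → ℂ) : F :=
  η (e.symm y) fun p =>
    mfderiv 𝓘(ℝ, Fin n → ℂ) 𝓘(ℝ, Fin n → ℂ) e.symm y (stdFrame n p)

/-- A smooth partition of unity on `X` subordinate to the cover by the chart domains. -/
def chartPartition (n : ℕ) (X : Type*) [TopologicalSpace X] [T2Space X] [CompactSpace X]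
    [ChartedSpace (Fin n → ℂ) X] [IsManifold 𝓘(ℂ, Fin n → ℂ) ω X] :
    SmoothPartitionOfUnity X 𝓘(ℝ, Fin n → ℂ) X :=
  (SmoothPartitionOfUnity.exists_isSubordinate_chartAt_source 𝓘(ℝ, Fin n → ℂ) X).choose

/-- The integral of a (continuous) form of top degree over the compact complex manifold `X` with
its canonical orientation, by means of a partition of unity. -/
def TopForm.integral {n : ℕ} {X : Type*} [TopologicalSpace X] [T2Space X] [CompactSpace X]
    [ChartedSpace (Fin n → ℂ) X] [IsManifold 𝓘(ℂ, Fin n → ℂ) ω X]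
    {F : Type*} [NormedAddCommGroup F] [NormedSpace ℝ F] (η : TopForm n X F) : F :=
  ∑ᶠ c : X, ∫ y in (chartAt (Fin n → ℂ) c).target,
    chartPartition n X c ((chartAt (Fin n → ℂ) c).symm y) • η.coeff (chartAt (Fin n → ℂ) c) y

/-! ## The deformed Hermitian-Yang-Mills flow -/

/-- The Hermitian matrix `(a_{jk})` of a real `(1,1)`-form `α = i ∑ a_{jk} dz_j ∧ dz̄_k` at `x`. -/
def hermMatrix {n : ℕ} {X : Type*} [TopologicalSpace X] [ChartedSpace (Fin n → ℂ) X]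
    (α : DForm n X 2 ℝ) (x : X) : Matrix (Fin n) (Fin n) ℂ :=
  Matrix.of fun j k =>
    let e : Fin n → TangentSpace 𝓘(ℝ, Fin n → ℂ) x := fun i => (Pi.single i 1 : Fin n → ℂ)
    (1 / 2 : ℂ) * ((α x ![e j, J x (e k)] : ℝ) - Complex.I * (α x ![e j, e k] : ℝ))

/-- The eigenvalues `λ₁, …, λₙ` of `Ω⁻¹α` at `x`, with multiplicity. They are real, and
`Complex.re` only regards them as real numbers. -/
def relEigenvalues {n : ℕ} {X : Type*} [TopologicalSpace X] [ChartedSpace (Fin n → ℂ) X]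
    (Ω α : DForm n X 2 ℝ) (x : X) : Multiset ℝ :=
  ((hermMatrix Ω x)⁻¹ * hermMatrix α x).charpoly.roots.map Complex.re

/-- The inverse cotangent with values in `(0, π)`. -/
def arccot (t : ℝ) : ℝ := Real.pi / 2 - Real.arctan t

/-- The Lagrangian phase `θ_Ω(α) = ∑ᵢ arccot λᵢ`. -/
def phase {n : ℕ} {X : Type*} [TopologicalSpace X] [ChartedSpace (Fin n → ℂ) X]
    (Ω α : DForm n X 2 ℝ) (x : X) : ℝ :=
  ((relEigenvalues Ω α x).map arccot).sum

/-- The constant `θ₀ = arg ∫_X (α + iΩ)ⁿ`. -/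
def angle {n : ℕ} {X : Type*} [TopologicalSpace X] [T2Space X] [CompactSpace X]
    [ChartedSpace (Fin n → ℂ) X] [IsManifold 𝓘(ℂ, Fin n → ℂ) ω X] (Ω α : DForm n X 2 ℝ) : ℝ :=
  Complex.arg (TopForm.integral (X := X) fun x => wedgePow n (cplx α Ω x))

/-- The time interval `[0, T)`, where `T` may be `∞`. -/
def timeInterval (T : ENNReal) : Set ℝ := {t | 0 ≤ t ∧ ENNReal.ofReal t < T}

/-- `φ` is a smooth solution on `X × [0, T)` of the dHYM flow
`∂φₜ/∂t = cot θ_Ω(α_{φₜ}) - cot θ₀`. -/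
structure IsFlow {n : ℕ} {X : Type*} [TopologicalSpace X] [T2Space X] [CompactSpace X]
    [ChartedSpace (Fin n → ℂ) X] [IsManifold 𝓘(ℂ, Fin n → ℂ) ω X]
    (Ω α : DForm n X 2 ℝ) (T : ENNReal) (φ : ℝ → X → ℝ) : Prop where
  smooth : ContMDiffOn (𝓘(ℝ, ℝ).prod 𝓘(ℝ, Fin n → ℂ)) 𝓘(ℝ, ℝ) ∞ (fun p : ℝ × X => φ p.1 p.2)
    (timeInterval T ×ˢ Set.univ)
  eq : ∀ t ∈ timeInterval T, ∀ x : X,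
    HasDerivWithinAt (fun s => φ s x)
      (Real.cot (phase Ω (twist α (φ t)) x) - Real.cot (angle Ω α)) (timeInterval T) t

/-- The integral `∫_X ψ Im(e^{-iθ₀} (α_φ + iΩ)ⁿ)`, the prescribed derivative of the
`𝒥`-functional at `φ` in the direction `ψ`. -/
def dFunctionalJ {n : ℕ} {X : Type*} [TopologicalSpace X] [T2Space X] [CompactSpace X]
    [ChartedSpace (Fin n → ℂ) X] [IsManifold 𝓘(ℂ, Fin n → ℂ) ω X]
    (Ω α : DForm n X 2 ℝ) (φ ψ : X → ℝ) : ℝ :=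
  TopForm.integral (X := X) fun x => ψ x • Complex.imLm.compAlternatingMap
    (Complex.exp (-Complex.I * (angle Ω α : ℂ)) • wedgePow n (cplx (twist α φ) Ω x))

/-- The `𝒥`-functional: the primitive, normalized by `𝒥(0) = 0`, of the one-form
`(φ, ψ) ↦ ∫_X ψ Im(e^{-iθ₀} (α_φ + iΩ)ⁿ)` on smooth functions, obtained by integration along the
segment from `0` to `φ`. -/
def functionalJ {n : ℕ} {X : Type*} [TopologicalSpace X] [T2Space X] [CompactSpace X]
    [ChartedSpace (Fin n → ℂ) X] [IsManifold 𝓘(ℂ, Fin n → ℂ) ω X]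
    (Ω α : DForm n X 2 ℝ) (φ : X → ℝ) : ℝ :=
  ∫ s in (0 : ℝ)..1, dFunctionalJ Ω α (s • φ) φ

end DHYM

end

/-! Let A and W be the matrices of α_φ and Ω in a complex frame, H = A + iW, and z = (α_φ + iΩ)ⁿ/Ωⁿ
= det H / det W (`ratio`). Since z = ∏(λ_j + i) is a positive multiple of e^{iθ}, one has cot θ = Re
z / Im z (`det_ne_zero_and_cot`), and the prescribed one-form is ∫ ψ Im(e^{-iθ₀} z) against the
measure of Ωⁿ (`dFunctionalJ_eq`). The derivative of z in the direction ψ is Lψ = tr(adj(H)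
∂∂̄ψ)/det W (`linRatio`, `hasDerivAt_ratio`).

The engine of both parts is the symmetry ∫ χ Lψ = ∫ ψ Lχ (`integral_linRatio_symm`). In coordinates,
closedness of α_φ and Ω says that ∂_l H_{jk} is symmetric in l and j, and ∂̄_l H_{jk} in l and k;
this makes the cofactors of H divergence free (`sum_wirt_adjugate`), so χ Lψ - ψ Lχ is a divergence.
A partition of unity reduces the global statement to functions supported in one chart.

For (1), symmetry of L means that the one-form is closed. Along φ_t, the t-derivative of the
integrand dJ(sφ_t)(φ_t) therefore equals the s-derivative of dJ(sφ_t)(sφ̇_t), and integration over s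
in [0,1] leaves dJ(φ_t)(φ̇_t) (`hasDerivAt_functionalJ`).

For (2), write z = a + ib, c = cos θ₀, s = sin θ₀, u = φ̇ = a/b - c/s, and a' + ib' = Lu. Since cb -
sa = -sbu, the second derivative of J is the integral of -2s u a' + 2c u b' + s u² b'
(`second_variation_identity`). Let G = tr(adj(H) ∂u ∂u*)/det W (`gradRatio`). From L(u²) = 2uLu +
2G, L(u³) = 3u²Lu + 6uG and ∫ Lψ = 0 one gets ∫ uLu = -∫ G and ∫ u²Lu = -2∫ uG, so the second
derivative is 2s ∫ (Re G - cot θ · Im G). The integrand is nonnegative where Im z > 0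
(`gradForm_nonneg`): G = zw with Im w ≤ 0, and the expression equals -|z|² Im w / Im z.

The condition Im z > 0 persists along the flow (`IsFlow.im_ratio_pos`): at each point cot θ = φ̇ +
cot θ₀ is continuous in time, while z never vanishes, and together these exclude a zero of Im z. -/

noncomputable section

namespace DHYM

open Set Filter Topology MeasureTheory
open scoped ComplexOrder Matrix

/-! ### Coordinate changes and differential forms in charts -/

section Charts

variable {n : ℕ} {X : Type*} [TopologicalSpace X] [ChartedSpace (Fin n → ℂ) X]

/-- A real-linear map of `ℂⁿ` given by a complex matrix. -/
def matCLM (P : Matrix (Fin n) (Fin n) ℂ) : (Fin n → ℂ) →L[ℝ] (Fin n → ℂ) :=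
  (LinearMap.toContinuousLinearMap (Matrix.toLin' P)).restrictScalars ℝ

@[simp]
theorem matCLM_apply (P : Matrix (Fin n) (Fin n) ℂ) (v : Fin n → ℂ) : matCLM P v = P.mulVec v := by
  simp [matCLM]

theorem exists_matCLM_eq (A : (Fin n → ℂ) →L[ℂ] (Fin n → ℂ)) :
    A.restrictScalars ℝ = matCLM (LinearMap.toMatrix' (A : (Fin n → ℂ) →ₗ[ℂ] (Fin n → ℂ))) := by
  ext v : 1
  rw [matCLM_apply, LinearMap.toMatrix'_mulVec]
  rfl

/-- The coordinate change from the chart `e` to the chart `c`. -/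
def transition (e c : OpenPartialHomeomorph X (Fin n → ℂ)) : (Fin n → ℂ) → (Fin n → ℂ) :=
  c ∘ e.symm

variable [IsManifold 𝓘(ℂ, Fin n → ℂ) ω X]

theorem contDiffOn_transition_complex {e c : OpenPartialHomeomorph X (Fin n → ℂ)}
    (he : e ∈ atlas (Fin n → ℂ) X) (hc : c ∈ atlas (Fin n → ℂ) X) :
    ContDiffOn ℂ ω (transition e c) (e.symm ≫ₕ c).source := by
  have h := (mem_groupoid_of_pregroupoid.1
    ((contDiffGroupoid ω 𝓘(ℂ, Fin n → ℂ)).compatible he hc)).1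
  simpa [contDiffPregroupoid, transition] using h

theorem contDiffOn_transition {e c : OpenPartialHomeomorph X (Fin n → ℂ)}
    (he : e ∈ atlas (Fin n → ℂ) X) (hc : c ∈ atlas (Fin n → ℂ) X) :
    ContDiffOn ℝ ∞ (transition e c) (e.symm ≫ₕ c).source :=
  ((contDiffOn_transition_complex he hc).restrict_scalars ℝ).of_le le_top

theorem contDiffAt_transition {e c : OpenPartialHomeomorph X (Fin n → ℂ)}
    (he : e ∈ atlas (Fin n → ℂ) X) (hc : c ∈ atlas (Fin n → ℂ) X) {y : Fin n → ℂ}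
    (hy : y ∈ (e.symm ≫ₕ c).source) : ContDiffAt ℝ ∞ (transition e c) y :=
  (contDiffOn_transition he hc).contDiffAt ((e.symm ≫ₕ c).open_source.mem_nhds hy)

/-- The complex Jacobian matrix of a coordinate change. -/
def jacobian (e c : OpenPartialHomeomorph X (Fin n → ℂ)) (y : Fin n → ℂ) :
    Matrix (Fin n) (Fin n) ℂ :=
  LinearMap.toMatrix' ((fderiv ℂ (transition e c) y : (Fin n → ℂ) →ₗ[ℂ] (Fin n → ℂ)))

theorem fderiv_transition {e c : OpenPartialHomeomorph X (Fin n → ℂ)}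
    (he : e ∈ atlas (Fin n → ℂ) X) (hc : c ∈ atlas (Fin n → ℂ) X) {y : Fin n → ℂ}
    (hy : y ∈ (e.symm ≫ₕ c).source) :
    fderiv ℝ (transition e c) y = matCLM (jacobian e c y) := by
  rw [jacobian, ← exists_matCLM_eq]
  have h : DifferentiableAt ℂ (transition e c) y :=
    ((contDiffOn_transition_complex he hc).contDiffAt
      ((e.symm ≫ₕ c).open_source.mem_nhds hy)).differentiableAt (by simp)
  exact (h.hasFDerivAt.restrictScalars ℝ).fderiv

theorem mdifferentiableAt_chart {e : OpenPartialHomeomorph X (Fin n → ℂ)}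
    (he : e ∈ atlas (Fin n → ℂ) X) {x : X} (hx : x ∈ e.source) :
    MDifferentiableAt 𝓘(ℝ, Fin n → ℂ) 𝓘(ℝ, Fin n → ℂ) e x :=
  haveI : IsManifold 𝓘(ℝ, Fin n → ℂ) 1 X := IsManifold.of_le (n := ∞) (by norm_num)
  mdifferentiableAt_atlas he hx

theorem mdifferentiableAt_chart_symm {e : OpenPartialHomeomorph X (Fin n → ℂ)}
    (he : e ∈ atlas (Fin n → ℂ) X) {y : Fin n → ℂ} (hy : y ∈ e.target) :
    MDifferentiableAt 𝓘(ℝ, Fin n → ℂ) 𝓘(ℝ, Fin n → ℂ) e.symm y :=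
  haveI : IsManifold 𝓘(ℝ, Fin n → ℂ) 1 X := IsManifold.of_le (n := ∞) (by norm_num)
  mdifferentiableAt_atlas_symm he hy

/-- The tangent map of `e.symm`, read in `ℂⁿ`. -/
def tangentSymm (e : OpenPartialHomeomorph X (Fin n → ℂ)) (y : Fin n → ℂ) :
    (Fin n → ℂ) →L[ℝ] (Fin n → ℂ) :=
  mfderiv 𝓘(ℝ, Fin n → ℂ) 𝓘(ℝ, Fin n → ℂ) e.symm y

theorem tangentSymm_eq_fderiv {e : OpenPartialHomeomorph X (Fin n → ℂ)}
    (he : e ∈ atlas (Fin n → ℂ) X) {y : Fin n → ℂ} (hy : y ∈ e.target) :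
    tangentSymm e y = fderiv ℝ (transition e (chartAt (Fin n → ℂ) (e.symm y))) y := by
  refine (mdifferentiableAt_chart_symm he hy).mfderiv.trans ?_
  simp only [writtenInExtChartAt, extChartAt, mfld_simps, fderivWithin_univ]
  rfl

/-- The tangent map of `e.symm` composed with the tangent map of a chart `c`. -/
theorem mfderiv_chart_comp_symm {e c : OpenPartialHomeomorph X (Fin n → ℂ)}
    (he : e ∈ atlas (Fin n → ℂ) X) (hc : c ∈ atlas (Fin n → ℂ) X) {y : Fin n → ℂ}
    (hy : y ∈ (e.symm ≫ₕ c).source) (v : Fin n → ℂ) :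
    mfderiv 𝓘(ℝ, Fin n → ℂ) 𝓘(ℝ, Fin n → ℂ) c (e.symm y)
      (mfderiv 𝓘(ℝ, Fin n → ℂ) 𝓘(ℝ, Fin n → ℂ) e.symm y v) = fderiv ℝ (transition e c) y v := by
  have hy' : y ∈ e.target ∧ e.symm y ∈ c.source := by simpa using hy
  have h := mfderiv_comp y (mdifferentiableAt_chart hc hy'.2)
    (mdifferentiableAt_chart_symm he hy'.1)
  rw [mfderiv_eq_fderiv] at h
  exact (congrArg (fun A : (Fin n → ℂ) →L[ℝ] (Fin n → ℂ) => A v) h).symm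

/-- The chain rule. Both tangent maps are read in the preferred chart at the same point of X, so the
identity concerns three coordinate changes of ℂⁿ. -/
theorem tangentSymm_transition {e c : OpenPartialHomeomorph X (Fin n → ℂ)}
    (he : e ∈ atlas (Fin n → ℂ) X) (hc : c ∈ atlas (Fin n → ℂ) X) {y : Fin n → ℂ}
    (hy : y ∈ (e.symm ≫ₕ c).source) :
    tangentSymm e y =
      (tangentSymm c (transition e c y)).comp (fderiv ℝ (transition e c) y) := by
  have hy' : y ∈ e.target ∧ e.symm y ∈ c.source := by simpa using hy
  have hcy : transition e c y ∈ c.target := c.map_source hy'.2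
  have hx : c.symm (transition e c y) = e.symm y := c.left_inv hy'.2
  rw [tangentSymm_eq_fderiv he hy'.1, tangentSymm_eq_fderiv hc hcy, hx]
  set c' := chartAt (Fin n → ℂ) (e.symm y)
  have hc' : c' ∈ atlas (Fin n → ℂ) X := chart_mem_atlas _ _
  have hx' : e.symm y ∈ c'.source := mem_chart_source _ _
  have h1 : DifferentiableAt ℝ (transition c c') (transition e c y) :=
    (contDiffAt_transition hc hc' (by simp [hcy, hx, hx'])).differentiableAt (by simp)
  have h2 : DifferentiableAt ℝ (transition e c) y :=
    (contDiffAt_transition he hc hy).differentiableAt (by simp)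
  rw [← fderiv_comp y h1 h2]
  apply Filter.EventuallyEq.fderiv_eq
  filter_upwards [(e.symm ≫ₕ c).open_source.mem_nhds hy] with z hz
  have hz' : z ∈ e.target ∧ e.symm z ∈ c.source := by simpa using hz
  simp [transition, c.left_inv hz'.2]

variable {k : ℕ} {F : Type*} [NormedAddCommGroup F] [NormedSpace ℝ F]

/-- The value of a form at `x`, read in `ℂⁿ`. -/
def DForm.val (η : DForm n X k F) (x : X) : (Fin n → ℂ) [⋀^Fin k]→L[ℝ] F := η x

theorem DForm.inChart_apply (η : DForm n X k F) {e : OpenPartialHomeomorph X (Fin n → ℂ)}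
    (he : e ∈ atlas (Fin n → ℂ) X) {y : Fin n → ℂ} (hy : y ∈ e.target) :
    η.inChart e y = (η.val (e.symm y)).compContinuousLinearMap
      (matCLM (jacobian e (chartAt (Fin n → ℂ) (e.symm y)) y)) := by
  rw [← fderiv_transition he (chart_mem_atlas _ _) (by simp [hy]), ← tangentSymm_eq_fderiv he hy]
  rfl

theorem DForm.inChart_transition (η : DForm n X k F) {e c : OpenPartialHomeomorph X (Fin n → ℂ)}
    (he : e ∈ atlas (Fin n → ℂ) X) (hc : c ∈ atlas (Fin n → ℂ) X) {y : Fin n → ℂ}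
    (hy : y ∈ (e.symm ≫ₕ c).source) :
    η.inChart e y =
      (η.inChart c (transition e c y)).compContinuousLinearMap (fderiv ℝ (transition e c) y) := by
  have hy' : y ∈ e.target ∧ e.symm y ∈ c.source := by simpa using hy
  have hx : e.symm y = c.symm (transition e c y) := (c.left_inv hy'.2).symm
  have h1 : ∀ (e : OpenPartialHomeomorph X (Fin n → ℂ)) (y : Fin n → ℂ),
    η.inChart e y = (η.val (e.symm y)).compContinuousLinearMap (tangentSymm e y) := fun _ _ => rfl
  rw [h1, h1, tangentSymm_transition he hc hy, ← hx]
  rfl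

/-- The exterior derivative is defined through the preferred chart at each point only; since it
commutes with pullback by coordinate changes, any chart of the atlas computes it. -/
theorem DForm.inChart_d {η : DForm n X k F} (hη : η.IsSmooth)
    {e : OpenPartialHomeomorph X (Fin n → ℂ)}
    (he : e ∈ atlas (Fin n → ℂ) X) {y : Fin n → ℂ} (hy : y ∈ e.target) :
    η.d.inChart e y = extDeriv (η.inChart e) y := by
  set c := chartAt (Fin n → ℂ) (e.symm y) with hcdef
  have hc : c ∈ atlas (Fin n → ℂ) X := chart_mem_atlas _ _
  have hx : e.symm y ∈ c.source := mem_chart_source _ _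
  have hys : y ∈ (e.symm ≫ₕ c).source := by simp [hy, hx]
  have h1 : η.inChart e =ᶠ[𝓝 y] fun y => (η.inChart c (transition e c y)).compContinuousLinearMap
      (fderiv ℝ (transition e c) y) := by
    filter_upwards [(e.symm ≫ₕ c).open_source.mem_nhds hys] with z hz
    exact η.inChart_transition he hc hz
  have hd : DifferentiableAt ℝ (η.inChart c) (transition e c y) :=
    ((hη c hc).contDiffAt (c.open_target.mem_nhds (c.map_source hx))).differentiableAt (by simp)
  rw [h1.extDeriv_eq, extDeriv_pullback hd ((contDiffAt_transition he hc hys).of_le (WithTop.coe_le_coe.2 le_top))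
    (r := 2) ?_]
  · ext v
    exact congrArg (extDeriv (η.inChart c) (transition e c y))
      (funext fun i => mfderiv_chart_comp_symm he hc hys (v i))
  · simp

end Charts

/-! ### Linear algebra of (1,1)-forms and their Hermitian matrices -/

section Herm

variable {n : ℕ}

/-- Multiplication by `i` on `ℂⁿ` as a real-linear map. -/
def mulI (n : ℕ) : (Fin n → ℂ) →L[ℝ] (Fin n → ℂ) :=
  Complex.I • ContinuousLinearMap.id ℝ (Fin n → ℂ)

/-- The `j`-th vector of the standard complex frame of `ℂⁿ`. -/
def frame (j : Fin n) : Fin n → ℂ := Pi.single j 1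

/-- The sesquilinear form of a real two-form on `ℂⁿ`. -/
def sesq (a : (Fin n → ℂ) [⋀^Fin 2]→L[ℝ] ℝ) (u v : Fin n → ℂ) : ℂ :=
  (1 / 2 : ℂ) * ((a ![u, Complex.I • v] : ℝ) - Complex.I * (a ![u, v] : ℝ))

/-- The matrix of a real two-form on `ℂⁿ`. -/
def herm (a : (Fin n → ℂ) [⋀^Fin 2]→L[ℝ] ℝ) : Matrix (Fin n) (Fin n) ℂ :=
  Matrix.of fun j k => sesq a (frame j) (frame k)

/-- A real two-form on `ℂⁿ` is of type `(1,1)` if it is invariant under `i`. -/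
def IsOneOne (a : (Fin n → ℂ) [⋀^Fin 2]→L[ℝ] ℝ) : Prop :=
  ∀ u v : Fin n → ℂ, a ![Complex.I • u, Complex.I • v] = a ![u, v]

section Alternating

variable {V F : Type*} [AddCommGroup V] [Module ℝ V] [TopologicalSpace V]
  [AddCommGroup F] [Module ℝ F] [TopologicalSpace F] (a : V [⋀^Fin 2]→L[ℝ] F)

theorem two_add_left (u u' v : V) : a ![u + u', v] = a ![u, v] + a ![u', v] := by
  have h0 : ∀ z : V, ![z, v] = Function.update ![u, v] 0 z :=
    fun z => by ext i; fin_cases i <;> rfl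
  rw [h0 (u + u'), a.map_update_add, ← h0, ← h0]

theorem two_smul_left (r : ℝ) (u v : V) : a ![r • u, v] = r • a ![u, v] := by
  have h0 : ∀ z : V, ![z, v] = Function.update ![u, v] 0 z :=
    fun z => by ext i; fin_cases i <;> rfl
  rw [h0 (r • u), a.map_update_smul, ← h0]

theorem two_swap (u v : V) : a ![u, v] = -a ![v, u] := by
  have h := a.map_swap ![v, u] (i := 0) (j := 1) (by decide)
  have h' : (![v, u] ∘ Equiv.swap (0 : Fin 2) 1) = ![u, v] := by
    ext i; fin_cases i <;> simp
  rw [h'] at h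
  exact h

theorem two_add_right (u v v' : V) : a ![u, v + v'] = a ![u, v] + a ![u, v'] := by
  rw [two_swap, two_add_left, two_swap a u v, two_swap a u v', neg_add]

theorem two_smul_right (r : ℝ) (u v : V) : a ![u, r • v] = r • a ![u, v] := by
  rw [two_swap, two_smul_left, two_swap a u v, smul_neg]

end Alternating

variable {a : (Fin n → ℂ) [⋀^Fin 2]→L[ℝ] ℝ}

theorem IsOneOne.I_left (ha : IsOneOne a) (u v : Fin n → ℂ) :
    a ![Complex.I • u, v] = -a ![u, Complex.I • v] := by
  rw [← ha, smul_smul, Complex.I_mul_I, neg_one_smul, ← neg_one_smul ℝ u, two_smul_left]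
  simp

theorem two_II_right (u v : Fin n → ℂ) :
    a ![u, Complex.I • Complex.I • v] = -a ![u, v] := by
  rw [smul_smul, Complex.I_mul_I, neg_one_smul, ← neg_one_smul ℝ v, two_smul_right]
  simp

theorem complex_smul_eq (c : ℂ) (u : Fin n → ℂ) : c • u = c.re • u + c.im • Complex.I • u := by
  ext i
  simp only [Pi.smul_apply, Pi.add_apply, smul_eq_mul, Complex.real_smul]
  nth_rewrite 1 [← Complex.re_add_im c]
  ring

/-- The sesquilinear form of a `(1,1)`-form, linear in the first variable. -/
def sesqForm (a : (Fin n → ℂ) [⋀^Fin 2]→L[ℝ] ℝ) (ha : IsOneOne a) :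
    (Fin n → ℂ) →ₗ[ℂ] (Fin n → ℂ) →ₛₗ[starRingEnd ℂ] ℂ :=
  LinearMap.mk₂'ₛₗ (RingHom.id ℂ) (starRingEnd ℂ) (sesq a)
    (fun u u' v => by simp only [sesq, two_add_left]; push_cast; ring)
    (fun c u v => by
      simp only [sesq, complex_smul_eq c u, two_add_left, two_smul_left, ha.I_left,
        two_II_right, smul_eq_mul, RingHom.id_apply]
      push_cast
      conv_rhs => rw [← Complex.re_add_im c]
      linear_combination (1/2 * (c.im : ℂ) * (a ![u, v] : ℂ)) * Complex.I_sq)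
    (fun u v v' => by simp only [sesq, smul_add, two_add_right]; push_cast; ring)
    (fun c u v => by
      simp only [sesq, complex_smul_eq c v, smul_add, two_add_right,
        smul_comm Complex.I (_ : ℝ), two_smul_right, two_II_right, smul_eq_mul]
      push_cast
      conv_rhs => rw [← Complex.re_add_im c]
      simp only [map_add, map_mul, Complex.conj_ofReal, Complex.conj_I]
      linear_combination (-1/2 * (c.im : ℂ) * (a ![u, v] : ℂ)) * Complex.I_sq)

theorem sesq_eq_sum (ha : IsOneOne a) (u v : Fin n → ℂ) :
    sesq a u v = ∑ j, ∑ k, u j * herm a j k * star (v k) := by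
  have h : ∀ w : Fin n → ℂ, w = ∑ j, w j • frame j := fun w => by
    conv_lhs => rw [pi_eq_sum_univ' w]
    simp only [frame]
  have h1 : sesq a u v = sesqForm a ha u v := rfl
  rw [h1]
  conv_lhs => rw [h u, h v]
  simp only [map_sum, LinearMap.sum_apply, map_smul, LinearMap.smul_apply, map_smulₛₗ]
  simp only [smul_eq_mul, Finset.mul_sum]
  rw [Finset.sum_comm]
  refine Finset.sum_congr rfl fun j _ => Finset.sum_congr rfl fun k _ => ?_
  change _ * (_ * sesq a _ _) = _ * sesq a _ _ * _
  simp only [Complex.star_def]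
  ring

theorem sesq_conj (ha : IsOneOne a) (u v : Fin n → ℂ) : star (sesq a u v) = sesq a v u := by
  have h := ha.I_left v u
  rw [two_swap] at h
  simp only [sesq, two_swap a u v, Complex.star_def, map_mul, map_sub, Complex.conj_ofReal,
    Complex.conj_I, neg_inj.1 h, map_div₀, map_one, map_ofNat]
  push_cast
  ring

theorem isHermitian_herm (ha : IsOneOne a) : (herm a).IsHermitian := by
  ext j k
  simp [herm, Matrix.conjTranspose_apply, ← sesq_conj ha (frame k)]

/-- Sesquilinearity of the form gives the congruence by P. Determinants thus scale by |det P|²,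
which is why quotients by the determinant of Ω do not depend on the chart. -/
theorem herm_comp_matCLM (ha : IsOneOne a) (P : Matrix (Fin n) (Fin n) ℂ) :
    herm (a.compContinuousLinearMap (matCLM P)) = P.transpose * herm a * P.map star := by
  ext j k
  have h : sesq (a.compContinuousLinearMap (matCLM P)) (frame j) (frame k) =
      sesq a (P.mulVec (frame j)) (P.mulVec (frame k)) := by
    have h0 : ∀ u v, (matCLM P ∘ ![u, v]) = ![P.mulVec u, P.mulVec v] := fun u v => by
      ext i; fin_cases i <;> simp
    simp only [sesq, ContinuousAlternatingMap.compContinuousLinearMap_apply, h0,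
      Matrix.mulVec_smul]
  rw [herm, Matrix.of_apply, h]
  simp only [sesq_eq_sum ha, Matrix.mul_apply, Matrix.transpose_apply,
    Matrix.map_apply, Finset.sum_mul, frame, Matrix.mulVec_single_one, Matrix.col_apply]
  exact Finset.sum_comm

theorem isOneOne_comp_matCLM (ha : IsOneOne a) (P : Matrix (Fin n) (Fin n) ℂ) :
    IsOneOne (a.compContinuousLinearMap (matCLM P)) := by
  intro u v
  have h0 : ∀ u v, (matCLM P ∘ ![u, v]) = ![P.mulVec u, P.mulVec v] := fun u v => by
      ext i; fin_cases i <;> simp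
  simp only [ContinuousAlternatingMap.compContinuousLinearMap_apply, h0, Matrix.mulVec_smul]
  exact ha _ _

theorem posDef_herm (ha : IsOneOne a) (hpos : ∀ v, v ≠ 0 → 0 < a ![v, Complex.I • v])
    {v : Fin n → ℂ} (hv : v ≠ 0) : 0 < (∑ j, ∑ k, v j * herm a j k * star (v k)).re := by
  rw [← sesq_eq_sum ha]
  have h0 : a ![v, v] = 0 := by have := two_swap a v v; linarith
  simp [sesq, h0, hpos v hv]

theorem herm_add (a b : (Fin n → ℂ) [⋀^Fin 2]→L[ℝ] ℝ) : herm (a + b) = herm a + herm b := by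
  ext j k; simp [herm, sesq]; ring

end Herm

/-! ### The form i∂∂̄f on ℂⁿ and the complex Hessian -/

section LocalHessian

variable {n : ℕ}

/-- The second derivative of `f` in the directions `u` and `v`. -/
def secondDeriv (f : (Fin n → ℂ) → ℝ) (y u v : Fin n → ℂ) : ℝ :=
  fderiv ℝ (fun z => fderiv ℝ f z v) y u

/-- The complex Hessian `∂²f/∂z_j∂z̄_k`. -/
def hessC (f : (Fin n → ℂ) → ℝ) (y : Fin n → ℂ) : Matrix (Fin n) (Fin n) ℂ :=
  Matrix.of fun j k => (1 / 4 : ℂ) *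
    (((secondDeriv f y (frame j) (frame k) +
        secondDeriv f y (Complex.I • frame j) (Complex.I • frame k) : ℝ) : ℂ) +
      Complex.I * ((secondDeriv f y (frame j) (Complex.I • frame k) -
        secondDeriv f y (Complex.I • frame j) (frame k) : ℝ) : ℂ))

/-- The one-form `dᶜf` on `ℂⁿ`. -/
def dcLocal (f : (Fin n → ℂ) → ℝ) (y : Fin n → ℂ) : (Fin n → ℂ) [⋀^Fin 1]→L[ℝ] ℝ :=
  ContinuousAlternatingMap.ofSubsingleton ℝ (Fin n → ℂ) ℝ (0 : Fin 1)
    (-((fderiv ℝ f y).comp (mulI n)))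

theorem dcLocal_apply (f : (Fin n → ℂ) → ℝ) (y : Fin n → ℂ) (v : Fin 1 → Fin n → ℂ) :
    dcLocal f y v = -(fderiv ℝ f y (Complex.I • v 0)) := by
  rfl

theorem contDiffOn_dcLocal {f : (Fin n → ℂ) → ℝ} {U : Set (Fin n → ℂ)} (hU : IsOpen U)
    (hf : ContDiffOn ℝ ∞ f U) : ContDiffOn ℝ ∞ (dcLocal f) U := by
  have h1 : ContDiffOn ℝ ∞ (fderiv ℝ f) U := hf.fderiv_of_isOpen hU (by simp)
  have h2 : ContDiffOn ℝ ∞ (fun y => -((fderiv ℝ f y).comp (mulI n))) U :=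
    (h1.clm_comp contDiffOn_const).neg
  exact (ContinuousAlternatingMap.ofSubsingletonLIE (𝕜 := ℝ) (E := Fin n → ℂ) (F := ℝ)
    (0 : Fin 1)).contDiff.comp_contDiffOn h2

theorem secondDeriv_symm {f : (Fin n → ℂ) → ℝ} {y : Fin n → ℂ} (hf : ContDiffAt ℝ ∞ f y)
    (u v : Fin n → ℂ) : secondDeriv f y u v = secondDeriv f y v u := by
  have h : DifferentiableAt ℝ (fderiv ℝ f) y :=
    (hf.fderiv_right (m := ∞) (by simp)).differentiableAt (by simp)
  have h' : ∀ u v, secondDeriv f y u v = fderiv ℝ (fderiv ℝ f) y u v := fun u v => by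
    rw [secondDeriv, fderiv_clm_apply h (differentiableAt_const v)]
    simp
  have hs : IsSymmSndFDerivAt ℝ f y :=
    hf.isSymmSndFDerivAt (by
      rw [minSmoothness_of_isRCLikeNormedField]
      exact WithTop.coe_le_coe.2 (le_top (α := ℕ∞)))
  rw [h', h', hs.eq]

theorem secondDeriv_neg_right (f : (Fin n → ℂ) → ℝ) (y u v : Fin n → ℂ) :
    secondDeriv f y u (-v) = -secondDeriv f y u v := by
  simp [secondDeriv, fderiv_fun_neg]

theorem secondDeriv_neg_left (f : (Fin n → ℂ) → ℝ) (y u v : Fin n → ℂ) :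
    secondDeriv f y (-u) v = -secondDeriv f y u v := by
  simp [secondDeriv]

theorem extDeriv_dcLocal {f : (Fin n → ℂ) → ℝ} {U : Set (Fin n → ℂ)} (hU : IsOpen U)
    (hf : ContDiffOn ℝ ∞ f U) {y : Fin n → ℂ} (hy : y ∈ U) (u v : Fin n → ℂ) :
    extDeriv (dcLocal f) y ![u, v] =
      secondDeriv f y v (Complex.I • u) - secondDeriv f y u (Complex.I • v) := by
  have hd : DifferentiableAt ℝ (dcLocal f) y :=
    ((contDiffOn_dcLocal hU hf).contDiffAt (hU.mem_nhds hy)).differentiableAt (by simp)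
  rw [extDeriv_apply hd]
  simp only [dcLocal_apply]
  simp [secondDeriv, fderiv_fun_neg, Fin.removeNth, Fin.succAbove]
  ring

/-- The factor 1/2 of i∂∂̄ = (1/2) d dᶜ and the 1/2 in `sesq` combine to the 1/4 in the Wirtinger
expression of ∂²f/∂z_j∂z̄_k; symmetry of second derivatives does the rest. -/
theorem herm_extDeriv_dcLocal {f : (Fin n → ℂ) → ℝ} {U : Set (Fin n → ℂ)} (hU : IsOpen U)
    (hf : ContDiffOn ℝ ∞ f U) {y : Fin n → ℂ} (hy : y ∈ U) :
    herm ((1 / 2 : ℝ) • extDeriv (dcLocal f) y) = hessC f y := by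
  ext j k
  have hs := secondDeriv_symm (hf.contDiffAt (hU.mem_nhds hy))
  simp only [herm, sesq, Matrix.of_apply, hessC, ContinuousAlternatingMap.smul_apply,
    extDeriv_dcLocal hU hf hy, smul_smul, Complex.I_mul_I, neg_one_smul, secondDeriv_neg_right,
    hs (Complex.I • frame k), hs (frame k) (Complex.I • frame j)]
  push_cast
  simp only [smul_eq_mul]
  push_cast
  ring

theorem isOneOne_extDeriv_dcLocal {f : (Fin n → ℂ) → ℝ} {U : Set (Fin n → ℂ)} (hU : IsOpen U)
    (hf : ContDiffOn ℝ ∞ f U) {y : Fin n → ℂ} (hy : y ∈ U) :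
    IsOneOne ((1 / 2 : ℝ) • extDeriv (dcLocal f) y) := by
  intro u v
  have hs := secondDeriv_symm (hf.contDiffAt (hU.mem_nhds hy))
  simp only [ContinuousAlternatingMap.smul_apply,
    extDeriv_dcLocal hU hf hy, smul_smul, Complex.I_mul_I, neg_one_smul, secondDeriv_neg_right,
    hs v, hs (Complex.I • v), secondDeriv_neg_left]
  congr 1
  ring

end LocalHessian

/-! ### Smooth functions and i∂∂̄φ in charts -/

section Functions

variable {n : ℕ} {X : Type*} [TopologicalSpace X] [ChartedSpace (Fin n → ℂ) X]

/-- Smoothness of a function in terms of its expressions in charts. -/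
def ChartSmooth (n : ℕ) {X : Type*} [TopologicalSpace X] [ChartedSpace (Fin n → ℂ) X]
    (φ : X → ℝ) : Prop :=
  ∀ e ∈ atlas (Fin n → ℂ) X, ContDiffOn ℝ ∞ (φ ∘ e.symm) e.target

theorem DForm.inChart_add {k : ℕ} (η ζ : DForm n X k ℝ)
    (e : OpenPartialHomeomorph X (Fin n → ℂ)) (y : Fin n → ℂ) :
    (η + ζ).inChart e y = η.inChart e y + ζ.inChart e y := rfl

theorem DForm.inChart_smul {k : ℕ} (r : ℝ) (ζ : DForm n X k ℝ)
    (e : OpenPartialHomeomorph X (Fin n → ℂ)) (y : Fin n → ℂ) :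
    (r • ζ).inChart e y = r • ζ.inChart e y := rfl

variable [IsManifold 𝓘(ℂ, Fin n → ℂ) ω X]

theorem SmoothFun.chartSmooth {φ : X → ℝ} (hφ : SmoothFun n φ) : ChartSmooth n φ := by
  intro e he
  have h : ContMDiffOn 𝓘(ℝ, Fin n → ℂ) 𝓘(ℝ, Fin n → ℂ) ∞ e.symm e.target :=
    contMDiffOn_symm_of_mem_maximalAtlas (IsManifold.subset_maximalAtlas he)
  exact contMDiffOn_iff_contDiffOn.1 (ContMDiff.comp_contMDiffOn hφ h)

theorem ChartSmooth.smoothFun {φ : X → ℝ} (hφ : ChartSmooth n φ) : SmoothFun n φ := by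
  intro x
  set c := chartAt (Fin n → ℂ) x
  have hc : c ∈ atlas (Fin n → ℂ) X := chart_mem_atlas _ _
  have hx : x ∈ c.source := mem_chart_source _ _
  have h1 : ContMDiffOn 𝓘(ℝ, Fin n → ℂ) 𝓘(ℝ, Fin n → ℂ) ∞ c c.source :=
    contMDiffOn_of_mem_maximalAtlas (IsManifold.subset_maximalAtlas hc)
  have h2 : ContMDiffOn 𝓘(ℝ, Fin n → ℂ) 𝓘(ℝ, ℝ) ∞ (φ ∘ c.symm) c.target :=
    contMDiffOn_iff_contDiffOn.2 (hφ c hc)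
  have h3 := (h2.comp h1 (fun z hz => c.map_source hz)).contMDiffAt (c.open_source.mem_nhds hx)
  refine h3.congr_of_eventuallyEq ?_
  filter_upwards [c.open_source.mem_nhds hx] with z hz
  simp [c.left_inv hz]

theorem ChartSmooth.continuous {φ : X → ℝ} (hφ : ChartSmooth n φ) : Continuous φ :=
  hφ.smoothFun.continuous

theorem inChart_dc {φ : X → ℝ} (hφ : ChartSmooth n φ) {e : OpenPartialHomeomorph X (Fin n → ℂ)}
    (he : e ∈ atlas (Fin n → ℂ) X) {y : Fin n → ℂ} (hy : y ∈ e.target) :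
    (dc n φ).inChart e y = dcLocal (φ ∘ e.symm) y := by
  ext v
  have hJ : Complex.I • tangentSymm e y (v 0) = tangentSymm e y (Complex.I • v 0) := by
    rw [tangentSymm_eq_fderiv he hy, fderiv_transition he (chart_mem_atlas _ _) (by simp [hy]),
      matCLM_apply, matCLM_apply, Matrix.mulVec_smul]
  have hφ' : MDifferentiableAt 𝓘(ℝ, Fin n → ℂ) 𝓘(ℝ, ℝ) φ (e.symm y) :=
    (hφ.smoothFun (e.symm y)).mdifferentiableAt (by simp)
  have h := mfderiv_comp y hφ' (mdifferentiableAt_chart_symm he hy)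
  rw [mfderiv_eq_fderiv] at h
  have h' := congrArg (fun A : (Fin n → ℂ) →L[ℝ] ℝ => A (Complex.I • v 0)) h
  rw [dcLocal_apply, h', ← neg_eq_iff_eq_neg]
  change - -((mfderiv 𝓘(ℝ, Fin n → ℂ) 𝓘(ℝ, ℝ) φ (e.symm y))
    (Complex.I • tangentSymm e y (v 0))) = _
  rw [hJ, neg_neg]
  rfl

theorem isSmooth_dc {φ : X → ℝ} (hφ : ChartSmooth n φ) : (dc n φ).IsSmooth := fun e he =>
  (contDiffOn_dcLocal e.open_target (hφ e he)).congr fun _ hy => inChart_dc hφ he hy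

theorem inChart_iddbar {φ : X → ℝ} (hφ : ChartSmooth n φ)
    {e : OpenPartialHomeomorph X (Fin n → ℂ)}
    (he : e ∈ atlas (Fin n → ℂ) X) {y : Fin n → ℂ} (hy : y ∈ e.target) :
    (iddbar n φ).inChart e y = (1 / 2 : ℝ) • extDeriv (dcLocal (φ ∘ e.symm)) y := by
  rw [iddbar, DForm.inChart_smul, DForm.inChart_d (isSmooth_dc hφ) he hy]
  congr 1
  apply Filter.EventuallyEq.extDeriv_eq
  filter_upwards [e.open_target.mem_nhds hy] with z hz using inChart_dc hφ he hz

theorem herm_inChart_iddbar {φ : X → ℝ} (hφ : ChartSmooth n φ)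
    {e : OpenPartialHomeomorph X (Fin n → ℂ)}
    (he : e ∈ atlas (Fin n → ℂ) X) {y : Fin n → ℂ} (hy : y ∈ e.target) :
    herm ((iddbar n φ).inChart e y) = hessC (φ ∘ e.symm) y := by
  rw [inChart_iddbar hφ he hy, herm_extDeriv_dcLocal e.open_target (hφ e he) hy]

/-- The matrix of a two-form in the chart `e`. -/
def chartMatrix (β : DForm n X 2 ℝ) (e : OpenPartialHomeomorph X (Fin n → ℂ)) (y : Fin n → ℂ) :
    Matrix (Fin n) (Fin n) ℂ :=
  herm (β.inChart e y)

end Functions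

/-! ### The top wedge power of a (1,1)-form as a determinant -/

section TopPower

variable {n : ℕ}

/-- The standard symplectic form on `ℂ²ⁿ`. -/
def symp (n : ℕ) (u w : Fin n × Fin 2 → ℂ) : ℂ :=
  ∑ k, (u (k, 0) * w (k, 1) - u (k, 1) * w (k, 0))

/-- The multilinear map `(v₁, w₁, …, vₙ, wₙ) ↦ ∏ symp(v_j, w_j)`. -/
def sympProd (n : ℕ) : MultilinearMap ℂ (fun _ : Fin n × Fin 2 => Fin n × Fin 2 → ℂ) ℂ where
  toFun v := ∏ j : Fin n, symp n (v (j, 0)) (v (j, 1))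
  map_update_add' {inst} v i x y := by
    obtain rfl : inst = instDecidableEqProd := Subsingleton.elim _ _
    obtain ⟨i, c⟩ := i
    have h : ∀ z : Fin n × Fin 2 → ℂ, ∏ j ∈ Finset.univ.erase i,
        symp n (Function.update v (i, c) z (j, 0)) (Function.update v (i, c) z (j, 1)) =
        ∏ j ∈ Finset.univ.erase i, symp n (v (j, 0)) (v (j, 1)) := fun z =>
      Finset.prod_congr rfl fun j hj => by
        have hj' : j ≠ i := Finset.ne_of_mem_erase hj
        simp [Function.update_of_ne, hj']
    simp only [← Finset.mul_prod_erase Finset.univ _ (Finset.mem_univ i), h, ← add_mul]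
    congr 1
    fin_cases c <;> simp [symp, add_mul, mul_add, Finset.sum_add_distrib] <;>
      ring
  map_update_smul' {inst} v i r x := by
    obtain rfl : inst = instDecidableEqProd := Subsingleton.elim _ _
    obtain ⟨i, c⟩ := i
    have h : ∀ z : Fin n × Fin 2 → ℂ, ∏ j ∈ Finset.univ.erase i,
        symp n (Function.update v (i, c) z (j, 0)) (Function.update v (i, c) z (j, 1)) =
        ∏ j ∈ Finset.univ.erase i, symp n (v (j, 0)) (v (j, 1)) := fun z =>
      Finset.prod_congr rfl fun j hj => by
        have hj' : j ≠ i := Finset.ne_of_mem_erase hj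
        simp [Function.update_of_ne, hj']
    simp only [← Finset.mul_prod_erase Finset.univ _ (Finset.mem_univ i), h, smul_eq_mul,
      ← mul_assoc]
    congr 1
    fin_cases c <;> simp [symp, Finset.mul_sum, mul_sub, mul_assoc, mul_left_comm]

theorem sympProd_apply (v : Fin n × Fin 2 → Fin n × Fin 2 → ℂ) :
    sympProd n v = ∏ j : Fin n, symp n (v (j, 0)) (v (j, 1)) := rfl

/-- The coefficients of the standard symplectic form. -/
def sympCoeff (p q : Fin n × Fin 2) : ℤ :=
  if p.1 = q.1 then (if p.2 = q.2 then 0 else if p.2 = 0 then 1 else -1) else 0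

theorem symp_single (p q : Fin n × Fin 2) :
    symp n (Pi.single p 1) (Pi.single q 1) = (sympCoeff p q : ℤ) := by
  obtain ⟨i, c⟩ := p
  obtain ⟨j, d⟩ := q
  simp only [symp, Pi.single_apply, sympCoeff, Prod.mk.injEq, mul_ite, mul_one, mul_zero]
  by_cases hij : i = j
  · subst hij
    rw [Finset.sum_eq_single i]
    · fin_cases c <;> fin_cases d <;> simp
    · intro b _ hb
      simp [hb]
    · simp
  · rw [if_neg hij]
    simp only [Int.cast_zero]
    refine Finset.sum_eq_zero fun k _ => ?_
    by_cases hk : k = i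
    · have : k ≠ j := fun h => hij (hk.symm.trans h)
      simp [this]
    · simp [hk]

/-- If the product is nonzero, σ sends each pair {(j,0), (j,1)} to a pair, so it permutes the n
blocks and possibly swaps inside them. Swaps contribute the same sign to σ and to the product. -/
theorem sign_mul_prod_sympCoeff_nonneg (σ : Equiv.Perm (Fin n × Fin 2)) :
    0 ≤ (Equiv.Perm.sign σ : ℤ) * ∏ j, sympCoeff (σ (j, 0)) (σ (j, 1)) := by
  by_cases h : ∏ j, sympCoeff (σ (j, 0)) (σ (j, 1)) = 0
  · simp [h]
  have h1 : ∀ j, (σ (j, 0)).1 = (σ (j, 1)).1 := fun j => by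
    by_contra hj
    exact h (Finset.prod_eq_zero (Finset.mem_univ j) (by simp [sympCoeff, hj]))
  have h2 : ∀ j, (σ (j, 0)).2 ≠ (σ (j, 1)).2 := fun j hj => by
    exact h (Finset.prod_eq_zero (Finset.mem_univ j) (by simp [sympCoeff, hj]))
  have hsurj : Function.Surjective fun j => (σ (j, 0)).1 := fun k => by
    obtain ⟨⟨j, c⟩, hj⟩ := σ.surjective (k, 0)
    refine ⟨j, ?_⟩
    fin_cases c
    · simp at hj; simp [hj]
    · simp at hj; simp [h1, hj]
  let π : Equiv.Perm (Fin n) :=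
    Equiv.ofBijective _ ⟨Finite.injective_iff_surjective.2 hsurj, hsurj⟩
  let ε : Fin n → Equiv.Perm (Fin 2) := fun j => if (σ (j, 0)).2 = 0 then 1 else Equiv.swap 0 1
  have hσ : σ = (Equiv.prodCongrLeft fun _ : Fin 2 => π) * Equiv.prodCongrRight ε := by
    ext1 ⟨j, c⟩
    have e1 := h1 j
    have e2 := h2 j
    change _ = (π j, ε j c)
    simp only [π, ε]
    generalize hp : σ (j, 0) = p at *
    generalize hq : σ (j, 1) = q at *
    obtain ⟨p1, p2⟩ := p
    obtain ⟨q1, q2⟩ := q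
    simp only at e1 e2
    subst e1
    fin_cases c <;> fin_cases p2 <;> fin_cases q2 <;> simp_all
  have hc : ∀ j, sympCoeff (σ (j, 0)) (σ (j, 1)) = (Equiv.Perm.sign (ε j) : ℤ) := fun j => by
    simp only [sympCoeff, h1 j, h2 j, if_true, if_false, ε]
    split_ifs <;> simp
  -- The block permutation π acts on two copies of the index set, so its sign enters squared and
  -- only the inner swaps count.
  have hs : (Equiv.Perm.sign σ : ℤ) = ∏ j, (Equiv.Perm.sign (ε j) : ℤ) := by
    rw [hσ, Equiv.Perm.sign_mul, Equiv.Perm.sign_prodCongrLeft, Equiv.Perm.sign_prodCongrRight]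
    simp
  simp only [hs, hc]
  exact mul_self_nonneg _

/-- The constant in the formula for the top power of a `(1,1)`-form. -/
def topConst (n : ℕ) : ℝ :=
  ((∑ σ : Equiv.Perm (Fin n × Fin 2),
    (Equiv.Perm.sign σ : ℤ) * ∏ j : Fin n, sympCoeff (σ (j, 0)) (σ (j, 1)) : ℤ) : ℝ)

/-- No summand is negative and the identity permutation contributes 1. Positivity is all that is
used; the exact value is irrelevant. -/
theorem topConst_pos (n : ℕ) : 0 < topConst n := by
  rw [topConst, Int.cast_pos]
  refine Finset.sum_pos' (fun σ _ => sign_mul_prod_sympCoeff_nonneg σ) ⟨1, Finset.mem_univ _, ?_⟩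
  simp [sympCoeff]

theorem alternatization_sympProd_single :
    MultilinearMap.alternatization (sympProd n) (fun p => Pi.single p 1) = (topConst n : ℂ) := by
  rw [MultilinearMap.alternatization_apply, topConst]
  push_cast
  refine Finset.sum_congr rfl fun σ _ => ?_
  simp [sympProd_apply, symp_single, Units.smul_def]

/-- Alternating forms of top degree on ℂ²ⁿ are multiples of the determinant, so the value on the
standard basis decides. -/
theorem alternatization_sympProd (T : Matrix (Fin n × Fin 2) (Fin n × Fin 2) ℂ) :
    MultilinearMap.alternatization (sympProd n) (fun p q => T p q) = (topConst n : ℂ) * T.det := by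
  rw [(MultilinearMap.alternatization (sympProd n)).eq_smul_basis_det (Pi.basisFun ℂ _),
    Pi.basisFun_det]
  have : (⇑(Pi.basisFun ℂ (Fin n × Fin 2))) = fun p => Pi.single p 1 := by
    ext p; simp
  rw [this, alternatization_sympProd_single]
  rfl

/-- The matrix whose symplectic Gram matrix is that of the `(1,1)`-form with matrix `H` in the
standard real frame. -/
def frameMatrix (H : Matrix (Fin n) (Fin n) ℂ) : Matrix (Fin n × Fin 2) (Fin n × Fin 2) ℂ :=
  Matrix.of fun p q => if q.2 = 0 then stdFrame n p q.1 else
    Complex.I * ∑ k, H q.1 k * star (stdFrame n p k)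

theorem det_frameMatrix (H : Matrix (Fin n) (Fin n) ℂ) :
    (frameMatrix H).det = (2 : ℂ) ^ n * H.det := by
  -- The first factor passes from the real frame to (z, z̄) coordinates, with determinant (-2i)ⁿ;
  -- the second inserts H, with determinant iⁿ det H. The product is 2ⁿ det H.
  have h : frameMatrix H =
      Matrix.kronecker (1 : Matrix (Fin n) (Fin n) ℂ) !![1, 1; Complex.I, -Complex.I] *
      Matrix.blockDiagonal fun d : Fin 2 => if d = 0 then 1 else Complex.I • H.transpose := by
    ext ⟨m, c⟩ ⟨j, d⟩
    rw [Matrix.mul_apply, Fintype.sum_prod_type]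
    simp only [Matrix.kronecker, Matrix.kroneckerMap_apply, Matrix.blockDiagonal_apply]
    rw [Finset.sum_eq_single m (fun k _ hk => by simp [hk.symm]) (by simp)]
    fin_cases c <;> fin_cases d <;>
      simp [frameMatrix, stdFrame, Pi.single_apply, Matrix.one_apply, eq_comm, apply_ite, mul_comm]
  rw [h, Matrix.det_mul, Matrix.kronecker, Matrix.det_kronecker, Matrix.det_blockDiagonal]
  simp [Matrix.det_fin_two]
  rw [← mul_assoc, ← mul_pow]
  congr 2
  linear_combination (-2 : ℂ) * Complex.I_sq

/-- By `hb` the values of b on the vectors w are the symplectic products of the rows of `frameMatrix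
H`, so the wedge power becomes a standard one; the 2ⁿ in its determinant cancels the normalization
2⁻ⁿ. -/
theorem wedgePow_apply_eq {V : Type*} [AddCommGroup V] [Module ℝ V] [TopologicalSpace V]
    (b : V [⋀^Fin 2]→L[ℝ] ℂ) (w : Fin n × Fin 2 → V) (H : Matrix (Fin n) (Fin n) ℂ)
    (hb : ∀ p q, b ![w p, w q] = Complex.I * ∑ j, ∑ k, H j k *
      (stdFrame n p j * star (stdFrame n q k) - stdFrame n q j * star (stdFrame n p k))) :
    wedgePow n b w = (topConst n : ℂ) * H.det := by
  have h : MultilinearMap.alternatization (prodTwo n b) w =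
      MultilinearMap.alternatization (sympProd n) (fun p q => frameMatrix H p q) := by
    rw [MultilinearMap.alternatization_apply, MultilinearMap.alternatization_apply]
    apply Finset.sum_congr rfl
    intro σ _
    congr 1
    change ∏ j : Fin n, b ![w (σ (j, 0)), w (σ (j, 1))] =
      ∏ j : Fin n, symp n (fun q => frameMatrix H (σ (j, 0)) q) (fun q => frameMatrix H (σ (j, 1)) q)
    refine Finset.prod_congr rfl fun j _ => ?_
    rw [hb, symp]
    simp only [frameMatrix, Matrix.of_apply, Finset.mul_sum, Finset.sum_mul,
      ← Finset.sum_sub_distrib, if_true, one_ne_zero, if_false]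
    exact Finset.sum_congr rfl fun _ _ => Finset.sum_congr rfl fun _ _ => by ring
  rw [wedgePow, AlternatingMap.smul_apply, h, alternatization_sympProd, det_frameMatrix,
    Complex.real_smul]
  push_cast
  field_simp

end TopPower

/-! ### Lagrangian phase, determinants and the key positivity -/

section Algebra

variable {n : ℕ}

theorem complex_add_I_eq (t : ℝ) :
    (t : ℂ) + Complex.I = (Real.sqrt (1 + t ^ 2) : ℂ) * Complex.exp (Complex.I * (arccot t : ℂ)) := by
  have h : 0 < Real.sqrt (1 + t ^ 2) := Real.sqrt_pos.2 (by positivity)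
  rw [mul_comm Complex.I, Complex.exp_mul_I, ← Complex.ofReal_cos, ← Complex.ofReal_sin, arccot,
    Real.cos_pi_div_two_sub, Real.sin_pi_div_two_sub, Real.sin_arctan, Real.cos_arctan]
  have h' : (Real.sqrt (1 + t ^ 2) : ℂ) ≠ 0 := by exact_mod_cast h.ne'
  push_cast
  field_simp

/-- Each t + i has argument arccot t in (0, π); moduli multiply and the arguments add, without
reduction modulo 2π. -/
theorem exists_prod_add_I (s : Multiset ℝ) :
    ∃ r : ℝ, 0 < r ∧ (s.map fun t : ℝ => (t : ℂ) + Complex.I).prod =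
      (r : ℂ) * Complex.exp (Complex.I * ((s.map arccot).sum : ℝ)) := by
  induction s using Multiset.induction_on with
  | empty => exact ⟨1, one_pos, by simp⟩
  | cons t s ih =>
    obtain ⟨r, hr, h⟩ := ih
    refine ⟨Real.sqrt (1 + t ^ 2) * r, mul_pos (Real.sqrt_pos.2 (by positivity)) hr, ?_⟩
    rw [Multiset.map_cons, Multiset.prod_cons, Multiset.map_cons, Multiset.sum_cons, h,
      complex_add_I_eq]
    push_cast
    rw [mul_add, Complex.exp_add]
    ring

theorem im_star_dotProduct_mulVec {A : Matrix (Fin n) (Fin n) ℂ} (hA : A.IsHermitian)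
    (v : Fin n → ℂ) : (star v ⬝ᵥ A.mulVec v).im = 0 := by
  have h : star (star v ⬝ᵥ A.mulVec v) = star v ⬝ᵥ A.mulVec v := by
    rw [← Matrix.star_dotProduct, Matrix.star_mulVec, hA.eq, ← Matrix.dotProduct_mulVec]
  exact Complex.conj_eq_iff_im.1 h

/-- An eigenvector satisfies Av = cWv. Pairing with v gives v*Av = c v*Wv, where both quadratic
values are real and the second is positive. -/
theorem im_eq_zero_of_mem_roots {A W : Matrix (Fin n) (Fin n) ℂ} (hA : A.IsHermitian)
    (hW : W.PosDef) {c : ℂ} (hc : c ∈ (W⁻¹ * A).charpoly.roots) : c.im = 0 := by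
  have hU : IsUnit W.det := (Matrix.isUnit_iff_isUnit_det _).1 hW.isUnit
  have h1 := (Polynomial.mem_roots'.1 hc).2
  rw [Polynomial.IsRoot, Matrix.eval_charpoly] at h1
  obtain ⟨v, hv, hv'⟩ := Matrix.exists_mulVec_eq_zero_iff.2 h1
  have h2 : A.mulVec v = c • W.mulVec v := by
    have h3 := congrArg W.mulVec hv'
    rw [Matrix.mulVec_mulVec, mul_sub, Matrix.mul_nonsing_inv_cancel_left _ _ hU, Matrix.sub_mulVec,
      Matrix.mulVec_zero, sub_eq_zero, ← Matrix.mulVec_mulVec] at h3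
    rw [← h3, ← Matrix.mulVec_smul]
    simp [Matrix.scalar_apply]
  have h4 := im_star_dotProduct_mulVec hA v
  have h5 := im_star_dotProduct_mulVec hW.1 v
  have h6 : 0 < (star v ⬝ᵥ W.mulVec v).re := by
    have := hW.dotProduct_mulVec_pos hv
    exact (Complex.lt_def.1 this).1
  rw [h2, dotProduct_smul, smul_eq_mul, Complex.mul_im, h5] at h4
  simpa [h6.ne'] using h4

/-- The quotient is det(W⁻¹A + i), the characteristic polynomial of W⁻¹A evaluated at -i up to the
sign (-1)ⁿ, hence the product of λ + i over its real roots λ. -/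
theorem exists_det_eq_exp {A W : Matrix (Fin n) (Fin n) ℂ} (hA : A.IsHermitian)
    (hW : W.PosDef) : ∃ r : ℝ, 0 < r ∧ (A + Complex.I • W).det / W.det =
      (r : ℂ) * Complex.exp (Complex.I *
        ((((W⁻¹ * A).charpoly.roots.map Complex.re).map arccot).sum : ℝ)) := by
  have hU : IsUnit W.det := (Matrix.isUnit_iff_isUnit_det _).1 hW.isUnit
  set M := W⁻¹ * A with hM
  obtain ⟨r, hr, h⟩ := exists_prod_add_I (M.charpoly.roots.map Complex.re)
  refine ⟨r, hr, ?_⟩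
  rw [← h, Multiset.map_map]
  have h1 : (M.charpoly.roots.map ((fun t : ℝ => (t : ℂ) + Complex.I) ∘ Complex.re)) =
      M.charpoly.roots.map fun c => c + Complex.I := by
    refine Multiset.map_congr rfl fun c hc => ?_
    have := im_eq_zero_of_mem_roots hA hW hc
    simp only [Function.comp_apply, add_left_inj]
    exact Complex.ext rfl (by simp [this])
  rw [h1]
  have h2 : (A + Complex.I • W).det = W.det * (M + Matrix.scalar (Fin n) Complex.I).det := by
    rw [← Matrix.det_mul, mul_add, hM, Matrix.mul_nonsing_inv_cancel_left _ _ hU]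
    congr 2
    ext i j
    simp [Matrix.scalar_apply, mul_comm]
  have h3 := (IsAlgClosed.splits M.charpoly).eval_eq_prod_roots_of_monic M.charpoly_monic
    (-Complex.I)
  rw [Matrix.eval_charpoly] at h3
  have h4 : Matrix.scalar (Fin n) (-Complex.I) - M = -(M + Matrix.scalar (Fin n) Complex.I) := by
    rw [map_neg]; abel
  rw [h4, Matrix.det_neg, Fintype.card_fin] at h3
  have h5 : (M.charpoly.roots.map fun c => -Complex.I - c) =
      M.charpoly.roots.map fun c => -1 * (c + Complex.I) :=
    Multiset.map_congr rfl fun c _ => by ring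
  have hcard : M.charpoly.roots.card = n := by
    rw [← (IsAlgClosed.splits M.charpoly).natDegree_eq_card_roots,
      Matrix.charpoly_natDegree_eq_dim, Fintype.card_fin]
  rw [h5, Multiset.prod_map_mul, Multiset.map_const', Multiset.prod_replicate, hcard] at h3
  have h6 := mul_left_cancel₀ (pow_ne_zero n (by norm_num : (-1 : ℂ) ≠ 0)) h3
  rw [h2, mul_div_cancel_left₀ _ hU.ne_zero, h6]

/-- The cotangent of the sum of the `arccot`s of the relative eigenvalues. -/
theorem det_ne_zero_and_cot {A W : Matrix (Fin n) (Fin n) ℂ} (hA : A.IsHermitian)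
    (hW : W.PosDef) : (A + Complex.I • W).det / W.det ≠ 0 ∧
      Real.cot (((W⁻¹ * A).charpoly.roots.map Complex.re).map arccot).sum =
        ((A + Complex.I • W).det / W.det).re / ((A + Complex.I • W).det / W.det).im ∧
      (0 < Real.sin (((W⁻¹ * A).charpoly.roots.map Complex.re).map arccot).sum →
        0 < ((A + Complex.I • W).det / W.det).im) := by
  obtain ⟨r, hr, h⟩ := exists_det_eq_exp hA hW
  rw [h]
  set θ := (((W⁻¹ * A).charpoly.roots.map Complex.re).map arccot).sum
  have hexp : Complex.exp (Complex.I * (θ : ℂ)) = (Real.cos θ : ℂ) + (Real.sin θ : ℂ) * Complex.I := by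
    rw [mul_comm, Complex.exp_mul_I]; push_cast; ring
  have hre : ((r : ℂ) * Complex.exp (Complex.I * (θ : ℂ))).re = r * Real.cos θ := by
    rw [hexp]; simp [-Complex.ofReal_cos, -Complex.ofReal_sin]
  have him : ((r : ℂ) * Complex.exp (Complex.I * (θ : ℂ))).im = r * Real.sin θ := by
    rw [hexp]; simp [-Complex.ofReal_cos, -Complex.ofReal_sin]
  refine ⟨mul_ne_zero (by exact_mod_cast hr.ne') (Complex.exp_ne_zero _), ?_, ?_⟩
  -- This also covers a vanishing sine: both the cotangent and the quotient are then 0 by the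
  -- convention for division.
  · rw [hre, him, mul_div_mul_left _ _ hr.ne', Real.cot_eq_cos_div_sin]
  · intro hs
    rw [him]
    exact mul_pos hr hs

/-- The trace of `adj(H) v v*`. -/
def gradForm (H : Matrix (Fin n) (Fin n) ℂ) (v : Fin n → ℂ) : ℂ :=
  (H.adjugate * Matrix.vecMulVec v (star v)).trace

/-- Put y = H⁻¹v and w = v*y. The gradient term is zw, and w = y*H*y = y*Ay - i y*Wy has nonpositive
imaginary part; the real combination in the conclusion isolates this part. -/
theorem gradForm_nonneg {A W : Matrix (Fin n) (Fin n) ℂ} (hA : A.IsHermitian)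
    (hW : W.PosDef) (him : 0 < ((A + Complex.I • W).det / W.det).im) (v : Fin n → ℂ) :
    0 ≤ (gradForm (A + Complex.I • W) v / W.det).re -
      ((A + Complex.I • W).det / W.det).re / ((A + Complex.I • W).det / W.det).im *
        (gradForm (A + Complex.I • W) v / W.det).im := by
  set H := A + Complex.I • W with hH
  set z := H.det / W.det with hz
  have hdet : H.det ≠ 0 := fun h => by simp [hz, h] at him
  have hU : IsUnit H.det := isUnit_iff_ne_zero.2 hdet
  set y := H⁻¹.mulVec v with hy
  have hv : v = H.mulVec y := by rw [hy, Matrix.mulVec_mulVec, Matrix.mul_nonsing_inv _ hU,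
    Matrix.one_mulVec]
  set w := star v ⬝ᵥ y with hw
  have h1 : gradForm H v / W.det = z * w := by
    have : H.adjugate = H.det • H⁻¹ := by
      rw [Matrix.inv_def, Ring.inverse_eq_inv', smul_smul, mul_inv_cancel₀ hdet, one_smul]
    rw [gradForm, this, Matrix.smul_mul, Matrix.trace_smul, Matrix.mul_vecMulVec,
      Matrix.trace_vecMulVec, ← hy, dotProduct_comm, ← hw, hz, smul_eq_mul]
    ring
  have h2 : w.im ≤ 0 := by
    have h3 : w = star y ⬝ᵥ A.mulVec y - Complex.I * (star y ⬝ᵥ W.mulVec y) := by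
      have hHs : H.conjTranspose = A - Complex.I • W := by
        rw [hH, Matrix.conjTranspose_add, Matrix.conjTranspose_smul, hA.eq, hW.1.eq]
        simp [sub_eq_add_neg]
      rw [hw, hv, Matrix.star_mulVec, ← Matrix.dotProduct_mulVec, hHs, Matrix.sub_mulVec,
        dotProduct_sub, Matrix.smul_mulVec, dotProduct_smul, smul_eq_mul]
    have h5 : 0 ≤ (star y ⬝ᵥ W.mulVec y).re := by
      have := hW.posSemidef.dotProduct_mulVec_nonneg y
      exact (Complex.le_def.1 this).1
    rw [h3]
    simp [im_star_dotProduct_mulVec hA]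
    exact h5
  rw [h1]
  -- The terms with Re w cancel, and the coefficient of Im w is -(Im z + (Re z)²/Im z) = -|z|²/Im z.
  have h6 : (z * w).re - z.re / z.im * (z * w).im = -(Complex.normSq z * w.im) / z.im := by
    rw [Complex.normSq_apply, Complex.mul_re, Complex.mul_im]
    field_simp
    ring
  rw [h6]
  exact div_nonneg (by nlinarith [Complex.normSq_nonneg z]) him.le

/-- The linearization of the determinant scales under congruence by the same factor as the
determinant itself, so `linRatio` is chart independent like `ratio`. -/
theorem trace_adjugate_conj (P Q H K : Matrix (Fin n) (Fin n) ℂ) :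
    ((P * H * Q).adjugate * (P * K * Q)).trace = P.det * Q.det * (H.adjugate * K).trace := by
  have h : (P * H * Q).adjugate * (P * K * Q) = P.det • (Q.adjugate * (H.adjugate * K) * Q) := by
    rw [Matrix.adjugate_mul_distrib, Matrix.adjugate_mul_distrib]
    simp only [Matrix.mul_assoc]
    rw [← Matrix.mul_assoc P.adjugate P, Matrix.adjugate_mul]
    simp
  rw [h, Matrix.trace_smul, Matrix.trace_mul_comm, ← Matrix.mul_assoc, Matrix.mul_adjugate]
  simp [mul_assoc]

end Algebra

/-! ### Chart-independent quotients and the density of Ωⁿ -/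

section Intrinsic

variable {n : ℕ} {X : Type*} [TopologicalSpace X] [ChartedSpace (Fin n → ℂ) X]

/-- A real two-form is of type `(1,1)`. -/
def DForm.OneOne (β : DForm n X 2 ℝ) : Prop := ∀ x, IsOneOne (β.val x)

theorem IsClosedRealOneOne.isOneOne {β : DForm n X 2 ℝ} (h : IsClosedRealOneOne β) : β.OneOne :=
  fun x u v => h.oneOne x u v

/-- The matrix of the complex-valued form `β + iΩ` at `x`. -/
def cplxMatrix (β Ω : DForm n X 2 ℝ) (x : X) : Matrix (Fin n) (Fin n) ℂ :=
  hermMatrix β x + Complex.I • hermMatrix Ω x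

/-- The matrix of the complex-valued form `β + iΩ` in the chart `e`. -/
def cplxChart (β Ω : DForm n X 2 ℝ) (e : OpenPartialHomeomorph X (Fin n → ℂ))
    (y : Fin n → ℂ) : Matrix (Fin n) (Fin n) ℂ :=
  chartMatrix β e y + Complex.I • chartMatrix Ω e y

/-- The quotient `(β + iΩ)ⁿ / Ωⁿ`. -/
def ratio (β Ω : DForm n X 2 ℝ) (x : X) : ℂ := (cplxMatrix β Ω x).det / (hermMatrix Ω x).det

/-- The quotient `n (β + iΩ)ⁿ⁻¹ ∧ i∂∂̄ψ / Ωⁿ`. -/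
def linRatio (β Ω : DForm n X 2 ℝ) (ψ : X → ℝ) (x : X) : ℂ :=
  ((cplxMatrix β Ω x).adjugate * hermMatrix (iddbar n ψ) x).trace / (hermMatrix Ω x).det

/-- The density of `Ωⁿ` with respect to Lebesgue measure in the chart `e`. -/
def dens (Ω : DForm n X 2 ℝ) (e : OpenPartialHomeomorph X (Fin n → ℂ)) (y : Fin n → ℂ) : ℝ :=
  topConst n * (chartMatrix Ω e y).det.re

theorem hermMatrix_eq (β : DForm n X 2 ℝ) (x : X) : hermMatrix β x = herm (β.val x) := rfl

theorem posDef_hermMatrix {Ω : DForm n X 2 ℝ} (hΩ : IsKahlerForm Ω) (x : X) :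
    (hermMatrix Ω x).PosDef := by
  have h11 : IsOneOne (Ω.val x) := hΩ.toIsClosedRealOneOne.isOneOne x
  have hH : (herm (Ω.val x)).IsHermitian := isHermitian_herm h11
  refine Matrix.PosDef.of_dotProduct_mulVec_pos hH fun v hv => ?_
  have h := posDef_herm h11 (hΩ.pos x) (v := star v) (by simpa using hv)
  have h' : (∑ j, ∑ k, star v j * herm (Ω.val x) j k * star (star v k)) =
      star v ⬝ᵥ (herm (Ω.val x)).mulVec v := by
    simp [dotProduct, Matrix.mulVec, Finset.mul_sum, mul_assoc]
  rw [h'] at h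
  rw [Complex.lt_def]
  exact ⟨h, (im_star_dotProduct_mulVec hH v).symm⟩

variable [IsManifold 𝓘(ℂ, Fin n → ℂ) ω X]

theorem matCLM_injective {P Q : Matrix (Fin n) (Fin n) ℂ} (h : matCLM P = matCLM Q) : P = Q := by
  refine Matrix.toLin'.injective (LinearMap.ext fun v => ?_)
  simpa using congrArg (fun A => A v) h

/-- The chain rule over ℝ suffices, because a complex matrix is determined by the real-linear map it
induces. -/
theorem jacobian_comp {e c d : OpenPartialHomeomorph X (Fin n → ℂ)}
    (he : e ∈ atlas (Fin n → ℂ) X) (hc : c ∈ atlas (Fin n → ℂ) X)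
    (hd : d ∈ atlas (Fin n → ℂ) X) {y : Fin n → ℂ}
    (hy : y ∈ (e.symm ≫ₕ c).source) (hy' : y ∈ (e.symm ≫ₕ d).source) :
    jacobian e d y = jacobian c d (transition e c y) * jacobian e c y := by
  have h1 : y ∈ e.target ∧ e.symm y ∈ c.source := by simpa using hy
  have h2 : y ∈ e.target ∧ e.symm y ∈ d.source := by simpa using hy'
  have hcy : transition e c y ∈ c.target := c.map_source h1.2
  have hx : c.symm (transition e c y) = e.symm y := c.left_inv h1.2
  have hcd : transition e c y ∈ (c.symm ≫ₕ d).source := by simp [hcy, hx, h2.2]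
  apply matCLM_injective
  have h3 : matCLM (jacobian c d (transition e c y) * jacobian e c y) =
      (matCLM (jacobian c d (transition e c y))).comp (matCLM (jacobian e c y)) := by
    ext v : 1
    simp
  rw [h3, ← fderiv_transition he hd hy', ← fderiv_transition he hc hy, ← fderiv_transition hc hd hcd,
    ← fderiv_comp y ((contDiffAt_transition hc hd hcd).differentiableAt (by simp))
      ((contDiffAt_transition he hc hy).differentiableAt (by simp))]
  apply Filter.EventuallyEq.fderiv_eq
  filter_upwards [(e.symm ≫ₕ c).open_source.mem_nhds hy] with z hz
  have hz' : z ∈ e.target ∧ e.symm z ∈ c.source := by simpa using hz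
  simp [transition, c.left_inv hz'.2]

theorem jacobian_self {e : OpenPartialHomeomorph X (Fin n → ℂ)}
    (he : e ∈ atlas (Fin n → ℂ) X) {y : Fin n → ℂ} (hy : y ∈ e.target) : jacobian e e y = 1 := by
  apply matCLM_injective
  rw [← fderiv_transition he he (by simp [hy])]
  have h : transition e e =ᶠ[𝓝 y] id := by
    filter_upwards [e.open_target.mem_nhds hy] with z hz
    simp [transition, e.right_inv hz]
  rw [h.fderiv_eq, fderiv_id]
  ext v : 1
  simp

theorem det_jacobian_ne_zero {e c : OpenPartialHomeomorph X (Fin n → ℂ)}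
    (he : e ∈ atlas (Fin n → ℂ) X) (hc : c ∈ atlas (Fin n → ℂ) X) {y : Fin n → ℂ}
    (hy : y ∈ (e.symm ≫ₕ c).source) : (jacobian e c y).det ≠ 0 := by
  have h1 : y ∈ e.target ∧ e.symm y ∈ c.source := by simpa using hy
  have h := jacobian_comp he hc he hy (by simp [h1.1])
  rw [jacobian_self he h1.1] at h
  intro h0
  have := congrArg Matrix.det h
  simp [h0] at this

theorem DForm.val_eq_inChart {k : ℕ} {F : Type*} [NormedAddCommGroup F] [NormedSpace ℝ F]
    (η : DForm n X k F) (x : X) :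
    η.val x = η.inChart (chartAt (Fin n → ℂ) x) (chartAt (Fin n → ℂ) x x) := by
  have hx := mem_chart_source (Fin n → ℂ) x
  have hy := (chartAt (Fin n → ℂ) x).map_source hx
  rw [η.inChart_apply (chart_mem_atlas _ _) hy, (chartAt (Fin n → ℂ) x).left_inv hx,
    jacobian_self (chart_mem_atlas _ _) hy]
  ext v
  simp [ContinuousAlternatingMap.compContinuousLinearMap_apply, Function.comp_def]

variable {β Ω : DForm n X 2 ℝ}

theorem DForm.OneOne.inChart (hβ : β.OneOne) {e : OpenPartialHomeomorph X (Fin n → ℂ)}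
    (he : e ∈ atlas (Fin n → ℂ) X) {y : Fin n → ℂ} (hy : y ∈ e.target) :
    IsOneOne (β.inChart e y) := by
  rw [β.inChart_apply he hy]
  exact isOneOne_comp_matCLM (hβ _) _

theorem oneOne_iddbar {φ : X → ℝ} (hφ : ChartSmooth n φ) : (iddbar n φ).OneOne := by
  intro x
  have hx := mem_chart_source (Fin n → ℂ) x
  have hy := (chartAt (Fin n → ℂ) x).map_source hx
  have hc : chartAt (Fin n → ℂ) x ∈ atlas (Fin n → ℂ) X := chart_mem_atlas _ _
  rw [DForm.val_eq_inChart, inChart_iddbar hφ hc hy]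
  exact isOneOne_extDeriv_dcLocal (chartAt (Fin n → ℂ) x).open_target (hφ _ hc) hy

theorem chartMatrix_eq (hβ : β.OneOne) {e : OpenPartialHomeomorph X (Fin n → ℂ)}
    (he : e ∈ atlas (Fin n → ℂ) X) {y : Fin n → ℂ} (hy : y ∈ e.target) :
    chartMatrix β e y = (jacobian e (chartAt (Fin n → ℂ) (e.symm y)) y)ᵀ *
      hermMatrix β (e.symm y) * (jacobian e (chartAt (Fin n → ℂ) (e.symm y)) y).map star := by
  rw [chartMatrix, β.inChart_apply he hy, herm_comp_matCLM (hβ _)]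
  rfl

theorem chartMatrix_transition (hβ : β.OneOne) {e c : OpenPartialHomeomorph X (Fin n → ℂ)}
    (he : e ∈ atlas (Fin n → ℂ) X) (hc : c ∈ atlas (Fin n → ℂ) X) {y : Fin n → ℂ}
    (hy : y ∈ (e.symm ≫ₕ c).source) :
    chartMatrix β e y = (jacobian e c y)ᵀ *
      chartMatrix β c (transition e c y) * (jacobian e c y).map star := by
  have h1 : y ∈ e.target ∧ e.symm y ∈ c.source := by simpa using hy
  have hcy : transition e c y ∈ c.target := c.map_source h1.2
  rw [chartMatrix, β.inChart_transition he hc hy, fderiv_transition he hc hy,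
    herm_comp_matCLM (hβ.inChart hc hcy)]
  rfl

theorem det_map_star (P : Matrix (Fin n) (Fin n) ℂ) : (P.map star).det = star P.det := by
  have : P.map star = (Pᵀ)ᴴ := by ext; simp
  rw [this, Matrix.det_conjTranspose, Matrix.det_transpose]

theorem cplxChart_eq (hβ : β.OneOne) (hΩ : Ω.OneOne) {e : OpenPartialHomeomorph X (Fin n → ℂ)}
    (he : e ∈ atlas (Fin n → ℂ) X) {y : Fin n → ℂ} (hy : y ∈ e.target) :
    cplxChart β Ω e y = (jacobian e (chartAt (Fin n → ℂ) (e.symm y)) y)ᵀ *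
      cplxMatrix β Ω (e.symm y) * (jacobian e (chartAt (Fin n → ℂ) (e.symm y)) y).map star := by
  rw [cplxChart, chartMatrix_eq hβ he hy, chartMatrix_eq hΩ he hy, cplxMatrix]
  simp [Matrix.mul_add, Matrix.add_mul]

/-- Passing from the preferred chart at the point to e multiplies both determinants by |det P|², P
being the complex Jacobian; the factor cancels. -/
theorem ratio_symm (hβ : β.OneOne) (hΩ : Ω.OneOne) {e : OpenPartialHomeomorph X (Fin n → ℂ)}
    (he : e ∈ atlas (Fin n → ℂ) X) {y : Fin n → ℂ} (hy : y ∈ e.target) :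
    ratio β Ω (e.symm y) = (cplxChart β Ω e y).det / (chartMatrix Ω e y).det := by
  have hP := det_jacobian_ne_zero he (chart_mem_atlas (Fin n → ℂ) (e.symm y)) (y := y) (by simp [hy])
  rw [cplxChart_eq hβ hΩ he hy, chartMatrix_eq hΩ he hy, ratio]
  simp only [Matrix.det_mul, det_map_star, Matrix.det_transpose]
  have : star (jacobian e (chartAt (Fin n → ℂ) (e.symm y)) y).det ≠ 0 := by simpa using hP
  rw [mul_div_mul_right _ _ this, mul_div_mul_left _ _ hP]

theorem linRatio_symm (hβ : β.OneOne) (hΩ : Ω.OneOne) {ψ : X → ℝ} (hψ : ChartSmooth n ψ)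
    {e : OpenPartialHomeomorph X (Fin n → ℂ)}
    (he : e ∈ atlas (Fin n → ℂ) X) {y : Fin n → ℂ} (hy : y ∈ e.target) :
    linRatio β Ω ψ (e.symm y) =
      ((cplxChart β Ω e y).adjugate * hessC (ψ ∘ e.symm) y).trace / (chartMatrix Ω e y).det := by
  have hP := det_jacobian_ne_zero he (chart_mem_atlas (Fin n → ℂ) (e.symm y)) (y := y) (by simp [hy])
  have h2 : hessC (ψ ∘ e.symm) y = chartMatrix (iddbar n ψ) e y :=
    (herm_inChart_iddbar hψ he hy).symm
  rw [cplxChart_eq hβ hΩ he hy, chartMatrix_eq hΩ he hy, linRatio, h2,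
    chartMatrix_eq (oneOne_iddbar hψ) he hy, trace_adjugate_conj]
  simp only [Matrix.det_mul, det_map_star, Matrix.det_transpose]
  have : star (jacobian e (chartAt (Fin n → ℂ) (e.symm y)) y).det ≠ 0 := by simpa using hP
  field_simp

theorem det_chartMatrix (hΩ : IsKahlerForm Ω) {e : OpenPartialHomeomorph X (Fin n → ℂ)}
    (he : e ∈ atlas (Fin n → ℂ) X) {y : Fin n → ℂ} (hy : y ∈ e.target) :
    0 < (chartMatrix Ω e y).det := by
  have hP := det_jacobian_ne_zero he (chart_mem_atlas (Fin n → ℂ) (e.symm y)) (y := y) (by simp [hy])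
  rw [chartMatrix_eq hΩ.toIsClosedRealOneOne.isOneOne he hy]
  simp only [Matrix.det_mul, det_map_star, Matrix.det_transpose]
  rw [mul_right_comm, Complex.star_def, Complex.mul_conj]
  have h1 : (0 : ℂ) < (Complex.normSq
      (jacobian e (chartAt (Fin n → ℂ) (e.symm y)) y).det : ℂ) := by
    exact_mod_cast Complex.normSq_pos.2 hP
  exact mul_pos h1 (posDef_hermMatrix hΩ _).det_pos

theorem dens_pos (hΩ : IsKahlerForm Ω) {e : OpenPartialHomeomorph X (Fin n → ℂ)}
    (he : e ∈ atlas (Fin n → ℂ) X) {y : Fin n → ℂ} (hy : y ∈ e.target) : 0 < dens Ω e y :=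
  mul_pos (topConst_pos n) (Complex.lt_def.1 (det_chartMatrix hΩ he hy)).1

theorem ofReal_dens (hΩ : IsKahlerForm Ω) {e : OpenPartialHomeomorph X (Fin n → ℂ)}
    (he : e ∈ atlas (Fin n → ℂ) X) {y : Fin n → ℂ} (hy : y ∈ e.target) :
    (dens Ω e y : ℂ) = topConst n * (chartMatrix Ω e y).det := by
  have h := (Complex.lt_def.1 (det_chartMatrix hΩ he hy)).2
  rw [dens, Complex.ofReal_mul]
  congr 1
  exact Complex.ext rfl (by simpa using h)

/-- A complex-linear map P of ℂⁿ has real determinant |det P|², which is exactly the factor by which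
det of the matrix of Ω changes. -/
theorem dens_transition (hΩ : IsKahlerForm Ω) {e c : OpenPartialHomeomorph X (Fin n → ℂ)}
    (he : e ∈ atlas (Fin n → ℂ) X) (hc : c ∈ atlas (Fin n → ℂ) X) {y : Fin n → ℂ}
    (hy : y ∈ (e.symm ≫ₕ c).source) :
    dens Ω e y = |(fderiv ℝ (transition e c) y).det| * dens Ω c (transition e c y) := by
  have h1 : y ∈ e.target ∧ e.symm y ∈ c.source := by simpa using hy
  have hdet : (matCLM (jacobian e c y)).det = Complex.normSq (jacobian e c y).det := by
    rw [matCLM, ContinuousLinearMap.det]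
    have := LinearMap.det_restrictScalars (R := ℝ) (f := Matrix.toLin' (jacobian e c y))
    rw [LinearMap.det_toLin', Algebra.norm_complex_apply] at this
    exact this
  rw [fderiv_transition he hc hy, hdet, abs_of_nonneg (Complex.normSq_nonneg _)]
  have hcy : transition e c y ∈ c.target := c.map_source h1.2
  apply Complex.ofReal_injective
  rw [Complex.ofReal_mul, ofReal_dens hΩ he h1.1, ofReal_dens hΩ hc hcy,
    chartMatrix_transition hΩ.toIsClosedRealOneOne.isOneOne he hc hy]
  simp only [Matrix.det_mul, det_map_star, Matrix.det_transpose]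
  rw [← Complex.mul_conj, Complex.star_def]
  ring

theorem oneOne_apply_eq {a : (Fin n → ℂ) [⋀^Fin 2]→L[ℝ] ℝ} (ha : IsOneOne a) (u v : Fin n → ℂ) :
    (a ![u, v] : ℂ) = Complex.I * ∑ j, ∑ k, herm a j k * (u j * star (v k) - v j * star (u k)) := by
  have h1 : (a ![u, v] : ℂ) = Complex.I * (sesq a u v - sesq a v u) := by
    have h := ha.I_left v u
    rw [two_swap] at h
    simp only [sesq, two_swap a v u, neg_inj.1 h]
    push_cast
    linear_combination (a ![u, v] : ℂ) * Complex.I_sq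
  rw [h1, sesq_eq_sum ha, sesq_eq_sum ha, ← Finset.sum_sub_distrib]
  simp only [← Finset.sum_sub_distrib]
  congr 1
  exact Finset.sum_congr rfl fun _ _ => Finset.sum_congr rfl fun _ _ => by ring

/-- The real parts β and Ω are expanded separately through their Hermitian matrices; the resulting
identity is linear in the matrix, hence holds for the non-Hermitian matrix of β + iΩ. -/
theorem coeff_wedgePow (hβ : β.OneOne) (hΩ : Ω.OneOne) {e : OpenPartialHomeomorph X (Fin n → ℂ)}
    (he : e ∈ atlas (Fin n → ℂ) X) {y : Fin n → ℂ} (hy : y ∈ e.target) :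
    TopForm.coeff (fun x : X => wedgePow n (cplx β Ω x)) e y =
      (topConst n : ℂ) * (cplxChart β Ω e y).det := by
  refine wedgePow_apply_eq _ _ _ fun p q => ?_
  have h : ∀ γ : DForm n X 2 ℝ, γ (e.symm y) ![mfderiv 𝓘(ℝ, Fin n → ℂ) 𝓘(ℝ, Fin n → ℂ) e.symm y
        (stdFrame n p), mfderiv 𝓘(ℝ, Fin n → ℂ) 𝓘(ℝ, Fin n → ℂ) e.symm y (stdFrame n q)] =
      γ.inChart e y ![stdFrame n p, stdFrame n q] := fun γ => by
    refine congrArg (γ.val (e.symm y)) ?_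
    ext i : 1
    fin_cases i <;> rfl
  have h2 : cplx β Ω (e.symm y) ![mfderiv 𝓘(ℝ, Fin n → ℂ) 𝓘(ℝ, Fin n → ℂ) e.symm y
        (stdFrame n p), mfderiv 𝓘(ℝ, Fin n → ℂ) 𝓘(ℝ, Fin n → ℂ) e.symm y (stdFrame n q)] =
      (β.inChart e y ![stdFrame n p, stdFrame n q] : ℂ) +
        Complex.I * (Ω.inChart e y ![stdFrame n p, stdFrame n q] : ℂ) := by
    rw [← h, ← h]
    rfl
  rw [h2, oneOne_apply_eq (hβ.inChart he hy), oneOne_apply_eq (hΩ.inChart he hy)]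
  simp only [cplxChart, chartMatrix, Matrix.add_apply, Matrix.smul_apply, smul_eq_mul, add_mul,
    Finset.sum_add_distrib, mul_add]
  congr 2
  simp only [mul_assoc, ← Finset.mul_sum]

end Intrinsic

/-! ### Smoothness of determinants and adjugates -/

section MatrixCalculus

variable {n : ℕ} {E : Type*} [NormedAddCommGroup E] [NormedSpace ℝ E] {s : Set E} {k : ℕ∞ω}
  {M N : E → Matrix (Fin n) (Fin n) ℂ}

theorem contDiffOn_det (hM : ∀ i j, ContDiffOn ℝ k (fun y => M y i j) s) :
    ContDiffOn ℝ k (fun y => (M y).det) s := by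
  simp only [Matrix.det_apply]
  refine ContDiffOn.sum fun σ _ => ContDiffOn.const_smul _ ?_
  exact contDiffOn_prod fun i _ => hM _ _

theorem contDiffOn_adjugate (hM : ∀ i j, ContDiffOn ℝ k (fun y => M y i j) s) (i j : Fin n) :
    ContDiffOn ℝ k (fun y => (M y).adjugate i j) s := by
  simp only [Matrix.adjugate_apply]
  refine contDiffOn_det fun a b => ?_
  by_cases h : a = j
  · subst h
    simp only [Matrix.updateRow_self]
    exact contDiffOn_const
  · simp only [Matrix.updateRow_ne h]
    exact hM a b

theorem contDiffOn_trace_mul (hM : ∀ i j, ContDiffOn ℝ k (fun y => M y i j) s)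
    (hN : ∀ i j, ContDiffOn ℝ k (fun y => N y i j) s) :
    ContDiffOn ℝ k (fun y => (M y * N y).trace) s := by
  simp only [Matrix.trace, Matrix.diag, Matrix.mul_apply]
  exact ContDiffOn.sum fun i _ => ContDiffOn.sum fun j _ => (hM i j).mul (hN j i)

theorem contDiffOn_ofReal {f : E → ℝ} (hf : ContDiffOn ℝ k f s) :
    ContDiffOn ℝ k (fun y => (f y : ℂ)) s :=
  Complex.ofRealCLM.contDiff.comp_contDiffOn hf

end MatrixCalculus

/-! ### Integrability from compact support -/

section CompactSupport

variable {E F : Type*} [TopologicalSpace E] [T2Space E] [MeasurableSpace E] [BorelSpace E]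
  [NormedAddCommGroup F] {μ : Measure E} [IsFiniteMeasureOnCompacts μ]

theorem integrableOn_of_continuousOn_of_compact {U K : Set E} (hU : MeasurableSet U)
    (hK : IsCompact K) (hKU : K ⊆ U) {g : E → F} (hg : ContinuousOn g U)
    (h0 : ∀ y ∈ U, y ∉ K → g y = 0) : IntegrableOn g U μ :=
  ((hg.mono hKU).integrableOn_compact hK).of_forall_sdiff_eq_zero hU fun y hy => h0 y hy.1 hy.2

end CompactSupport

theorem integrable_of_continuous {X F : Type*} [TopologicalSpace X] [T2Space X] [CompactSpace X]
    [MeasurableSpace X] [BorelSpace X] [NormedAddCommGroup F] {μ : Measure X} [IsFiniteMeasure μ] {f : X → F}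
    (hf : Continuous f) : Integrable f μ := by
  rw [← integrableOn_univ]
  exact hf.continuousOn.integrableOn_compact isCompact_univ

/-! ### The measure of Ωⁿ and integration in a single chart -/

section Volume

variable {n : ℕ} {X : Type*} [TopologicalSpace X] [ChartedSpace (Fin n → ℂ) X]

theorem continuous_of_chart {F : Type*} [TopologicalSpace F] {f : X → F}
    (hf : ∀ e ∈ atlas (Fin n → ℂ) X, ContinuousOn (f ∘ e.symm) e.target) : Continuous f := by
  rw [continuous_iff_continuousAt]
  intro x
  set c := chartAt (Fin n → ℂ) x
  have hx : x ∈ c.source := mem_chart_source _ _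
  have h : ContinuousOn ((f ∘ c.symm) ∘ c) c.source :=
    (hf c (chart_mem_atlas _ _)).comp c.continuousOn fun z hz => c.map_source hz
  refine (h.continuousAt (c.open_source.mem_nhds hx)).congr ?_
  filter_upwards [c.open_source.mem_nhds hx] with z hz
  simp [c.left_inv hz]

theorem DForm.IsSmooth.contDiffOn_chartMatrix {β : DForm n X 2 ℝ} (hβ : β.IsSmooth)
    {e : OpenPartialHomeomorph X (Fin n → ℂ)} (he : e ∈ atlas (Fin n → ℂ) X) (j k : Fin n) :
    ContDiffOn ℝ ∞ (fun y => chartMatrix β e y j k) e.target := by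
  have h : ∀ v : Fin 2 → Fin n → ℂ, ContDiffOn ℝ ∞ (fun y => ((β.inChart e y v : ℝ) : ℂ)) e.target :=
    fun v => contDiffOn_ofReal
      ((ContinuousAlternatingMap.apply ℝ (Fin n → ℂ) ℝ v).contDiff.comp_contDiffOn (hβ e he))
  exact contDiffOn_const.mul ((h _).sub (contDiffOn_const.mul (h _)))

theorem contDiffOn_cplxChart {β Ω : DForm n X 2 ℝ} (hβ : β.IsSmooth) (hΩ : Ω.IsSmooth)
    {e : OpenPartialHomeomorph X (Fin n → ℂ)} (he : e ∈ atlas (Fin n → ℂ) X) (j k : Fin n) :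
    ContDiffOn ℝ ∞ (fun y => cplxChart β Ω e y j k) e.target :=
  (hβ.contDiffOn_chartMatrix he j k).add
    (contDiffOn_const.mul (hΩ.contDiffOn_chartMatrix he j k))

theorem continuousOn_dens {Ω : DForm n X 2 ℝ} (hΩ : Ω.IsSmooth)
    {e : OpenPartialHomeomorph X (Fin n → ℂ)} (he : e ∈ atlas (Fin n → ℂ) X) :
    ContinuousOn (dens Ω e) e.target :=
  continuousOn_const.mul (Complex.continuous_re.comp_continuousOn
    (contDiffOn_det (hΩ.contDiffOn_chartMatrix he)).continuousOn)

variable [T2Space X] [CompactSpace X] [IsManifold 𝓘(ℂ, Fin n → ℂ) ω X]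

theorem finite_chartPartition :
    {c : X | (Function.support (chartPartition n X c)).Nonempty}.Finite :=
  (chartPartition n X).locallyFinite.finite_nonempty_of_compact

/-- The finite set of indices of the nonzero functions in the partition of unity. -/
def chartIndex (n : ℕ) (X : Type*) [TopologicalSpace X] [T2Space X] [CompactSpace X]
    [ChartedSpace (Fin n → ℂ) X] [IsManifold 𝓘(ℂ, Fin n → ℂ) ω X] : Finset X :=
  (finite_chartPartition (n := n) (X := X)).toFinset

theorem chartPartition_eq_zero {c : X} (hc : c ∉ chartIndex n X) (x : X) :
    chartPartition n X c x = 0 := by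
  by_contra h
  exact hc ((finite_chartPartition).mem_toFinset.2 ⟨x, h⟩)

theorem sum_chartPartition (x : X) : ∑ c ∈ chartIndex n X, chartPartition n X c x = 1 := by
  rw [← (chartPartition n X).sum_eq_one (mem_univ x), finsum_eq_sum_of_support_subset]
  intro c hc
  by_contra h
  exact hc (chartPartition_eq_zero h x)

theorem tsupport_chartPartition (c : X) :
    tsupport (chartPartition n X c) ⊆ (chartAt (Fin n → ℂ) c).source :=
  (SmoothPartitionOfUnity.exists_isSubordinate_chartAt_source 𝓘(ℝ, Fin n → ℂ) X).choose_spec c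

theorem isCompact_image_tsupport (c : X) :
    IsCompact (chartAt (Fin n → ℂ) c '' tsupport (chartPartition n X c)) :=
  (isClosed_tsupport _).isCompact.image_of_continuousOn
    ((chartAt (Fin n → ℂ) c).continuousOn.mono (tsupport_chartPartition c))

theorem image_tsupport_subset (c : X) :
    chartAt (Fin n → ℂ) c '' tsupport (chartPartition n X c) ⊆ (chartAt (Fin n → ℂ) c).target := by
  rintro _ ⟨x, hx, rfl⟩
  exact (chartAt (Fin n → ℂ) c).map_source (tsupport_chartPartition c hx)

theorem chartPartition_symm_eq_zero {c : X} {y : Fin n → ℂ}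
    (hy : y ∈ (chartAt (Fin n → ℂ) c).target)
    (hy' : y ∉ chartAt (Fin n → ℂ) c '' tsupport (chartPartition n X c)) :
    chartPartition n X c ((chartAt (Fin n → ℂ) c).symm y) = 0 := by
  by_contra h
  exact hy' ⟨_, subset_tsupport _ h, (chartAt (Fin n → ℂ) c).right_inv hy⟩

theorem continuous_chartPartition (c : X) : Continuous (chartPartition n X c) :=
  (chartPartition n X c).contMDiff.continuous

theorem integral_eq_sum {F : Type*} [NormedAddCommGroup F] [NormedSpace ℝ F] (η : TopForm n X F) :
    η.integral = ∑ c ∈ chartIndex n X, ∫ y in (chartAt (Fin n → ℂ) c).target,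
      chartPartition n X c ((chartAt (Fin n → ℂ) c).symm y) • η.coeff (chartAt (Fin n → ℂ) c) y := by
  rw [TopForm.integral, finsum_eq_sum_of_support_subset]
  intro c hc
  by_contra h
  exact hc (by simp [chartPartition_eq_zero h])

/-- The weight of the chart at `c` in the volume measure. -/
def weight (Ω : DForm n X 2 ℝ) (c : X) (y : Fin n → ℂ) : ℝ :=
  chartPartition n X c ((chartAt (Fin n → ℂ) c).symm y) * dens Ω (chartAt (Fin n → ℂ) c) y

theorem continuousOn_weight {Ω : DForm n X 2 ℝ} (hΩ : Ω.IsSmooth) (c : X) :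
    ContinuousOn (weight Ω c) (chartAt (Fin n → ℂ) c).target :=
  ((continuous_chartPartition c).comp_continuousOn (chartAt (Fin n → ℂ) c).continuousOn_symm).mul
    (continuousOn_dens hΩ (chart_mem_atlas _ _))

theorem weight_nonneg {Ω : DForm n X 2 ℝ} (hΩ : IsKahlerForm Ω) {c : X} {y : Fin n → ℂ}
    (hy : y ∈ (chartAt (Fin n → ℂ) c).target) : 0 ≤ weight Ω c y :=
  mul_nonneg ((chartPartition n X).nonneg _ _) (dens_pos hΩ (chart_mem_atlas _ _) hy).le

theorem weight_eq_zero {Ω : DForm n X 2 ℝ} {c : X} {y : Fin n → ℂ}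
    (hy : y ∈ (chartAt (Fin n → ℂ) c).target)
    (hy' : y ∉ chartAt (Fin n → ℂ) c '' tsupport (chartPartition n X c)) : weight Ω c y = 0 := by
  rw [weight, chartPartition_symm_eq_zero hy hy', zero_mul]

theorem aemeasurable_weight {Ω : DForm n X 2 ℝ} (hΩ : Ω.IsSmooth) (c : X) :
    AEMeasurable (fun y => ENNReal.ofReal (weight Ω c y))
      (volume.restrict (chartAt (Fin n → ℂ) c).target) :=
  ((continuousOn_weight hΩ c).aemeasurable
    (chartAt (Fin n → ℂ) c).open_target.measurableSet).ennreal_ofReal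

theorem integrableOn_weight {Ω : DForm n X 2 ℝ} (hΩ : Ω.IsSmooth) (c : X) :
    IntegrableOn (weight Ω c) (chartAt (Fin n → ℂ) c).target :=
  integrableOn_of_continuousOn_of_compact (chartAt (Fin n → ℂ) c).open_target.measurableSet
    (isCompact_image_tsupport c) (image_tsupport_subset c) (continuousOn_weight hΩ c)
    fun _ hy hy' => weight_eq_zero hy hy'

variable [MeasurableSpace X]

/-- The part of the volume measure in the chart at `c`. -/
def chartVolume (Ω : DForm n X 2 ℝ) (c : X) : Measure X :=
  Measure.map (chartAt (Fin n → ℂ) c).symm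
    ((volume.restrict (chartAt (Fin n → ℂ) c).target).withDensity
      fun y => ENNReal.ofReal (weight Ω c y))

theorem isFiniteMeasure_chartVolume {Ω : DForm n X 2 ℝ} (hΩ : Ω.IsSmooth) (c : X) :
    IsFiniteMeasure (chartVolume Ω c) := by
  have : IsFiniteMeasure ((volume.restrict (chartAt (Fin n → ℂ) c).target).withDensity
      fun y => ENNReal.ofReal (weight Ω c y)) :=
    isFiniteMeasure_withDensity_ofReal (integrableOn_weight hΩ c).2
  unfold chartVolume
  infer_instance

/-- The measure on `X` given by the volume form `Ωⁿ`. -/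
def volMeasure (Ω : DForm n X 2 ℝ) : Measure X :=
  ∑ c ∈ chartIndex n X, chartVolume Ω c

theorem isFiniteMeasure_volMeasure {Ω : DForm n X 2 ℝ} (hΩ : Ω.IsSmooth) :
    IsFiniteMeasure (volMeasure Ω) := by
  have := isFiniteMeasure_chartVolume (X := X) hΩ
  unfold volMeasure
  infer_instance

variable [BorelSpace X]

theorem aemeasurable_chart_symm (Ω : DForm n X 2 ℝ) (c : X) :
    AEMeasurable (chartAt (Fin n → ℂ) c).symm
      ((volume.restrict (chartAt (Fin n → ℂ) c).target).withDensity
        fun y => ENNReal.ofReal (weight Ω c y)) :=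
  ((chartAt (Fin n → ℂ) c).continuousOn_symm.aemeasurable
    (chartAt (Fin n → ℂ) c).open_target.measurableSet).mono_ac
    (withDensity_absolutelyContinuous _ _)

variable {F : Type*} [NormedAddCommGroup F] [NormedSpace ℝ F] [SecondCountableTopology F]
  {Ω : DForm n X 2 ℝ}

theorem integral_volMeasure (hΩ : IsKahlerForm Ω) {f : X → F} (hf : Continuous f) :
    ∫ x, f x ∂volMeasure Ω = ∑ c ∈ chartIndex n X,
      ∫ y in (chartAt (Fin n → ℂ) c).target, weight Ω c y • f ((chartAt (Fin n → ℂ) c).symm y) := by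
  have hfin := isFiniteMeasure_chartVolume (X := X) hΩ.smooth
  rw [volMeasure, integral_finsetSum_measure fun c _ => integrable_of_continuous hf]
  refine Finset.sum_congr rfl fun c _ => ?_
  rw [chartVolume, integral_map (aemeasurable_chart_symm Ω c) hf.aestronglyMeasurable,
    integral_withDensity_eq_integral_toReal_smul₀ (aemeasurable_weight hΩ.smooth c) (by simp)]
  refine setIntegral_congr_fun (chartAt (Fin n → ℂ) c).open_target.measurableSet fun y hy => ?_
  simp only [ENNReal.toReal_ofReal (weight_nonneg hΩ hy)]

/-- The integral of a function supported in a chart. -/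
theorem integral_volMeasure_of_support (hΩ : IsKahlerForm Ω) {f : X → F} (hf : Continuous f)
    {e : OpenPartialHomeomorph X (Fin n → ℂ)} (he : e ∈ atlas (Fin n → ℂ) X) {K : Set X}
    (hK : IsCompact K) (hKe : K ⊆ e.source) (h0 : ∀ x ∉ K, f x = 0) :
    ∫ x, f x ∂volMeasure Ω = ∫ y in e.target, dens Ω e y • f (e.symm y) := by
  rw [integral_volMeasure hΩ hf]
  have hK' : IsCompact (e '' K) := hK.image_of_continuousOn (e.continuousOn.mono hKe)
  have hKt : e '' K ⊆ e.target := by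
    rintro _ ⟨x, hx, rfl⟩; exact e.map_source (hKe hx)
  have h0' : ∀ y ∈ e.target, y ∉ e '' K → f (e.symm y) = 0 := fun y hy hy' =>
    h0 _ fun h => hy' ⟨_, h, e.right_inv hy⟩
  have hfe : ContinuousOn (fun y => f (e.symm y)) e.target := hf.comp_continuousOn e.continuousOn_symm
  -- Each chart's share is carried to e by the transition map. Outside the overlap one integrand
  -- vanishes because f does, the other because the partition function does.
  have key : ∀ c : X, ∫ y in (chartAt (Fin n → ℂ) c).target,
      weight Ω c y • f ((chartAt (Fin n → ℂ) c).symm y) =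
      ∫ y in e.target, chartPartition n X c (e.symm y) • dens Ω e y • f (e.symm y) := fun c => by
    set d := chartAt (Fin n → ℂ) c with hd
    have hda : d ∈ atlas (Fin n → ℂ) X := chart_mem_atlas _ _
    set A := (e.symm ≫ₕ d).source with hA
    have hAm : MeasurableSet A := (e.symm ≫ₕ d).open_source.measurableSet
    have hAe : ∀ y, y ∈ A ↔ y ∈ e.target ∧ e.symm y ∈ d.source := fun y => by simp [hA]
    have himg : transition e d '' A = d.target ∩ d.symm ⁻¹' e.source := by
      have : transition e d '' A = (e.symm ≫ₕ d).target := (e.symm ≫ₕ d).image_source_eq_target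
      rw [this]
      simp
    have h1 : ∫ y in d.target, weight Ω c y • f (d.symm y) =
        ∫ y in transition e d '' A, weight Ω c y • f (d.symm y) := by
      rw [himg]
      refine setIntegral_eq_of_subset_of_forall_sdiff_eq_zero d.open_target.measurableSet
        inter_subset_left fun y hy => ?_
      have : d.symm y ∉ K := fun h => hy.2 ⟨hy.1, hKe h⟩
      rw [h0 _ this, smul_zero]
    have h2 : ∫ y in e.target, chartPartition n X c (e.symm y) • dens Ω e y • f (e.symm y) =
        ∫ y in A, chartPartition n X c (e.symm y) • dens Ω e y • f (e.symm y) := by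
      refine setIntegral_eq_of_subset_of_forall_sdiff_eq_zero e.open_target.measurableSet
        (fun y hy => ((hAe y).1 hy).1) fun y hy => ?_
      have h3 : e.symm y ∉ d.source := fun h => hy.2 ((hAe y).2 ⟨hy.1, h⟩)
      have h4 : chartPartition n X c (e.symm y) = 0 := by
        by_contra h
        exact h3 (tsupport_chartPartition c (subset_tsupport _ h))
      rw [h4, zero_smul]
    -- Change of variables on the overlap; the Jacobian factor is absorbed by `dens_transition`.
    rw [h1, h2, integral_image_eq_integral_abs_det_fderiv_smul volume hAm
      (f' := fderiv ℝ (transition e d))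
      (fun y hy => ((contDiffAt_transition he hda hy).differentiableAt
        (by simp)).hasFDerivAt.hasFDerivWithinAt)
      (e.symm ≫ₕ d).injOn]
    refine setIntegral_congr_fun hAm fun y hy => ?_
    have hs : d.symm (transition e d y) = e.symm y := d.left_inv ((hAe y).1 hy).2
    simp only [weight, ← hd, hs, dens_transition hΩ he hda hy, smul_smul]
    congr 1
    ring
  rw [Finset.sum_congr rfl fun c _ => key c, ← integral_finsetSum]
  · refine setIntegral_congr_fun e.open_target.measurableSet fun y _ => ?_
    simp only [← Finset.sum_smul, sum_chartPartition, one_smul]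
  · intro c _
    refine integrableOn_of_continuousOn_of_compact e.open_target.measurableSet hK' hKt ?_ ?_
    · exact ((continuous_chartPartition c).comp_continuousOn e.continuousOn_symm).smul
        ((continuousOn_dens hΩ.smooth he).smul hfe)
    · intro y hy hy'
      rw [h0' y hy hy', smul_zero, smul_zero]

end Volume

/-! ### Jacobi's formula for the derivative of a determinant -/

section DetDeriv

variable {n : ℕ} {E : Type*} [NormedAddCommGroup E] [NormedSpace ℝ E]

/-- The determinant as a real multilinear function of the rows. -/
def detMultilinear (n : ℕ) : ContinuousMultilinearMap ℝ (fun _ : Fin n => Fin n → ℂ) ℂ where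
  toMultilinearMap :=
    (Matrix.detRowAlternating (n := Fin n) (R := ℂ)).toMultilinearMap.restrictScalars ℝ
  cont := Continuous.matrix_det (A := fun M : Matrix (Fin n) (Fin n) ℂ => M) continuous_id

theorem sum_adjugate_mul (M : Matrix (Fin n) (Fin n) ℂ) (a : Fin n) (r : Fin n → ℂ) :
    ∑ b, M.adjugate b a * r b = (M.updateRow a r).det := by
  rw [← Matrix.det_transpose, ← Matrix.updateCol_transpose, ← Matrix.cramer_apply,
    Matrix.cramer_eq_adjugate_mulVec, ← Matrix.adjugate_transpose]
  rfl

/-- Differentiation of a multilinear function of the rows replaces one row at a time; expanding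
along that row produces the adjugate. -/
theorem hasFDerivAt_det {M : E → Matrix (Fin n) (Fin n) ℂ} {M' : Fin n → Fin n → (E →L[ℝ] ℂ)}
    {y : E} (hM : ∀ i j, HasFDerivAt (fun y => M y i j) (M' i j) y) :
    HasFDerivAt (fun y => (M y).det)
      (∑ a, ∑ b, (M y).adjugate b a • M' a b) y := by
  have h1 : HasFDerivAt (fun y => (fun i j => M y i j : Fin n → Fin n → ℂ))
      (ContinuousLinearMap.pi fun i => ContinuousLinearMap.pi fun j => M' i j) y :=
    hasFDerivAt_pi.2 fun i => hasFDerivAt_pi.2 fun j => hM i j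
  have h2 := ((detMultilinear n).hasFDerivAt (fun i j => M y i j)).comp y h1
  refine h2.congr_fderiv ?_
  ext v
  simp only [ContinuousLinearMap.comp_apply, ContinuousMultilinearMap.linearDeriv_apply,
    sum_apply, smul_apply, smul_eq_mul]
  refine Finset.sum_congr rfl fun a _ => ?_
  have h3 : detMultilinear n (Function.update (fun i j => M y i j) a
      ((ContinuousLinearMap.pi fun i => ContinuousLinearMap.pi fun j => M' i j) v a)) =
      ((M y).updateRow a (fun b => M' a b v)).det := rfl
  rw [h3]
  exact (sum_adjugate_mul (M y) a fun b => M' a b v).symm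

end DetDeriv

/-! ### Wirtinger derivatives (c = -i gives ∂, c = i gives ∂̄) and divergence-free cofactors -/

section Wirtinger

variable {n : ℕ}

/-- The Wirtinger-type derivative `(∂_v f + c ∂_{iv} f) / 2`. -/
def wirt (c : ℂ) (f : (Fin n → ℂ) → ℂ) (y v : Fin n → ℂ) : ℂ :=
  (1 / 2 : ℂ) * (fderiv ℝ f y v + c * fderiv ℝ f y (Complex.I • v))

theorem wirt_mul {c : ℂ} {f g : (Fin n → ℂ) → ℂ} {y : Fin n → ℂ} (hf : DifferentiableAt ℝ f y)
    (hg : DifferentiableAt ℝ g y) (v : Fin n → ℂ) :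
    wirt c (fun z => f z * g z) y v = wirt c f y v * g y + f y * wirt c g y v := by
  simp only [wirt, fderiv_fun_mul hf hg, add_apply,
    smul_apply, smul_eq_mul]
  ring

theorem wirt_const_mul {c : ℂ} {f : (Fin n → ℂ) → ℂ} {y : Fin n → ℂ}
    (hf : DifferentiableAt ℝ f y) (a : ℂ) (v : Fin n → ℂ) :
    wirt c (fun z => a * f z) y v = a * wirt c f y v := by
  rw [wirt_mul (differentiableAt_const a) hf]
  simp [wirt]

theorem wirt_det {c : ℂ} {M : (Fin n → ℂ) → Matrix (Fin n) (Fin n) ℂ} {y : Fin n → ℂ}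
    (hM : ∀ i j, DifferentiableAt ℝ (fun y => M y i j) y) (v : Fin n → ℂ) :
    wirt c (fun y => (M y).det) y v =
      ∑ a, ((M y).updateRow a fun b => wirt c (fun z => M z a b) y v).det := by
  simp only [wirt, (hasFDerivAt_det fun i j => (hM i j).hasFDerivAt).fderiv,
    sum_apply, smul_apply, smul_eq_mul, ← sum_adjugate_mul]
  simp only [Finset.mul_sum, ← Finset.sum_add_distrib]
  exact Finset.sum_congr rfl fun _ _ => Finset.sum_congr rfl fun _ _ => by ring

/-- The cofactors of a matrix with `d`-closed columns are divergence free. -/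
theorem sum_wirt_adjugate {c : ℂ} {M : (Fin n → ℂ) → Matrix (Fin n) (Fin n) ℂ} {y : Fin n → ℂ}
    (hM : ∀ i j, DifferentiableAt ℝ (fun y => M y i j) y)
    (hcl : ∀ l j k, wirt c (fun z => M z j k) y (frame l) = wirt c (fun z => M z l k) y (frame j))
    (k : Fin n) : ∑ j, wirt c (fun z => (M z).adjugate k j) y (frame j) = 0 := by
  let G : Fin n → Fin n → Fin n → ℂ := fun j a b => wirt c (fun z => M z a b) y (frame j)
  -- The cofactor is the determinant with row j replaced by a constant unit row. Its derivative is a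
  -- sum over the other rows a, each replaced by its derivative in the direction j; the term a = j
  -- vanishes.
  let T : Fin n → Fin n → ℂ := fun j a => if a = j then 0 else
    (((M y).updateRow j (Pi.single k 1)).updateRow a (G j a)).det
  have h1 : ∀ j, wirt c (fun z => (M z).adjugate k j) y (frame j) = ∑ a, T j a := fun j => by
    simp only [Matrix.adjugate_apply]
    rw [wirt_det]
    · refine Finset.sum_congr rfl fun a _ => ?_
      by_cases h : a = j
      · subst h
        simp only [T, if_true, Matrix.updateRow_self]
        refine Matrix.det_eq_zero_of_row_eq_zero a fun b => ?_
        simp [wirt]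
      · simp only [T, h, if_false, Matrix.updateRow_ne h, G]
    · intro a b
      by_cases h : a = j
      · subst h
        simp only [Matrix.updateRow_self]
        exact differentiableAt_const _
      · simp only [Matrix.updateRow_ne h]
        exact hM a b
  -- By closedness the derivative of row a in direction j equals that of row j in direction a, so
  -- exchanging j and a amounts to swapping two rows. Antisymmetry then kills the double sum.
  have h2 : ∀ j a, T j a = -T a j := fun j a => by
    by_cases h : a = j
    · subst h; simp [T]
    have h' : j ≠ a := fun e => h e.symm
    have hG : G j a = G a j := funext fun b => hcl j a b
    simp only [T, h, h', if_false]
    have h3 : ((M y).updateRow j (Pi.single k 1)).updateRow a (G j a) =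
        (((M y).updateRow a (Pi.single k 1)).updateRow j (G a j)).submatrix (Equiv.swap a j) id := by
      ext i b
      rw [Matrix.submatrix_apply, hG]
      by_cases hi : i = a
      · subst hi
        simp
      by_cases hj : i = j
      · subst hj
        simp [Matrix.updateRow_ne h', Matrix.updateRow_ne h]
      · rw [Equiv.swap_apply_of_ne_of_ne hi hj]
        simp [Matrix.updateRow_ne hi, Matrix.updateRow_ne hj]
    rw [h3, Matrix.det_permute, Equiv.Perm.sign_swap h]
    simp
  rw [Finset.sum_congr rfl fun j _ => h1 j]
  have h4 : ∑ j, ∑ a, T j a = -∑ j, ∑ a, T j a := by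
    conv_lhs => rw [Finset.sum_comm]
    rw [← Finset.sum_neg_distrib]
    refine Finset.sum_congr rfl fun a _ => ?_
    rw [← Finset.sum_neg_distrib]
    exact Finset.sum_congr rfl fun j _ => h2 j a
  exact self_eq_neg.1 h4

theorem contDiffOn_wirt {U : Set (Fin n → ℂ)} (hU : IsOpen U) {f : (Fin n → ℂ) → ℂ}
    (hf : ContDiffOn ℝ ∞ f U) (c : ℂ) (v : Fin n → ℂ) :
    ContDiffOn ℝ ∞ (fun y => wirt c f y v) U := by
  have h : ContDiffOn ℝ ∞ (fderiv ℝ f) U := hf.fderiv_of_isOpen hU (by simp)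
  have h' : ∀ v, ContDiffOn ℝ ∞ (fun y => fderiv ℝ f y v) U := fun v => h.clm_apply contDiffOn_const
  exact contDiffOn_const.mul ((h' _).add (contDiffOn_const.mul (h' _)))

theorem fderiv_ofReal_comp {f : (Fin n → ℂ) → ℝ} {y : Fin n → ℂ} (hf : DifferentiableAt ℝ f y)
    (v : Fin n → ℂ) : fderiv ℝ (fun z => (f z : ℂ)) y v = (fderiv ℝ f y v : ℂ) := by
  have := (Complex.ofRealCLM.hasFDerivAt.comp y hf.hasFDerivAt).fderiv
  exact congrArg (fun A : (Fin n → ℂ) →L[ℝ] ℂ => A v) this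

theorem wirt_ofReal {f : (Fin n → ℂ) → ℝ} {y : Fin n → ℂ} (hf : DifferentiableAt ℝ f y) (c : ℂ)
    (v : Fin n → ℂ) : wirt c (fun z => (f z : ℂ)) y v =
      (1 / 2 : ℂ) * ((fderiv ℝ f y v : ℂ) + c * (fderiv ℝ f y (Complex.I • v) : ℂ)) := by
  rw [wirt, fderiv_ofReal_comp hf, fderiv_ofReal_comp hf]

theorem wirt_wirt {U : Set (Fin n → ℂ)} (hU : IsOpen U) {f : (Fin n → ℂ) → ℝ}
    (hf : ContDiffOn ℝ ∞ f U) {y : Fin n → ℂ} (hy : y ∈ U) (c d : ℂ) (u v : Fin n → ℂ) :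
    wirt c (fun z => wirt d (fun w => (f w : ℂ)) z v) y u = (1 / 4 : ℂ) *
      (secondDeriv f y u v + d * secondDeriv f y u (Complex.I • v) +
        c * (secondDeriv f y (Complex.I • u) v +
          d * secondDeriv f y (Complex.I • u) (Complex.I • v))) := by
  have h : ContDiffOn ℝ ∞ (fderiv ℝ f) U := hf.fderiv_of_isOpen hU (by simp)
  have h' : ∀ v, DifferentiableAt ℝ (fun y => fderiv ℝ f y v) y := fun v =>
    ((h.clm_apply contDiffOn_const).contDiffAt (hU.mem_nhds hy)).differentiableAt (by simp)
  have h1 : (fun z => wirt d (fun w => (f w : ℂ)) z v) =ᶠ[𝓝 y] fun z => (1 / 2 : ℂ) *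
      ((fderiv ℝ f z v : ℂ) + d * (fderiv ℝ f z (Complex.I • v) : ℂ)) := by
    filter_upwards [hU.mem_nhds hy] with z hz
    exact wirt_ofReal ((hf.contDiffAt (hU.mem_nhds hz)).differentiableAt (by simp)) _ _
  have h2 : ∀ v, HasFDerivAt (fun z => ((fderiv ℝ f z v : ℝ) : ℂ))
      (Complex.ofRealCLM.comp (fderiv ℝ (fun z => fderiv ℝ f z v) y)) y := fun v =>
    Complex.ofRealCLM.hasFDerivAt.comp y (h' v).hasFDerivAt
  have h3 : fderiv ℝ (fun z => (1 / 2 : ℂ) *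
      ((fderiv ℝ f z v : ℂ) + d * (fderiv ℝ f z (Complex.I • v) : ℂ))) y = _ := (((h2 v).add ((h2 (Complex.I • v)).const_mul d)).const_mul (1 / 2 : ℂ)).fderiv
  rw [wirt, h1.fderiv_eq, h3]
  simp only [smul_apply, add_apply,
    ContinuousLinearMap.comp_apply, Complex.ofRealCLM_apply, smul_eq_mul, secondDeriv]
  ring

theorem hessC_apply {U : Set (Fin n → ℂ)} (hU : IsOpen U) {f : (Fin n → ℂ) → ℝ}
    (hf : ContDiffOn ℝ ∞ f U) {y : Fin n → ℂ} (hy : y ∈ U) (j k : Fin n) :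
    hessC f y j k = wirt (-Complex.I)
      (fun z => wirt Complex.I (fun w => (f w : ℂ)) z (frame k)) y (frame j) := by
  rw [wirt_wirt hU hf hy, hessC, Matrix.of_apply]
  push_cast
  linear_combination (1 / 4 : ℂ) *
    (secondDeriv f y (Complex.I • frame j) (Complex.I • frame k) : ℂ) * Complex.I_sq

theorem hessC_apply' {U : Set (Fin n → ℂ)} (hU : IsOpen U) {f : (Fin n → ℂ) → ℝ}
    (hf : ContDiffOn ℝ ∞ f U) {y : Fin n → ℂ} (hy : y ∈ U) (j k : Fin n) :
    hessC f y j k = wirt Complex.I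
      (fun z => wirt (-Complex.I) (fun w => (f w : ℂ)) z (frame j)) y (frame k) := by
  have hs := secondDeriv_symm (hf.contDiffAt (hU.mem_nhds hy))
  rw [wirt_wirt hU hf hy, hessC, Matrix.of_apply, hs (frame k), hs (frame k),
    hs (Complex.I • frame k), hs (Complex.I • frame k)]
  push_cast
  linear_combination (1 / 4 : ℂ) *
    (secondDeriv f y (Complex.I • frame j) (Complex.I • frame k) : ℂ) * Complex.I_sq

end Wirtinger

/-! ### Integration by parts in a coordinate domain -/

section Divergence

variable {n : ℕ}

/-- Integration by parts against the constant function 1. -/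
theorem integral_fderiv_apply_eq_zero {g : (Fin n → ℂ) → ℂ} (hg : ContDiff ℝ 1 g)
    (hc : HasCompactSupport g) (v : Fin n → ℂ) : ∫ y, fderiv ℝ g y v = 0 := by
  have h1 : Integrable g := hg.continuous.integrable_of_hasCompactSupport hc
  have h2 : Integrable (fun y => fderiv ℝ g y v) :=
    ((hg.continuous_fderiv one_ne_zero).clm_apply continuous_const).integrable_of_hasCompactSupport
      ((hc.fderiv ℝ).comp_left (g := fun A : (Fin n → ℂ) →L[ℝ] ℂ => A v) (by simp))
  have h := integral_smul_fderiv_eq_neg_fderiv_smul_of_integrable (μ := volume)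
    (f := fun _ : Fin n → ℂ => (1 : ℝ)) (g := g) (v := v) (by simp) (by simpa using h2)
    (by simpa using h1) (fun _ _ => differentiableAt_const _)
    (fun x _ => (hg.differentiable one_ne_zero) x)
  simpa using h

variable {U K : Set (Fin n → ℂ)} {f : (Fin n → ℂ) → ℂ}

/-- As K is compact inside U, extension of f by zero is smooth on all of ℂⁿ with compact support,
whatever values f takes outside U. -/
theorem integral_fderiv_of_compact (hU : IsOpen U) (hK : IsCompact K) (hKU : K ⊆ U)
    (hf : ContDiffOn ℝ ∞ f U) (h0 : ∀ y ∈ U, y ∉ K → f y = 0) (v : Fin n → ℂ) :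
    ∫ y in U, fderiv ℝ f y v = 0 := by
  have h1 : ∀ y ∈ U, U.indicator f =ᶠ[𝓝 y] f := fun y hy => by
    filter_upwards [hU.mem_nhds hy] with z hz using indicator_of_mem hz f
  have hz : ∀ z ∉ K, U.indicator f z = 0 := fun z hz => by
    by_cases hzU : z ∈ U
    · rw [indicator_of_mem hzU, h0 z hzU hz]
    · exact indicator_of_notMem hzU f
  have h2 : ∀ y ∉ K, U.indicator f =ᶠ[𝓝 y] fun _ => 0 := fun y hy => by
    filter_upwards [hK.isClosed.isOpen_compl.mem_nhds hy] with z hz' using hz z hz'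
  have hg : ContDiff ℝ ∞ (U.indicator f) := contDiff_iff_contDiffAt.2 fun y => by
    by_cases hy : y ∈ K
    · exact (hf.contDiffAt (hU.mem_nhds (hKU hy))).congr_of_eventuallyEq (h1 y (hKU hy))
    · exact contDiffAt_const.congr_of_eventuallyEq (h2 y hy)
  have h3 : ∫ y in U, fderiv ℝ f y v = ∫ y in U, fderiv ℝ (U.indicator f) y v :=
    setIntegral_congr_fun hU.measurableSet fun y hy => by
      simp only [(h1 y hy).fderiv_eq]
  rw [h3, setIntegral_eq_integral_of_forall_compl_eq_zero fun y hy => ?_]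
  · exact integral_fderiv_apply_eq_zero (hg.of_le (WithTop.coe_le_coe.2 le_top))
      (HasCompactSupport.intro hK hz) v
  · rw [(h2 y fun h => hy (hKU h)).fderiv_eq]
    simp

theorem wirt_eq_zero_of_notMem (hU : IsOpen U) (hK : IsCompact K)
    (h0 : ∀ y ∈ U, y ∉ K → f y = 0) {y : Fin n → ℂ} (hy : y ∈ U) (hy' : y ∉ K) (c : ℂ)
    (v : Fin n → ℂ) : wirt c f y v = 0 := by
  have : f =ᶠ[𝓝 y] fun _ => 0 := by
    filter_upwards [hU.mem_nhds hy, hK.isClosed.isOpen_compl.mem_nhds hy'] with z h1 h2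
      using h0 z h1 h2
  simp [wirt, this.fderiv_eq]

theorem integrableOn_of_contDiffOn (hU : IsOpen U) (hK : IsCompact K) (hKU : K ⊆ U)
    (hf : ContDiffOn ℝ ∞ f U) (h0 : ∀ y ∈ U, y ∉ K → f y = 0) : IntegrableOn f U :=
  integrableOn_of_continuousOn_of_compact hU.measurableSet hK hKU hf.continuousOn h0

theorem integral_wirt_eq_zero (hU : IsOpen U) (hK : IsCompact K) (hKU : K ⊆ U)
    (hf : ContDiffOn ℝ ∞ f U) (h0 : ∀ y ∈ U, y ∉ K → f y = 0) (c : ℂ) (v : Fin n → ℂ) :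
    ∫ y in U, wirt c f y v = 0 := by
  have hint : ∀ v, IntegrableOn (fun y => fderiv ℝ f y v) U := fun v => by
    refine integrableOn_of_contDiffOn hU hK hKU
      ((hf.fderiv_of_isOpen hU (by simp)).clm_apply contDiffOn_const) fun y hy hy' => ?_
    have : f =ᶠ[𝓝 y] fun _ => 0 := by
      filter_upwards [hU.mem_nhds hy, hK.isClosed.isOpen_compl.mem_nhds hy'] with z h1 h2
        using h0 z h1 h2
    simp [this.fderiv_eq]
  simp only [wirt]
  rw [integral_const_mul, integral_add (hint v) ((hint _).const_mul c), integral_const_mul,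
    integral_fderiv_of_compact hU hK hKU hf h0, integral_fderiv_of_compact hU hK hKU hf h0]
  simp

/-- Symmetry of the linearized operator for functions with compact support in a coordinate
domain. -/
theorem integral_trace_hessC_symm (hU : IsOpen U) (hK : IsCompact K) (hKU : K ⊆ U)
    {M : (Fin n → ℂ) → Matrix (Fin n) (Fin n) ℂ}
    (hM : ∀ i j, ContDiffOn ℝ ∞ (fun y => M y i j) U)
    (hcl : ∀ y ∈ U, ∀ l j k, wirt (-Complex.I) (fun z => M z j k) y (frame l) =
      wirt (-Complex.I) (fun z => M z l k) y (frame j))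
    (hcl' : ∀ y ∈ U, ∀ l j k, wirt Complex.I (fun z => M z j k) y (frame l) =
      wirt Complex.I (fun z => M z j l) y (frame k))
    {f g : (Fin n → ℂ) → ℝ} (hf : ContDiffOn ℝ ∞ f U) (hg : ContDiffOn ℝ ∞ g U)
    (h0 : ∀ y ∈ U, y ∉ K → f y = 0) :
    ∫ y in U, ((f y : ℂ) * ((M y).adjugate * hessC g y).trace -
      (g y : ℂ) * ((M y).adjugate * hessC f y).trace) = 0 := by
  have hA := contDiffOn_adjugate hM
  have hf' := contDiffOn_ofReal hf
  have hg' := contDiffOn_ofReal hg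
  have hdg : ∀ k, ContDiffOn ℝ ∞ (fun y => wirt Complex.I (fun w => (g w : ℂ)) y (frame k)) U :=
    fun k => contDiffOn_wirt hU hg' _ _
  have hdf : ∀ j, ContDiffOn ℝ ∞ (fun y => wirt (-Complex.I) (fun w => (f w : ℂ)) y (frame j)) U :=
    fun j => contDiffOn_wirt hU hf' _ _
  have h0' : ∀ y ∈ U, y ∉ K → (f y : ℂ) = 0 := fun y hy hy' => by simp [h0 y hy hy']
  -- The components f A ∂̄g and g A ∂f of two vector fields, with A = adj M. Both vanish outside K
  -- because f does, so g may be arbitrary.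
  let P : Fin n → Fin n → (Fin n → ℂ) → ℂ := fun j k y =>
    (f y : ℂ) * ((M y).adjugate k j * wirt Complex.I (fun w => (g w : ℂ)) y (frame k))
  let Q : Fin n → Fin n → (Fin n → ℂ) → ℂ := fun j k y =>
    (g y : ℂ) * ((M y).adjugate k j * wirt (-Complex.I) (fun w => (f w : ℂ)) y (frame j))
  have hP : ∀ j k, ContDiffOn ℝ ∞ (P j k) U := fun j k => hf'.mul ((hA k j).mul (hdg k))
  have hQ : ∀ j k, ContDiffOn ℝ ∞ (Q j k) U := fun j k => hg'.mul ((hA k j).mul (hdf j))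
  have hP0 : ∀ j k, ∀ y ∈ U, y ∉ K → P j k y = 0 := fun j k y hy hy' => by
    simp [P, h0 y hy hy']
  have hQ0 : ∀ j k, ∀ y ∈ U, y ∉ K → Q j k y = 0 := fun j k y hy hy' => by
    simp only [Q]
    rw [wirt_eq_zero_of_notMem hU hK h0' hy hy', mul_zero, mul_zero]
  -- The ∂-divergence of the first field minus the ∂̄-divergence of the second: derivatives falling
  -- on A sum to zero, and the products of first derivatives of f and g agree and cancel.
  have hpt : ∀ y ∈ U, (f y : ℂ) * ((M y).adjugate * hessC g y).trace -
      (g y : ℂ) * ((M y).adjugate * hessC f y).trace =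
      ∑ j, ∑ k, (wirt (-Complex.I) (P j k) y (frame j) - wirt Complex.I (Q j k) y (frame k)) := by
    intro y hy
    have hD : ∀ {F : (Fin n → ℂ) → ℂ}, ContDiffOn ℝ ∞ F U → DifferentiableAt ℝ F y := fun h =>
      (h.contDiffAt (hU.mem_nhds hy)).differentiableAt (by simp)
    have hMd : ∀ i j, DifferentiableAt ℝ (fun y => M y i j) y := fun i j => hD (hM i j)
    have e1 : ∀ j k, wirt (-Complex.I) (P j k) y (frame j) =
        wirt (-Complex.I) (fun w => (f w : ℂ)) y (frame j) *
          ((M y).adjugate k j * wirt Complex.I (fun w => (g w : ℂ)) y (frame k)) +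
        (f y : ℂ) * wirt Complex.I (fun w => (g w : ℂ)) y (frame k) *
          wirt (-Complex.I) (fun z => (M z).adjugate k j) y (frame j) +
        (f y : ℂ) * ((M y).adjugate k j * hessC g y j k) := fun j k => by
      rw [wirt_mul (hD hf') (hD ((hA k j).mul (hdg k))), wirt_mul (hD (hA k j)) (hD (hdg k)),
        hessC_apply hU hg hy]
      ring
    have e2 : ∀ j k, wirt Complex.I (Q j k) y (frame k) =
        wirt Complex.I (fun w => (g w : ℂ)) y (frame k) *
          ((M y).adjugate k j * wirt (-Complex.I) (fun w => (f w : ℂ)) y (frame j)) +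
        (g y : ℂ) * wirt (-Complex.I) (fun w => (f w : ℂ)) y (frame j) *
          wirt Complex.I (fun z => (M z).adjugate k j) y (frame k) +
        (g y : ℂ) * ((M y).adjugate k j * hessC f y j k) := fun j k => by
      rw [wirt_mul (hD hg') (hD ((hA k j).mul (hdf j))), wirt_mul (hD (hA k j)) (hD (hdf j)),
        hessC_apply' hU hf hy]
      ring
    have p1 := sum_wirt_adjugate hMd (hcl y hy)
    -- The divergence identity for ∂̄ acts on the other index, hence is applied to the transpose.
    have p2 : ∀ j, ∑ k, wirt Complex.I (fun z => (M z).adjugate k j) y (frame k) = 0 := fun j => by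
      have := sum_wirt_adjugate (M := fun z => (M z)ᵀ) (fun i j => hMd j i)
        (fun l j k => hcl' y hy l k j) j
      simpa only [← Matrix.adjugate_transpose, Matrix.transpose_apply] using this
    have s1 : ∑ j, ∑ k, (f y : ℂ) * wirt Complex.I (fun w => (g w : ℂ)) y (frame k) *
          wirt (-Complex.I) (fun z => (M z).adjugate k j) y (frame j) = 0 := by
      rw [Finset.sum_comm]
      simp only [← Finset.mul_sum, p1, mul_zero, Finset.sum_const_zero]
    have s2 : ∑ j, ∑ k, (g y : ℂ) * wirt (-Complex.I) (fun w => (f w : ℂ)) y (frame j) *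
          wirt Complex.I (fun z => (M z).adjugate k j) y (frame k) = 0 := by
      simp only [← Finset.mul_sum, p2, mul_zero, Finset.sum_const_zero]
    have t : ∀ N : Matrix (Fin n) (Fin n) ℂ, ((M y).adjugate * N).trace =
        ∑ j, ∑ k, (M y).adjugate k j * N j k := fun N => by
      simp only [Matrix.trace, Matrix.diag, Matrix.mul_apply]
      exact Finset.sum_comm
    simp only [e1, e2, t, Finset.sum_sub_distrib, Finset.sum_add_distrib, s1, s2, Finset.mul_sum]
    have s3 : ∑ j, ∑ k, wirt (-Complex.I) (fun w => (f w : ℂ)) y (frame j) *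
          ((M y).adjugate k j * wirt Complex.I (fun w => (g w : ℂ)) y (frame k)) =
        ∑ j, ∑ k, wirt Complex.I (fun w => (g w : ℂ)) y (frame k) *
          ((M y).adjugate k j * wirt (-Complex.I) (fun w => (f w : ℂ)) y (frame j)) :=
      Finset.sum_congr rfl fun _ _ => Finset.sum_congr rfl fun _ _ => by ring
    rw [s3]
    ring
  rw [setIntegral_congr_fun hU.measurableSet hpt]
  have iP : ∀ j k, IntegrableOn (fun y => wirt (-Complex.I) (P j k) y (frame j)) U := fun j k =>
    integrableOn_of_contDiffOn hU hK hKU (contDiffOn_wirt hU (hP j k) _ _)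
      fun y hy hy' => wirt_eq_zero_of_notMem hU hK (hP0 j k) hy hy' _ _
  have iQ : ∀ j k, IntegrableOn (fun y => wirt Complex.I (Q j k) y (frame k)) U := fun j k =>
    integrableOn_of_contDiffOn hU hK hKU (contDiffOn_wirt hU (hQ j k) _ _)
      fun y hy hy' => wirt_eq_zero_of_notMem hU hK (hQ0 j k) hy hy' _ _
  have iPQ : ∀ j k, Integrable (fun y => wirt (-Complex.I) (P j k) y (frame j) -
      wirt Complex.I (Q j k) y (frame k)) (volume.restrict U) := fun j k => (iP j k).sub (iQ j k)
  rw [integral_finsetSum _ fun j _ => integrable_finsetSum _ fun k _ => iPQ j k]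
  refine Finset.sum_eq_zero fun j _ => ?_
  rw [integral_finsetSum _ fun k _ => iPQ j k]
  refine Finset.sum_eq_zero fun k _ => ?_
  rw [integral_sub (iP j k) (iQ j k), integral_wirt_eq_zero hU hK hKU (hP j k) (hP0 j k),
    integral_wirt_eq_zero hU hK hKU (hQ j k) (hQ0 j k), sub_zero]

end Divergence

/-! ### Closedness of (1,1)-forms in coordinates -/

section ClosedForms

variable {n : ℕ}

theorem wirt_herm_entry {a : (Fin n → ℂ) → (Fin n → ℂ) [⋀^Fin 2]→L[ℝ] ℝ} {y : Fin n → ℂ}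
    (ha : DifferentiableAt ℝ a y) (c : ℂ) (j k : Fin n) (v : Fin n → ℂ) :
    wirt c (fun z => herm (a z) j k) y v = (1 / 4 : ℂ) *
      ((fderiv ℝ (fun z => a z ![frame j, Complex.I • frame k]) y v : ℂ) -
        Complex.I * (fderiv ℝ (fun z => a z ![frame j, frame k]) y v : ℂ) +
        c * ((fderiv ℝ (fun z => a z ![frame j, Complex.I • frame k]) y (Complex.I • v) : ℂ) -
        Complex.I * (fderiv ℝ (fun z => a z ![frame j, frame k]) y (Complex.I • v) : ℂ))) := by
  have h1 : ∀ w, HasFDerivAt (fun z => ((a z w : ℝ) : ℂ))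
      (Complex.ofRealCLM.comp (fderiv ℝ (fun z => a z w) y)) y := fun w =>
    Complex.ofRealCLM.hasFDerivAt.comp y
      (((ContinuousAlternatingMap.apply ℝ (Fin n → ℂ) ℝ w).differentiableAt.comp y ha).hasFDerivAt)
  have h3 : fderiv ℝ (fun z => herm (a z) j k) y = _ :=
    (((h1 ![frame j, Complex.I • frame k]).sub ((h1 ![frame j, frame k]).const_mul
      Complex.I)).const_mul (1 / 2 : ℂ)).fderiv
  rw [wirt, h3]
  simp only [smul_apply, sub_apply, ContinuousLinearMap.comp_apply, Complex.ofRealCLM_apply,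
    smul_eq_mul]
  ring

section

variable {a : (Fin n → ℂ) → (Fin n → ℂ) [⋀^Fin 2]→L[ℝ] ℝ} {y : Fin n → ℂ}

theorem extDeriv_two_eq (ha : DifferentiableAt ℝ a y) (h0 : extDeriv a y = 0)
    (u v w : Fin n → ℂ) :
    fderiv ℝ (fun z => a z ![v, w]) y u - fderiv ℝ (fun z => a z ![u, w]) y v +
      fderiv ℝ (fun z => a z ![u, v]) y w = 0 := by
  have h := extDeriv_apply ha ![u, v, w]
  rw [h0] at h
  have e0 : (0 : Fin 3).removeNth ![u, v, w] = ![v, w] := by ext i : 1; fin_cases i <;> rfl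
  have e1 : (1 : Fin 3).removeNth ![u, v, w] = ![u, w] := by ext i : 1; fin_cases i <;> rfl
  have e2 : (2 : Fin 3).removeNth ![u, v, w] = ![u, v] := by ext i : 1; fin_cases i <;> rfl
  rw [Fin.sum_univ_three, e0, e1, e2] at h
  simp at h
  linarith

/-- These are the (2,1) and (1,2) components of da = 0: the real identity is used on four triples
obtained by rotating the frame vectors by i, and invariance under i makes the derivatives in the
remaining direction cancel. -/
theorem wirt_herm_closed (ha : DifferentiableAt ℝ a y) (h0 : extDeriv a y = 0)
    (h11 : ∀ᶠ z in 𝓝 y, IsOneOne (a z)) (l j k : Fin n) :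
    wirt (-Complex.I) (fun z => herm (a z) j k) y (frame l) =
      wirt (-Complex.I) (fun z => herm (a z) l k) y (frame j) ∧
    wirt Complex.I (fun z => herm (a z) j k) y (frame l) =
      wirt Complex.I (fun z => herm (a z) j l) y (frame k) := by
  let d : (Fin n → ℂ) → (Fin n → ℂ) → (Fin n → ℂ) → ℝ := fun u v w =>
    fderiv ℝ (fun z => a z ![v, w]) y u
  have hd : ∀ u v w, fderiv ℝ (fun z => a z ![v, w]) y u = d u v w := fun _ _ _ => rfl
  have cl : ∀ u v w, d u v w - d v u w + d w u v = 0 := fun u v w => extDeriv_two_eq ha h0 u v w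
  have sw : ∀ u v w, d u v w = -d u w v := fun u v w => by
    have : (fun z => a z ![v, w]) = fun z => -(a z ![w, v]) := funext fun z => two_swap _ _ _
    simp only [d, this, fderiv_fun_neg, neg_apply]
  have ii : ∀ u v w, d u (Complex.I • v) (Complex.I • w) = d u v w := fun u v w => by
    have : (fun z => a z ![Complex.I • v, Complex.I • w]) =ᶠ[𝓝 y] fun z => a z ![v, w] := by
      filter_upwards [h11] with z hz using hz v w
    simp only [d, this.fderiv_eq]
  have il : ∀ u v w, d u (Complex.I • v) w = -d u v (Complex.I • w) := fun u v w => by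
    have : (fun z => a z ![Complex.I • v, w]) =ᶠ[𝓝 y] fun z => -(a z ![v, Complex.I • w]) := by
      filter_upwards [h11] with z hz using hz.I_left v w
    simp only [d, this.fderiv_eq, fderiv_fun_neg, neg_apply]
  have I2 := Complex.I_sq
  simp only [wirt_herm_entry ha, hd]
  constructor
  · have c1 := cl (frame l) (frame j) (Complex.I • frame k)
    have c2 := cl (frame l) (frame j) (frame k)
    have c3 := cl (Complex.I • frame l) (Complex.I • frame j) (Complex.I • frame k)
    have c4 := cl (Complex.I • frame l) (Complex.I • frame j) (frame k)
    simp only [ii, il] at c3 c4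
    generalize d (frame l) (frame j) (Complex.I • frame k) = x1 at *
    generalize d (frame j) (frame l) (Complex.I • frame k) = x2 at *
    generalize d (Complex.I • frame k) (frame l) (frame j) = x3 at *
    generalize d (frame l) (frame j) (frame k) = x4 at *
    generalize d (frame j) (frame l) (frame k) = x5 at *
    generalize d (frame k) (frame l) (frame j) = x6 at *
    generalize d (Complex.I • frame l) (frame j) (frame k) = x7 at *
    generalize d (Complex.I • frame j) (frame l) (frame k) = x8 at *
    generalize d (Complex.I • frame l) (frame j) (Complex.I • frame k) = x9 at *
    generalize d (Complex.I • frame j) (frame l) (Complex.I • frame k) = x10 at *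
    have r1 : (x1 : ℂ) - x2 + x3 = 0 := by exact_mod_cast c1
    have r2 : (x4 : ℂ) - x5 + x6 = 0 := by exact_mod_cast c2
    have r3 : (x7 : ℂ) - x8 + x3 = 0 := by exact_mod_cast c3
    have r4 : -(x9 : ℂ) - -x10 + x6 = 0 := by exact_mod_cast c4
    linear_combination (1 / 4 : ℂ) * (r1 - Complex.I * r2 - r3 + Complex.I * r4) +
      (1 / 4 : ℂ) * ((x7 : ℂ) - x8) * I2
  · have c1 := cl (frame l) (frame k) (Complex.I • frame j)
    have c2 := cl (frame l) (frame k) (frame j)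
    have c3 := cl (Complex.I • frame l) (Complex.I • frame k) (frame j)
    have c4 := cl (Complex.I • frame l) (Complex.I • frame k) (Complex.I • frame j)
    simp only [ii, il] at c3 c4
    have s1 := sw (frame l) (Complex.I • frame j) (frame k)
    have s2 := sw (frame k) (Complex.I • frame j) (frame l)
    have s3 := sw (frame l) (frame j) (frame k)
    have s4 := sw (frame k) (frame j) (frame l)
    have s5 := sw (Complex.I • frame l) (Complex.I • frame j) (frame k)
    have s6 := sw (Complex.I • frame k) (Complex.I • frame j) (frame l)
    have s7 := sw (Complex.I • frame l) (frame j) (frame k)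
    have s8 := sw (Complex.I • frame k) (frame j) (frame l)
    simp only [il] at s1 s2 s5 s6
    generalize d (frame l) (frame j) (Complex.I • frame k) = x1 at *
    generalize d (frame k) (frame j) (Complex.I • frame l) = x2 at *
    generalize d (frame l) (frame k) (Complex.I • frame j) = x3 at *
    generalize d (frame k) (frame l) (Complex.I • frame j) = x4 at *
    generalize d (Complex.I • frame j) (frame l) (frame k) = x5 at *
    generalize d (frame j) (frame l) (frame k) = x6 at *
    generalize d (frame l) (frame j) (frame k) = x7 at *
    generalize d (frame k) (frame j) (frame l) = x8 at *
    generalize d (frame l) (frame k) (frame j) = x9 at *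
    generalize d (frame k) (frame l) (frame j) = x10 at *
    generalize d (Complex.I • frame l) (frame j) (Complex.I • frame k) = x11 at *
    generalize d (Complex.I • frame k) (frame j) (Complex.I • frame l) = x12 at *
    generalize d (Complex.I • frame l) (frame k) (Complex.I • frame j) = x13 at *
    generalize d (Complex.I • frame k) (frame l) (Complex.I • frame j) = x14 at *
    generalize d (Complex.I • frame l) (frame j) (frame k) = x15 at *
    generalize d (Complex.I • frame k) (frame j) (frame l) = x16 at *
    generalize d (Complex.I • frame l) (frame k) (frame j) = x17 at *
    generalize d (Complex.I • frame k) (frame l) (frame j) = x18 at *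
    have r1 : (x1 : ℂ) - x2 = -x5 := by exact_mod_cast (by linarith : x1 - x2 = -x5)
    have r2 : (x7 : ℂ) - x8 = x6 := by exact_mod_cast (by linarith : x7 - x8 = x6)
    have r3 : (x11 : ℂ) - x12 = x6 := by exact_mod_cast (by linarith : x11 - x12 = x6)
    have r4 : (x15 : ℂ) - x16 = x5 := by exact_mod_cast (by linarith : x15 - x16 = x5)
    linear_combination (1 / 4 : ℂ) * (r1 - Complex.I * r2 + r4 + Complex.I * r3) -
      (1 / 4 : ℂ) * ((x15 : ℂ) - x16) * I2

end

variable {X : Type*} [TopologicalSpace X] [ChartedSpace (Fin n → ℂ) X]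

/-- A smooth closed real `(1,1)`-form, in terms of its expressions in charts. -/
structure ChartClosed (β : DForm n X 2 ℝ) : Prop where
  smooth : β.IsSmooth
  oneOne : β.OneOne
  closed : ∀ e ∈ atlas (Fin n → ℂ) X, ∀ y ∈ e.target, extDeriv (β.inChart e) y = 0

theorem ChartSmooth.mul {φ ψ : X → ℝ} (hφ : ChartSmooth n φ) (hψ : ChartSmooth n ψ) :
    ChartSmooth n fun x => φ x * ψ x := fun e he => (hφ e he).mul (hψ e he)

theorem ChartSmooth.sum {ι : Type*} {s : Finset ι} {φ : ι → X → ℝ}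
    (hφ : ∀ i ∈ s, ChartSmooth n (φ i)) : ChartSmooth n fun x => ∑ i ∈ s, φ i x := fun e he =>
  ContDiffOn.sum fun i hi => hφ i hi e he

theorem chartSmooth_const (r : ℝ) : ChartSmooth n fun _ : X => r := fun _ _ => contDiffOn_const

variable [IsManifold 𝓘(ℂ, Fin n → ℂ) ω X]

theorem IsClosedRealOneOne.chartClosed {β : DForm n X 2 ℝ} (h : IsClosedRealOneOne β) :
    ChartClosed β where
  smooth := h.smooth
  oneOne := h.isOneOne
  closed e he y hy := by
    rw [← DForm.inChart_d h.smooth he hy, h.closed]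
    rfl

theorem contDiffOn_extDeriv {k : ℕ} {U : Set (Fin n → ℂ)} (hU : IsOpen U)
    {a : (Fin n → ℂ) → (Fin n → ℂ) [⋀^Fin k]→L[ℝ] ℝ} (ha : ContDiffOn ℝ ∞ a U) :
    ContDiffOn ℝ ∞ (extDeriv a) U :=
  (ContinuousAlternatingMap.alternatizeUncurryFinCLM ℝ (Fin n → ℂ) ℝ).contDiff.comp_contDiffOn
    (ha.fderiv_of_isOpen hU (by simp))

/-- The added term is half of d dᶜφ, so it is closed by d² = 0 and of type (1,1) by symmetry of
second derivatives. -/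
theorem ChartClosed.twist {α : DForm n X 2 ℝ} (hα : ChartClosed α) {φ : X → ℝ}
    (hφ : ChartSmooth n φ) : ChartClosed (twist α φ) := by
  have h1 : ∀ e ∈ atlas (Fin n → ℂ) X, ∀ y ∈ e.target, (DHYM.twist α φ).inChart e y =
      (α.inChart e + (1 / 2 : ℝ) • extDeriv (dcLocal (φ ∘ e.symm))) y := fun e he y hy => by
    rw [DHYM.twist, DForm.inChart_add, inChart_iddbar hφ he hy]
    rfl
  have hs : ∀ e ∈ atlas (Fin n → ℂ) X, ContDiffOn ℝ ∞ (extDeriv (dcLocal (φ ∘ e.symm))) e.target :=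
    fun e he => contDiffOn_extDeriv e.open_target (contDiffOn_dcLocal e.open_target (hφ e he))
  refine ⟨fun e he => ?_, fun x u v => ?_, fun e he y hy => ?_⟩
  · exact ((hα.smooth e he).add ((hs e he).const_smul (1 / 2 : ℝ))).congr (h1 e he)
  · exact congrArg₂ (· + ·) (hα.oneOne x u v) (oneOne_iddbar hφ x u v)
  · have h2 : (DHYM.twist α φ).inChart e =ᶠ[𝓝 y]
        α.inChart e + (1 / 2 : ℝ) • extDeriv (dcLocal (φ ∘ e.symm)) := by
      filter_upwards [e.open_target.mem_nhds hy] with z hz using h1 e he z hz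
    have hd : ∀ {k : ℕ} {a : (Fin n → ℂ) → (Fin n → ℂ) [⋀^Fin k]→L[ℝ] ℝ},
        ContDiffOn ℝ ∞ a e.target → DifferentiableAt ℝ a y := fun h =>
      (h.contDiffAt (e.open_target.mem_nhds hy)).differentiableAt (by simp)
    rw [h2.extDeriv_eq, extDeriv_add (hd (hα.smooth e he)) ((hd (hs e he)).const_smul _),
      extDeriv_smul, hα.closed e he y hy, extDeriv_extDeriv_apply
        ((contDiffOn_dcLocal e.open_target (hφ e he)).contDiffAt (e.open_target.mem_nhds hy))
        (by rw [minSmoothness_of_isRCLikeNormedField]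
            exact WithTop.coe_le_coe.2 (le_top (α := ℕ∞)))]
    simp

theorem wirt_add {c : ℂ} {f g : (Fin n → ℂ) → ℂ} {y : Fin n → ℂ} (hf : DifferentiableAt ℝ f y)
    (hg : DifferentiableAt ℝ g y) (v : Fin n → ℂ) :
    wirt c (fun z => f z + g z) y v = wirt c f y v + wirt c g y v := by
  simp only [wirt, fderiv_fun_add hf hg, add_apply]
  ring

theorem wirt_cplxChart_closed {β Ω : DForm n X 2 ℝ} (hβ : ChartClosed β) (hΩ : ChartClosed Ω)
    {e : OpenPartialHomeomorph X (Fin n → ℂ)} (he : e ∈ atlas (Fin n → ℂ) X) {y : Fin n → ℂ}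
    (hy : y ∈ e.target) (l j k : Fin n) :
    wirt (-Complex.I) (fun z => cplxChart β Ω e z j k) y (frame l) =
      wirt (-Complex.I) (fun z => cplxChart β Ω e z l k) y (frame j) ∧
    wirt Complex.I (fun z => cplxChart β Ω e z j k) y (frame l) =
      wirt Complex.I (fun z => cplxChart β Ω e z j l) y (frame k) := by
  have hd : ∀ {γ : DForm n X 2 ℝ}, γ.IsSmooth → ∀ j k,
      DifferentiableAt ℝ (fun z => chartMatrix γ e z j k) y := fun h j k =>
    ((h.contDiffOn_chartMatrix he j k).contDiffAt (e.open_target.mem_nhds hy)).differentiableAt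
      (by simp)
  have hc : ∀ {γ : DForm n X 2 ℝ} (hγ : ChartClosed γ), _ := fun {γ} hγ =>
    wirt_herm_closed (a := γ.inChart e)
      (((hγ.smooth e he).contDiffAt (e.open_target.mem_nhds hy)).differentiableAt (by simp))
      (hγ.closed e he y hy) (by
        filter_upwards [e.open_target.mem_nhds hy] with z hz using hγ.oneOne.inChart he hz) l j k
  have hsplit : ∀ c j k v, wirt c (fun z => cplxChart β Ω e z j k) y v =
      wirt c (fun z => herm (β.inChart e z) j k) y v +
        Complex.I * wirt c (fun z => herm (Ω.inChart e z) j k) y v := fun c j k v => by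
    refine (wirt_add (hd hβ.smooth j k) ((hd hΩ.smooth j k).const_mul Complex.I) v).trans ?_
    rw [wirt_const_mul (hd hΩ.smooth j k)]
    rfl
  simp only [hsplit]
  exact ⟨by rw [(hc hβ).1, (hc hΩ).1], by rw [(hc hβ).2, (hc hΩ).2]⟩

end ClosedForms

/-! ### Global symmetry of the linearized operator -/

section Stokes

variable {n : ℕ} {X : Type*} [TopologicalSpace X] [ChartedSpace (Fin n → ℂ) X]
  [IsManifold 𝓘(ℂ, Fin n → ℂ) ω X] {β Ω : DForm n X 2 ℝ}

theorem contDiffOn_hessC {U : Set (Fin n → ℂ)} (hU : IsOpen U) {f : (Fin n → ℂ) → ℝ}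
    (hf : ContDiffOn ℝ ∞ f U) (j k : Fin n) : ContDiffOn ℝ ∞ (fun y => hessC f y j k) U :=
  (contDiffOn_wirt hU (contDiffOn_wirt hU (contDiffOn_ofReal hf) Complex.I (frame k))
    (-Complex.I) (frame j)).congr fun _ hy => hessC_apply hU hf hy j k

theorem continuous_ratio (hβ : ChartClosed β) (hΩ : IsKahlerForm Ω) : Continuous (ratio β Ω) := by
  refine continuous_of_chart (n := n) fun e he => ?_
  have h : ContinuousOn (fun y => (cplxChart β Ω e y).det / (chartMatrix Ω e y).det) e.target :=
    (contDiffOn_det (contDiffOn_cplxChart hβ.smooth hΩ.smooth he)).continuousOn.div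
      (contDiffOn_det (hΩ.smooth.contDiffOn_chartMatrix he)).continuousOn
      fun y hy => (det_chartMatrix hΩ he hy).ne'
  exact h.congr fun y hy => ratio_symm hβ.oneOne hΩ.isOneOne he hy

theorem continuous_linRatio (hβ : ChartClosed β) (hΩ : IsKahlerForm Ω) {ψ : X → ℝ}
    (hψ : ChartSmooth n ψ) : Continuous (linRatio β Ω ψ) := by
  refine continuous_of_chart (n := n) fun e he => ?_
  have h : ContinuousOn (fun y => ((cplxChart β Ω e y).adjugate * hessC (ψ ∘ e.symm) y).trace /
      (chartMatrix Ω e y).det) e.target :=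
    (contDiffOn_trace_mul (contDiffOn_adjugate (contDiffOn_cplxChart hβ.smooth hΩ.smooth he))
      (contDiffOn_hessC e.open_target (hψ e he))).continuousOn.div
      (contDiffOn_det (hΩ.smooth.contDiffOn_chartMatrix he)).continuousOn
      fun y hy => (det_chartMatrix hΩ he hy).ne'
  exact h.congr fun y hy => linRatio_symm hβ.oneOne hΩ.isOneOne hψ he hy

theorem hermMatrix_iddbar {ψ : X → ℝ} (hψ : ChartSmooth n ψ) (x : X) :
    hermMatrix (iddbar n ψ) x =
      hessC (ψ ∘ (chartAt (Fin n → ℂ) x).symm) (chartAt (Fin n → ℂ) x x) := by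
  rw [hermMatrix_eq, DForm.val_eq_inChart, herm_inChart_iddbar hψ (chart_mem_atlas _ _)
    ((chartAt (Fin n → ℂ) x).map_source (mem_chart_source _ _))]

theorem hessC_congr {f g : (Fin n → ℂ) → ℝ} {y : Fin n → ℂ} (h : f =ᶠ[𝓝 y] g) :
    hessC f y = hessC g y := by
  have : ∀ u v, secondDeriv f y u v = secondDeriv g y u v := fun u v => by
    have h' : (fun z => fderiv ℝ f z v) =ᶠ[𝓝 y] fun z => fderiv ℝ g z v := by
      filter_upwards [h.fderiv (𝕜 := ℝ)] with z hz using by rw [hz]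
    rw [secondDeriv, secondDeriv, h'.fderiv_eq]
  ext j k
  simp only [hessC, Matrix.of_apply, this]

theorem linRatio_eq_zero {ψ : X → ℝ} (hψ : ChartSmooth n ψ) {x : X} {r : ℝ}
    (h : ψ =ᶠ[𝓝 x] fun _ => r) : linRatio β Ω ψ x = 0 := by
  set c := chartAt (Fin n → ℂ) x
  have hx : x ∈ c.source := mem_chart_source _ _
  have h1 : ψ ∘ c.symm =ᶠ[𝓝 (c x)] fun _ => r := by
    have := c.continuousAt_symm (c.map_source hx)
    rw [ContinuousAt, c.left_inv hx] at this
    exact this.eventually h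
  have h2 : hessC (fun _ : Fin n → ℂ => r) (c x) = 0 := by
    ext j k
    simp [hessC, secondDeriv]
  rw [linRatio, hermMatrix_iddbar hψ, hessC_congr h1, h2]
  simp

theorem hessC_sum {ι : Type*} {s : Finset ι} {U : Set (Fin n → ℂ)} (hU : IsOpen U)
    {f : ι → (Fin n → ℂ) → ℝ} (hf : ∀ i ∈ s, ContDiffOn ℝ ∞ (f i) U) {y : Fin n → ℂ} (hy : y ∈ U) :
    hessC (fun z => ∑ i ∈ s, f i z) y = ∑ i ∈ s, hessC (f i) y := by
  have h : ∀ u v, secondDeriv (fun z => ∑ i ∈ s, f i z) y u v = ∑ i ∈ s, secondDeriv (f i) y u v := by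
    intro u v
    have h' : (fun z => fderiv ℝ (fun z => ∑ i ∈ s, f i z) z v) =ᶠ[𝓝 y]
        fun z => ∑ i ∈ s, fderiv ℝ (f i) z v := by
      filter_upwards [hU.mem_nhds hy] with z hz
      rw [fderiv_fun_sum fun i hi =>
        ((hf i hi).contDiffAt (hU.mem_nhds hz)).differentiableAt (by simp), sum_apply]
    rw [secondDeriv, h'.fderiv_eq, fderiv_fun_sum fun i hi =>
      ((((hf i hi).fderiv_of_isOpen (m := ∞) hU (by simp)).clm_apply
        contDiffOn_const).contDiffAt (hU.mem_nhds hy)).differentiableAt (by simp), sum_apply]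
    rfl
  ext j k
  simp only [hessC, Matrix.of_apply, h, Matrix.sum_apply, Complex.ofReal_sum, Complex.ofReal_add,
    Complex.ofReal_sub, ← Finset.sum_add_distrib, ← Finset.sum_sub_distrib, Finset.mul_sum]

theorem linRatio_sum {ι : Type*} {s : Finset ι} {φ : ι → X → ℝ}
    (hφ : ∀ i ∈ s, ChartSmooth n (φ i)) (x : X) :
    linRatio β Ω (fun x => ∑ i ∈ s, φ i x) x = ∑ i ∈ s, linRatio β Ω (φ i) x := by
  set c := chartAt (Fin n → ℂ) x
  have hx : x ∈ c.source := mem_chart_source _ _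
  have h := hessC_sum (s := s) c.open_target (fun i hi => hφ i hi c (chart_mem_atlas _ _))
    (c.map_source hx)
  have h2 : hermMatrix (iddbar n fun x => ∑ i ∈ s, φ i x) x =
      ∑ i ∈ s, hermMatrix (iddbar n (φ i)) x := by
    rw [hermMatrix_iddbar (ChartSmooth.sum hφ)]
    refine h.trans (Finset.sum_congr rfl fun i hi => ?_)
    rw [hermMatrix_iddbar (hφ i hi)]
  simp only [linRatio, h2, Finset.mul_sum, Matrix.trace_sum, Finset.sum_div]

variable [T2Space X] [CompactSpace X] [MeasurableSpace X] [BorelSpace X]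

/-- In the chart e the density of Ωⁿ cancels the denominator of L up to the constant `topConst n`,
leaving the local divergence identity; only χ has to be supported in the chart. -/
theorem integral_linRatio_symm_of_support (hβ : ChartClosed β) (hΩ : IsKahlerForm Ω)
    {χ ψ : X → ℝ} (hχ : ChartSmooth n χ) (hψ : ChartSmooth n ψ)
    {e : OpenPartialHomeomorph X (Fin n → ℂ)} (he : e ∈ atlas (Fin n → ℂ) X) {K : Set X}
    (hK : IsCompact K) (hKe : K ⊆ e.source) (h0 : ∀ x ∉ K, χ x = 0) :
    ∫ x, ((χ x : ℂ) * linRatio β Ω ψ x - (ψ x : ℂ) * linRatio β Ω χ x) ∂volMeasure Ω = 0 := by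
  have hcont : Continuous fun x => (χ x : ℂ) * linRatio β Ω ψ x - (ψ x : ℂ) * linRatio β Ω χ x :=
    ((Complex.continuous_ofReal.comp hχ.continuous).mul (continuous_linRatio hβ hΩ hψ)).sub
      ((Complex.continuous_ofReal.comp hψ.continuous).mul (continuous_linRatio hβ hΩ hχ))
  have hΩc := hΩ.toIsClosedRealOneOne.chartClosed
  rw [integral_volMeasure_of_support hΩ hcont he hK hKe fun x hx => ?_]
  · have h1 : ∀ y ∈ e.target, dens Ω e y • ((χ (e.symm y) : ℂ) * linRatio β Ω ψ (e.symm y) -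
        (ψ (e.symm y) : ℂ) * linRatio β Ω χ (e.symm y)) = (topConst n : ℂ) *
        (((χ ∘ e.symm) y : ℂ) * ((cplxChart β Ω e y).adjugate * hessC (ψ ∘ e.symm) y).trace -
          ((ψ ∘ e.symm) y : ℂ) *
            ((cplxChart β Ω e y).adjugate * hessC (χ ∘ e.symm) y).trace) := fun y hy => by
      have hdet := (det_chartMatrix hΩ he hy).ne'
      rw [Complex.real_smul, ofReal_dens hΩ he hy, linRatio_symm hβ.oneOne hΩ.isOneOne hψ he hy,
        linRatio_symm hβ.oneOne hΩ.isOneOne hχ he hy]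
      simp only [Function.comp_apply]
      field_simp
    rw [setIntegral_congr_fun e.open_target.measurableSet h1, integral_const_mul,
      integral_trace_hessC_symm e.open_target (hK.image_of_continuousOn (e.continuousOn.mono hKe))
        (by rintro _ ⟨x, hx, rfl⟩; exact e.map_source (hKe hx))
        (contDiffOn_cplxChart hβ.smooth hΩ.smooth he)
        (fun y hy l j k => (wirt_cplxChart_closed hβ hΩc he hy l j k).1)
        (fun y hy l j k => (wirt_cplxChart_closed hβ hΩc he hy l j k).2)
        (hχ e he) (hψ e he) (fun y hy hy' => h0 _ fun h => hy' ⟨_, h, e.right_inv hy⟩), mul_zero]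
  · have h2 : χ =ᶠ[𝓝 x] fun _ => 0 := by
      filter_upwards [hK.isClosed.isOpen_compl.mem_nhds hx] with z hz using h0 z hz
    rw [linRatio_eq_zero hχ h2, h0 x hx]
    simp

/-- The linearized operator is symmetric with respect to the volume measure. -/
theorem integral_linRatio_symm (hβ : ChartClosed β) (hΩ : IsKahlerForm Ω)
    {χ ψ : X → ℝ} (hχ : ChartSmooth n χ) (hψ : ChartSmooth n ψ) :
    ∫ x, (χ x : ℂ) * linRatio β Ω ψ x ∂volMeasure Ω =
      ∫ x, (ψ x : ℂ) * linRatio β Ω χ x ∂volMeasure Ω := by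
  have hfin := isFiniteMeasure_volMeasure (X := X) hΩ.smooth
  have hint : ∀ {χ ψ : X → ℝ}, ChartSmooth n χ → ChartSmooth n ψ →
      Integrable (fun x => (χ x : ℂ) * linRatio β Ω ψ x) (volMeasure Ω) := fun hχ hψ =>
    integrable_of_continuous
      ((Complex.continuous_ofReal.comp hχ.continuous).mul (continuous_linRatio hβ hΩ hψ))
  have hρ : ∀ c, ChartSmooth n (chartPartition n X c) := fun c =>
    SmoothFun.chartSmooth (chartPartition n X c).contMDiff
  -- Only χ is localized by the partition of unity; both sides are additive in it.
  let χ' : X → X → ℝ := fun c x => chartPartition n X c x * χ x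
  have hχ' : ∀ c, ChartSmooth n (χ' c) := fun c => (hρ c).mul hχ
  have hsum : χ = fun x => ∑ c ∈ chartIndex n X, χ' c x := by
    ext x
    simp only [χ', ← Finset.sum_mul, sum_chartPartition, one_mul]
  rw [← sub_eq_zero, ← integral_sub (hint hχ hψ) (hint hψ hχ)]
  have h1 : ∀ x, (χ x : ℂ) * linRatio β Ω ψ x - (ψ x : ℂ) * linRatio β Ω χ x =
      ∑ c ∈ chartIndex n X,
        ((χ' c x : ℂ) * linRatio β Ω ψ x - (ψ x : ℂ) * linRatio β Ω (χ' c) x) := fun x => by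
    conv_lhs => rw [hsum]
    rw [linRatio_sum fun c _ => hχ' c]
    push_cast
    rw [Finset.sum_sub_distrib, Finset.sum_mul, Finset.mul_sum]
  simp only [h1]
  have hi : ∀ c, Integrable (fun x => (χ' c x : ℂ) * linRatio β Ω ψ x -
      (ψ x : ℂ) * linRatio β Ω (χ' c) x) (volMeasure Ω) := fun c =>
    (hint (hχ' c) hψ).sub (hint hψ (hχ' c))
  rw [integral_finsetSum _ fun c _ => hi c]
  refine Finset.sum_eq_zero fun c _ => ?_
  refine integral_linRatio_symm_of_support hβ hΩ (hχ' c) hψ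
    (chart_mem_atlas (Fin n → ℂ) c) (isClosed_tsupport (chartPartition n X c)).isCompact
    (tsupport_chartPartition c) fun x hx => ?_
  simp only [χ', image_eq_zero_of_notMem_tsupport hx, zero_mul]

end Stokes

/-! ### Product rule and the gradient term -/

section Gradient

variable {n : ℕ}

/-- The gradient `∂f/∂z_j` of a real function. -/
def gradC (f : (Fin n → ℂ) → ℝ) (y : Fin n → ℂ) (j : Fin n) : ℂ :=
  wirt (-Complex.I) (fun w => (f w : ℂ)) y (frame j)

theorem differentiableAt_ofReal {f : (Fin n → ℂ) → ℝ} {y : Fin n → ℂ}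
    (hf : DifferentiableAt ℝ f y) : DifferentiableAt ℝ (fun w => (f w : ℂ)) y :=
  Complex.ofRealCLM.differentiableAt.comp y hf

theorem wirt_I_eq_star_gradC {f : (Fin n → ℂ) → ℝ} {y : Fin n → ℂ}
    (hf : DifferentiableAt ℝ f y) (k : Fin n) :
    wirt Complex.I (fun w => (f w : ℂ)) y (frame k) = star (gradC f y k) := by
  rw [gradC, wirt_ofReal hf, wirt_ofReal hf]
  simp

theorem gradC_mul {f g : (Fin n → ℂ) → ℝ} {y : Fin n → ℂ} (hf : DifferentiableAt ℝ f y)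
    (hg : DifferentiableAt ℝ g y) :
    gradC (fun z => f z * g z) y = (g y : ℂ) • gradC f y + (f y : ℂ) • gradC g y := by
  ext j
  simp only [gradC, Complex.ofReal_mul, Pi.add_apply, Pi.smul_apply, smul_eq_mul]
  rw [wirt_mul (differentiableAt_ofReal hf) (differentiableAt_ofReal hg)]
  ring

theorem hessC_mul {U : Set (Fin n → ℂ)} (hU : IsOpen U) {f g : (Fin n → ℂ) → ℝ}
    (hf : ContDiffOn ℝ ∞ f U) (hg : ContDiffOn ℝ ∞ g U) {y : Fin n → ℂ} (hy : y ∈ U) :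
    hessC (fun z => f z * g z) y = (g y : ℂ) • hessC f y + (f y : ℂ) • hessC g y +
      Matrix.vecMulVec (gradC f y) (star (gradC g y)) +
      Matrix.vecMulVec (gradC g y) (star (gradC f y)) := by
  have hd : ∀ {f : (Fin n → ℂ) → ℝ}, ContDiffOn ℝ ∞ f U → ∀ z ∈ U, DifferentiableAt ℝ f z :=
    fun h z hz => (h.contDiffAt (hU.mem_nhds hz)).differentiableAt (by simp)
  ext j k
  have hw : ∀ {f : (Fin n → ℂ) → ℝ}, ContDiffOn ℝ ∞ f U →
      DifferentiableAt ℝ (fun z => wirt Complex.I (fun w => (f w : ℂ)) z (frame k)) y := fun h =>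
    ((contDiffOn_wirt hU (contDiffOn_ofReal h) Complex.I (frame k)).contDiffAt
      (hU.mem_nhds hy)).differentiableAt (by simp)
  have hfy := differentiableAt_ofReal (hd hf y hy)
  have hgy := differentiableAt_ofReal (hd hg y hy)
  have h1 : (fun z => wirt Complex.I (fun w => ((f w * g w : ℝ) : ℂ)) z (frame k)) =ᶠ[𝓝 y]
      fun z => wirt Complex.I (fun w => (f w : ℂ)) z (frame k) * (g z : ℂ) +
        (f z : ℂ) * wirt Complex.I (fun w => (g w : ℂ)) z (frame k) := by
    filter_upwards [hU.mem_nhds hy] with z hz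
    simp only [Complex.ofReal_mul]
    exact wirt_mul (differentiableAt_ofReal (hd hf z hz)) (differentiableAt_ofReal (hd hg z hz)) _
  have h2 : wirt (-Complex.I)
      (fun z => wirt Complex.I (fun w => ((f w * g w : ℝ) : ℂ)) z (frame k)) y (frame j) =
      wirt (-Complex.I)
        (fun z => wirt Complex.I (fun w => (f w : ℂ)) z (frame k) * (g z : ℂ)) y (frame j) +
      wirt (-Complex.I)
        (fun z => (f z : ℂ) * wirt Complex.I (fun w => (g w : ℂ)) z (frame k)) y (frame j) := by
    rw [wirt, h1.fderiv_eq, ← wirt]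
    exact wirt_add ((hw hf).mul hgy) (hfy.mul (hw hg)) (frame j)
  refine (hessC_apply hU (hf.mul hg) hy j k).trans (h2.trans ?_)
  rw [wirt_mul (hw hf) hgy, wirt_mul hfy (hw hg),
    ← hessC_apply hU hf hy, ← hessC_apply hU hg hy, wirt_I_eq_star_gradC (hd hf y hy),
    wirt_I_eq_star_gradC (hd hg y hy)]
  simp only [Matrix.add_apply, Matrix.smul_apply, Matrix.vecMulVec_apply, smul_eq_mul,
    Pi.star_apply, gradC]
  ring

variable {X : Type*} [TopologicalSpace X] [ChartedSpace (Fin n → ℂ) X]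

/-- The quotient `n (β + iΩ)ⁿ⁻¹ ∧ i∂u ∧ ∂̄u / Ωⁿ`. -/
def gradRatio (β Ω : DForm n X 2 ℝ) (u : X → ℝ) (x : X) : ℂ :=
  gradForm (cplxMatrix β Ω x)
    (gradC (u ∘ (chartAt (Fin n → ℂ) x).symm) (chartAt (Fin n → ℂ) x x)) / (hermMatrix Ω x).det

variable [IsManifold 𝓘(ℂ, Fin n → ℂ) ω X] {β Ω : DForm n X 2 ℝ}

/-- L has no first-order or zeroth-order part, so the product rule for the Hessian leaves only the
two equal rank-one gradient terms. -/
theorem linRatio_sq {u : X → ℝ} (hu : ChartSmooth n u) (x : X) :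
    linRatio β Ω (fun x => u x * u x) x =
      2 * (u x : ℂ) * linRatio β Ω u x + 2 * gradRatio β Ω u x := by
  set c := chartAt (Fin n → ℂ) x with hc
  have hx : x ∈ c.source := mem_chart_source _ _
  have hu' := hu c (chart_mem_atlas _ _)
  have h := hessC_mul c.open_target hu' hu' (c.map_source hx)
  have hux : (u ∘ c.symm) (c x) = u x := congrArg u (c.left_inv hx)
  rw [linRatio, hermMatrix_iddbar (hu.mul hu), linRatio, hermMatrix_iddbar hu, gradRatio, gradForm,
    ← hc]
  change (_ * hessC (fun z => (u ∘ c.symm) z * (u ∘ c.symm) z) (c x)).trace / _ = _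
  rw [h, hux]
  simp only [Matrix.mul_add, Matrix.trace_add, Matrix.mul_smul, Matrix.trace_smul, smul_eq_mul]
  ring

theorem linRatio_cube {u : X → ℝ} (hu : ChartSmooth n u) (x : X) :
    linRatio β Ω (fun x => u x * (u x * u x)) x =
      3 * (u x : ℂ) ^ 2 * linRatio β Ω u x + 6 * (u x : ℂ) * gradRatio β Ω u x := by
  set c := chartAt (Fin n → ℂ) x with hc
  have hx : x ∈ c.source := mem_chart_source _ _
  have hu' := hu c (chart_mem_atlas _ _)
  have hd : DifferentiableAt ℝ (u ∘ c.symm) (c x) :=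
    (hu'.contDiffAt (c.open_target.mem_nhds (c.map_source hx))).differentiableAt (by simp)
  have h := hessC_mul c.open_target hu' (hu'.mul hu') (c.map_source hx)
  have hux : (u ∘ c.symm) (c x) = u x := congrArg u (c.left_inv hx)
  rw [linRatio, hermMatrix_iddbar (hu.mul (hu.mul hu)), linRatio, hermMatrix_iddbar hu, gradRatio,
    gradForm, ← hc]
  change (_ * hessC (fun z => (u ∘ c.symm) z * ((u ∘ c.symm) z * (u ∘ c.symm) z)) (c x)).trace /
    _ = _
  rw [h, hessC_mul c.open_target hu' hu' (c.map_source hx), gradC_mul hd hd, hux]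
  simp only [Matrix.mul_add, Matrix.trace_add, Matrix.mul_smul, Matrix.trace_smul, smul_eq_mul,
    star_add, star_smul, Matrix.vecMulVec_add, Matrix.add_vecMulVec, Matrix.vecMulVec_smul,
    Matrix.smul_vecMulVec, smul_add, Complex.star_def, Complex.conj_ofReal]
  push_cast
  ring

/-- The gradient is taken in the preferred chart at x, which jumps with x. Expressing the term
through L(u²) and uLu, already known to be continuous, avoids checking its chart independence. -/
theorem continuous_gradRatio (hβ : ChartClosed β) (hΩ : IsKahlerForm Ω) {u : X → ℝ}
    (hu : ChartSmooth n u) : Continuous (gradRatio β Ω u) := by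
  have h : gradRatio β Ω u = fun x => (1 / 2 : ℂ) * linRatio β Ω (fun x => u x * u x) x -
      (u x : ℂ) * linRatio β Ω u x := funext fun x => by rw [linRatio_sq hu]; ring
  rw [h]
  exact (continuous_const.mul (continuous_linRatio hβ hΩ (hu.mul hu))).sub
    ((Complex.continuous_ofReal.comp hu.continuous).mul (continuous_linRatio hβ hΩ hu))

variable [T2Space X] [CompactSpace X] [MeasurableSpace X] [BorelSpace X]

/-- Symmetry against the constant 1, which L annihilates. -/
theorem integral_linRatio (hβ : ChartClosed β) (hΩ : IsKahlerForm Ω) {ψ : X → ℝ}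
    (hψ : ChartSmooth n ψ) : ∫ x, linRatio β Ω ψ x ∂volMeasure Ω = 0 := by
  have h := integral_linRatio_symm hβ hΩ (chartSmooth_const (X := X) 1) hψ
  simpa [linRatio_eq_zero (chartSmooth_const (X := X) 1) (EventuallyEq.refl _ _)] using h

theorem integral_mul_linRatio_self (hβ : ChartClosed β) (hΩ : IsKahlerForm Ω) {u : X → ℝ}
    (hu : ChartSmooth n u) : ∫ x, (u x : ℂ) * linRatio β Ω u x ∂volMeasure Ω =
      -∫ x, gradRatio β Ω u x ∂volMeasure Ω := by
  have hfin := isFiniteMeasure_volMeasure (X := X) hΩ.smooth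
  have h := integral_linRatio hβ hΩ (hu.mul hu)
  have hi1 : Integrable (fun x => (u x : ℂ) * linRatio β Ω u x) (volMeasure Ω) :=
    integrable_of_continuous
      ((Complex.continuous_ofReal.comp hu.continuous).mul (continuous_linRatio hβ hΩ hu))
  have hi2 : Integrable (gradRatio β Ω u) (volMeasure Ω) :=
    integrable_of_continuous (continuous_gradRatio hβ hΩ hu)
  simp only [linRatio_sq hu, mul_assoc] at h
  rw [integral_add (hi1.const_mul _) (hi2.const_mul _), integral_const_mul,
    integral_const_mul] at h
  linear_combination (1 / 2 : ℂ) * h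

/-- The integral of L(u³) vanishes, and L(u³) = 3u²Lu + 6uG. -/
theorem integral_sq_mul_linRatio_self (hβ : ChartClosed β) (hΩ : IsKahlerForm Ω) {u : X → ℝ}
    (hu : ChartSmooth n u) : ∫ x, (u x : ℂ) ^ 2 * linRatio β Ω u x ∂volMeasure Ω =
      -2 * ∫ x, (u x : ℂ) * gradRatio β Ω u x ∂volMeasure Ω := by
  have hfin := isFiniteMeasure_volMeasure (X := X) hΩ.smooth
  have h := integral_linRatio hβ hΩ (hu.mul (hu.mul hu))
  have huc : Continuous fun x => (u x : ℂ) := Complex.continuous_ofReal.comp hu.continuous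
  have hi1 : Integrable (fun x => (u x : ℂ) ^ 2 * linRatio β Ω u x) (volMeasure Ω) :=
    integrable_of_continuous ((huc.pow 2).mul (continuous_linRatio hβ hΩ hu))
  have hi2 : Integrable (fun x => (u x : ℂ) * gradRatio β Ω u x) (volMeasure Ω) :=
    integrable_of_continuous (huc.mul (continuous_gradRatio hβ hΩ hu))
  simp only [linRatio_cube hu, mul_assoc] at h
  rw [integral_add (hi1.const_mul _) (hi2.const_mul _), integral_const_mul,
    integral_const_mul] at h
  linear_combination (1 / 3 : ℂ) * h

end Gradient

/-! ### The prescribed derivative as an integral against Ωⁿ -/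

section Functional

variable {n : ℕ} {X : Type*} [TopologicalSpace X] [ChartedSpace (Fin n → ℂ) X]
  [IsManifold 𝓘(ℂ, Fin n → ℂ) ω X] [T2Space X] [CompactSpace X] {α Ω : DForm n X 2 ℝ}

/-- The function `Im(e^{-iθ₀} (β + iΩ)ⁿ) / Ωⁿ` for `β = α_φ`. -/
def imRatio (Ω α : DForm n X 2 ℝ) (φ : X → ℝ) (x : X) : ℝ :=
  (Complex.exp (-Complex.I * (angle Ω α : ℂ)) * ratio (twist α φ) Ω x).im

theorem continuous_imRatio (hα : ChartClosed α) (hΩ : IsKahlerForm Ω) {φ : X → ℝ}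
    (hφ : ChartSmooth n φ) : Continuous (imRatio Ω α φ) :=
  Complex.continuous_im.comp (continuous_const.mul (continuous_ratio (hα.twist hφ) hΩ))

variable [MeasurableSpace X] [BorelSpace X]

theorem dFunctionalJ_eq (hα : ChartClosed α) (hΩ : IsKahlerForm Ω) {φ ψ : X → ℝ}
    (hφ : ChartSmooth n φ) (hψ : Continuous ψ) :
    dFunctionalJ Ω α φ ψ = ∫ x, ψ x * imRatio Ω α φ x ∂volMeasure Ω := by
  have hc : Continuous fun x => ψ x * imRatio Ω α φ x := hψ.mul (continuous_imRatio hα hΩ hφ)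
  rw [integral_volMeasure hΩ hc, dFunctionalJ, integral_eq_sum]
  refine Finset.sum_congr rfl fun c _ =>
    setIntegral_congr_fun (chartAt (Fin n → ℂ) c).open_target.measurableSet fun y hy => ?_
  set e := chartAt (Fin n → ℂ) c with hec
  have he : e ∈ atlas (Fin n → ℂ) X := chart_mem_atlas _ _
  have h1 := coeff_wedgePow (hα.twist hφ).oneOne hΩ.isOneOne he hy
  have hdet := (det_chartMatrix hΩ he hy).ne'
  have h2 : (topConst n : ℂ) * (cplxChart (twist α φ) Ω e y).det =
      (dens Ω e y : ℂ) * ratio (twist α φ) Ω (e.symm y) := by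
    rw [ofReal_dens hΩ he hy, ratio_symm (hα.twist hφ).oneOne hΩ.isOneOne he hy]
    field_simp
  have h3 : TopForm.coeff (fun x : X => ψ x • Complex.imLm.compAlternatingMap
      (Complex.exp (-Complex.I * (angle Ω α : ℂ)) • wedgePow n (cplx (twist α φ) Ω x))) e y =
      ψ (e.symm y) * (Complex.exp (-Complex.I * (angle Ω α : ℂ)) *
        TopForm.coeff (fun x : X => wedgePow n (cplx (twist α φ) Ω x)) e y).im := rfl
  rw [h3, h1, h2, mul_left_comm, Complex.im_ofReal_mul]
  simp only [weight, imRatio, smul_eq_mul, ← hec]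
  ring

end Functional

/-! ### Partial derivatives of functions with a parameter -/

section Slices

variable {P E F : Type*} [NormedAddCommGroup P] [NormedSpace ℝ P] [NormedAddCommGroup E]
  [NormedSpace ℝ E] [NormedAddCommGroup F] [NormedSpace ℝ F] {S : Set P} {U : Set E}

/-- Differentiation is in the space variable only, so the parameter set needs just unique
differentiability; this admits time intervals closed at 0. -/
theorem contDiffOn_fderiv_slice (hS : UniqueDiffOn ℝ S) (hU : IsOpen U) {f : P → E → F}
    (hf : ContDiffOn ℝ ∞ (fun q : P × E => f q.1 q.2) (S ×ˢ U)) (v : E) :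
    ContDiffOn ℝ ∞ (fun q : P × E => fderiv ℝ (f q.1) q.2 v) (S ×ˢ U) := by
  have h1 : ContDiffOn ℝ ∞ (fderivWithin ℝ (fun q : P × E => f q.1 q.2) (S ×ˢ U)) (S ×ˢ U) :=
    hf.fderivWithin (hS.prod hU.uniqueDiffOn) (by simp)
  refine (h1.clm_apply (contDiffOn_const (c := ((0 : P), v)))).congr fun q hq => ?_
  have h2 := (hf.differentiableOn (by simp) q hq).hasFDerivWithinAt
  have h3 : HasFDerivWithinAt (fun y : E => (q.1, y)) (ContinuousLinearMap.inr ℝ P E) U q.2 :=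
    (hasFDerivAt_prodMk_right q.1 q.2).hasFDerivWithinAt
  have hm : MapsTo (fun y : E => (q.1, y)) U (S ×ˢ U) := fun y hy => mk_mem_prod hq.1 hy
  have h4 := (HasFDerivWithinAt.comp q.2 h2 h3 hm).hasFDerivAt (hU.mem_nhds hq.2)
  have h5 : fderiv ℝ (f q.1) q.2 = _ := h4.fderiv
  rw [h5]
  simp

theorem hasDerivAt_slice {I : Set ℝ} (hI : IsOpen I) (hU : IsOpen U) {f : ℝ → E → F}
    (hf : ContDiffOn ℝ ∞ (fun q : ℝ × E => f q.1 q.2) (I ×ˢ U)) {t : ℝ} (ht : t ∈ I) {y : E}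
    (hy : y ∈ U) : HasDerivAt (fun r => f r y)
      (fderiv ℝ (fun q : ℝ × E => f q.1 q.2) (t, y) (1, 0)) t := by
  have h2 := ((hf.contDiffAt ((hI.prod hU).mem_nhds (x := (t, y)) ⟨ht, hy⟩)).differentiableAt
    (by simp)).hasFDerivAt
  have h3 := (HasFDerivAt.comp t h2 (hasFDerivAt_prodMk_left t y)).hasDerivAt
  simpa [Function.comp_def] using h3

theorem fderiv_slice {I : Set P} (hI : IsOpen I) (hU : IsOpen U) {f : P → E → F}
    (hf : ContDiffOn ℝ ∞ (fun q : P × E => f q.1 q.2) (I ×ˢ U)) {t : P} (ht : t ∈ I) {y : E}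
    (hy : y ∈ U) (v : E) : fderiv ℝ (f t) y v =
      fderiv ℝ (fun q : P × E => f q.1 q.2) (t, y) (0, v) := by
  have h2 := ((hf.contDiffAt ((hI.prod hU).mem_nhds (x := (t, y)) ⟨ht, hy⟩)).differentiableAt
    (by simp)).hasFDerivAt
  have h3 : fderiv ℝ (f t) y = _ := (HasFDerivAt.comp y h2 (hasFDerivAt_prodMk_right t y)).fderiv
  rw [h3]
  simp

theorem contDiffOn_deriv_slice {I : Set ℝ} (hI : IsOpen I) (hU : IsOpen U) {f : ℝ → E → F}
    (hf : ContDiffOn ℝ ∞ (fun q : ℝ × E => f q.1 q.2) (I ×ˢ U)) :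
    ContDiffOn ℝ ∞ (fun q : ℝ × E => deriv (fun r => f r q.2) q.1) (I ×ˢ U) :=
  ((hf.fderiv_of_isOpen (hI.prod hU) (by simp)).clm_apply
    (contDiffOn_const (c := ((1 : ℝ), (0 : E))))).congr fun _ hq =>
      (hasDerivAt_slice hI hU hf hq.1 hq.2).deriv

/-- The derivatives in the parameter and in the variable commute. -/
theorem hasDerivAt_fderiv_slice {I : Set ℝ} (hI : IsOpen I) (hU : IsOpen U) {f : ℝ → E → F}
    (hf : ContDiffOn ℝ ∞ (fun q : ℝ × E => f q.1 q.2) (I ×ˢ U)) {t : ℝ} (ht : t ∈ I) {y : E}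
    (hy : y ∈ U) (v : E) : HasDerivAt (fun r => fderiv ℝ (f r) y v)
      (fderiv ℝ (fun z => deriv (fun r => f r z) t) y v) t := by
  have hIU := hI.prod hU
  have hm : I ×ˢ U ∈ 𝓝 (t, y) := hIU.mem_nhds ⟨ht, hy⟩
  set G : ℝ × E → F := fun q => f q.1 q.2
  have hG := hf.contDiffAt hm
  have hd : DifferentiableAt ℝ (fderiv ℝ G) (t, y) :=
    (hG.fderiv_right (m := ∞) (by simp)).differentiableAt (by simp)
  have hs : IsSymmSndFDerivAt ℝ G (t, y) :=
    hG.isSymmSndFDerivAt (by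
      rw [minSmoothness_of_isRCLikeNormedField]
      exact WithTop.coe_le_coe.2 (le_top (α := ℕ∞)))
  have h1 : (fun r => fderiv ℝ G (r, y) (0, v)) =ᶠ[𝓝 t] fun r => fderiv ℝ (f r) y v := by
    filter_upwards [hI.mem_nhds ht] with r hr using (fderiv_slice hI hU hf hr hy v).symm
  have h2 : (fun z => fderiv ℝ G (t, z) (1, 0)) =ᶠ[𝓝 y] fun z => deriv (fun r => f r z) t := by
    filter_upwards [hU.mem_nhds hy] with z hz using (hasDerivAt_slice hI hU hf ht hz).deriv.symm
  have h3 : HasDerivAt (fun r => fderiv ℝ G (r, y) (0, v))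
      (fderiv ℝ (fderiv ℝ G) (t, y) (1, 0) (0, v)) t := by
    have h := (HasFDerivAt.comp t hd.hasFDerivAt (hasFDerivAt_prodMk_left t y)).hasDerivAt
    simpa using h.clm_apply (hasDerivAt_const t ((0 : ℝ), v))
  have h4 : HasFDerivAt (fun z => fderiv ℝ G (t, z) (1, 0))
      (((fderiv ℝ (fderiv ℝ G) (t, y)).comp (ContinuousLinearMap.inr ℝ ℝ E)).flip (1, 0)) y := by
    have h := HasFDerivAt.comp y hd.hasFDerivAt (hasFDerivAt_prodMk_right t y)
    refine (h.clm_apply (hasFDerivAt_const ((1 : ℝ), (0 : E)) y)).congr_fderiv ?_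
    ext w
    simp
  rw [← h2.fderiv_eq, h4.fderiv]
  -- Schwarz's theorem for the function of both variables, in the directions (1,0) and (0,v).
  have h5 : ((fderiv ℝ (fderiv ℝ G) (t, y)).comp (ContinuousLinearMap.inr ℝ ℝ E)).flip (1, 0) v =
      fderiv ℝ (fderiv ℝ G) (t, y) (1, 0) (0, v) := by
    simpa using hs.eq (0, v) (1, 0)
  rw [h5]
  exact h3.congr_of_eventuallyEq h1.symm

end Slices

/-! ### Complex Hessians depending on a parameter -/

section Hessian

variable {n : ℕ} {P : Type*} [NormedAddCommGroup P] [NormedSpace ℝ P] {S : Set P}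
  {U : Set (Fin n → ℂ)}

theorem contDiffOn_hessC_slice (hS : UniqueDiffOn ℝ S) (hU : IsOpen U) {f : P → (Fin n → ℂ) → ℝ}
    (hf : ContDiffOn ℝ ∞ (fun q : P × (Fin n → ℂ) => f q.1 q.2) (S ×ˢ U)) (j k : Fin n) :
    ContDiffOn ℝ ∞ (fun q : P × (Fin n → ℂ) => hessC (f q.1) q.2 j k) (S ×ˢ U) := by
  have h : ∀ u v, ContDiffOn ℝ ∞ (fun q : P × (Fin n → ℂ) => secondDeriv (f q.1) q.2 u v)
      (S ×ˢ U) := fun u v =>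
    contDiffOn_fderiv_slice hS hU (f := fun p z => fderiv ℝ (f p) z v)
      (contDiffOn_fderiv_slice hS hU hf v) u
  exact contDiffOn_const.mul ((contDiffOn_ofReal ((h _ _).add (h _ _))).add
    (contDiffOn_const.mul (contDiffOn_ofReal ((h _ _).sub (h _ _)))))

theorem hasDerivAt_hessC {I : Set ℝ} (hI : IsOpen I) (hU : IsOpen U) {f : ℝ → (Fin n → ℂ) → ℝ}
    (hf : ContDiffOn ℝ ∞ (fun q : ℝ × (Fin n → ℂ) => f q.1 q.2) (I ×ˢ U)) {t : ℝ} (ht : t ∈ I)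
    {y : Fin n → ℂ} (hy : y ∈ U) (j k : Fin n) : HasDerivAt (fun r => hessC (f r) y j k)
      (hessC (fun z => deriv (fun r => f r z) t) y j k) t := by
  have h : ∀ u v, HasDerivAt (fun r => secondDeriv (f r) y u v)
      (secondDeriv (fun z => deriv (fun r => f r z) t) y u v) t := fun u v => by
    have h1 := hasDerivAt_fderiv_slice hI hU (f := fun r z => fderiv ℝ (f r) z v)
      (contDiffOn_fderiv_slice hI.uniqueDiffOn hU hf v) ht hy u
    have h2 : (fun z => deriv (fun r => fderiv ℝ (f r) z v) t) =ᶠ[𝓝 y]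
        fun z => fderiv ℝ (fun z => deriv (fun r => f r z) t) z v := by
      filter_upwards [hU.mem_nhds hy] with z hz using
        (hasDerivAt_fderiv_slice hI hU hf ht hz v).deriv
    rw [h2.fderiv_eq] at h1
    exact h1
  exact ((((h _ _).add (h _ _)).ofReal_comp).add
    ((((h _ _).sub (h _ _)).ofReal_comp).const_mul Complex.I)).const_mul (1 / 4 : ℂ)

end Hessian

/-! ### Differentiation under the integral sign over compact spaces -/

section ParametricIntegral

variable {Y : Type*} [TopologicalSpace Y] [T2Space Y] [CompactSpace Y] [MeasurableSpace Y]
  [BorelSpace Y] {μ : Measure Y} [IsFiniteMeasure μ]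

theorem hasDerivAt_integral_of_compact {I : Set ℝ} (hI : IsOpen I) {f f' : ℝ → Y → ℝ}
    (hf : ∀ t ∈ I, Continuous (f t))
    (hf' : ContinuousOn (fun q : ℝ × Y => f' q.1 q.2) (I ×ˢ univ))
    (hd : ∀ t ∈ I, ∀ y, HasDerivAt (fun r => f r y) (f' t y) t) {t : ℝ} (ht : t ∈ I) :
    HasDerivAt (fun r => ∫ y, f r y ∂μ) (∫ y, f' t y ∂μ) t := by
  -- On a compact neighbourhood of t times Y the derivative is bounded, and a constant is an
  -- integrable bound for a finite measure.
  obtain ⟨K, hKn, hKI, hK⟩ := LocallyCompactSpace.local_compact_nhds t I (hI.mem_nhds ht)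
  obtain ⟨C, hC⟩ := (hK.prod (isCompact_univ (X := Y))).exists_bound_of_continuousOn
    (hf'.mono (prod_mono hKI subset_rfl))
  have hc : Continuous (f' t) := by
    rw [← continuousOn_univ]
    exact hf'.comp (by fun_prop) fun y _ => mk_mem_prod ht (mem_univ y)
  refine (hasDerivAt_integral_of_dominated_loc_of_deriv_le (bound := fun _ => C) hKn ?_
    (integrable_of_continuous (hf t ht)) hc.aestronglyMeasurable ?_ (integrable_const C) ?_).2
  · filter_upwards [hI.mem_nhds ht] with r hr using (hf r hr).aestronglyMeasurable
  · exact ae_of_all _ fun y r hr => hC (r, y) (mk_mem_prod hr (mem_univ y))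
  · exact ae_of_all _ fun y r hr => hd r (hKI hr) y

theorem intervalIntegral_eq_integral_Icc (f : ℝ → ℝ) :
    ∫ s in (0 : ℝ)..1, f s = ∫ s : Icc (0 : ℝ) 1, f s := by
  rw [intervalIntegral.integral_of_le zero_le_one, ← integral_Icc_eq_integral_Ioc,
    ← integral_subtype measurableSet_Icc]

theorem hasDerivAt_intervalIntegral {I : Set ℝ} (hI : IsOpen I) {f f' : ℝ → ℝ → ℝ}
    (hf : ∀ t ∈ I, Continuous (f t))
    (hf' : ContinuousOn (fun q : ℝ × ℝ => f' q.1 q.2) (I ×ˢ univ))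
    (hd : ∀ t ∈ I, ∀ s, HasDerivAt (fun r => f r s) (f' t s) t) {t : ℝ} (ht : t ∈ I) :
    HasDerivAt (fun r => ∫ s in (0 : ℝ)..1, f r s) (∫ s in (0 : ℝ)..1, f' t s) t := by
  simp only [intervalIntegral_eq_integral_Icc]
  exact hasDerivAt_integral_of_compact hI (f := fun t (s : Icc (0 : ℝ) 1) => f t s)
    (f' := fun t (s : Icc (0 : ℝ) 1) => f' t s) (fun t ht => (hf t ht).comp continuous_subtype_val)
    (hf'.comp (by fun_prop) fun q hq => mk_mem_prod hq.1 (mem_univ _)) (fun t ht s => hd t ht s) ht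

theorem continuousOn_intervalIntegral {P : Type*} [TopologicalSpace P] {S : Set P}
    {f : P → ℝ → ℝ} (hf : ContinuousOn (fun q : P × ℝ => f q.1 q.2) (S ×ˢ univ)) :
    ContinuousOn (fun p => ∫ s in (0 : ℝ)..1, f p s) S := by
  simp only [intervalIntegral_eq_integral_Icc]
  refine continuousOn_integral_of_compact_support (f := fun p (s : Icc (0 : ℝ) 1) => f p s)
    isCompact_univ ?_ fun p x _ hx => (hx (mem_univ x)).elim
  exact hf.comp (by fun_prop) fun q hq => mk_mem_prod hq.1 (mem_univ _)

end ParametricIntegral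

/-! ### Smooth families of functions and the variation of (α_φ + iΩ)ⁿ -/

section Paths

variable {n : ℕ} {X : Type*} [TopologicalSpace X] [ChartedSpace (Fin n → ℂ) X]
  {P : Type*} [NormedAddCommGroup P] [NormedSpace ℝ P] {S : Set P}

/-- A family of functions on `X` depends smoothly on the point and on a parameter in `S`. -/
def PathSmooth (n : ℕ) {X : Type*} [TopologicalSpace X] [ChartedSpace (Fin n → ℂ) X]
    {P : Type*} [NormedAddCommGroup P] [NormedSpace ℝ P] (S : Set P) (φ : P → X → ℝ) : Prop :=
  ∀ e ∈ atlas (Fin n → ℂ) X, ContDiffOn ℝ ∞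
    (fun q : P × (Fin n → ℂ) => φ q.1 (e.symm q.2)) (S ×ˢ e.target)

theorem PathSmooth.chartSmooth {φ : P → X → ℝ} (hφ : PathSmooth n S φ) {p : P} (hp : p ∈ S) :
    ChartSmooth n (φ p) := fun e he =>
  (hφ e he).comp (contDiffOn_const.prodMk contDiffOn_id) fun _ hy => mk_mem_prod hp hy

theorem ChartSmooth.pathSmooth {ψ : X → ℝ} (hψ : ChartSmooth n ψ) :
    PathSmooth n S fun _ => ψ := fun e he =>
  (hψ e he).comp contDiffOn_snd fun _ hq => hq.2

theorem pathSmooth_of_contDiffOn {g : P → ℝ} (hg : ContDiffOn ℝ ∞ g S) :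
    PathSmooth n S fun p (_ : X) => g p := fun _ _ =>
  hg.comp contDiffOn_fst fun _ hq => hq.1

theorem PathSmooth.add {φ ψ : P → X → ℝ} (hφ : PathSmooth n S φ) (hψ : PathSmooth n S ψ) :
    PathSmooth n S fun p x => φ p x + ψ p x := fun e he => (hφ e he).add (hψ e he)

theorem PathSmooth.mul {φ ψ : P → X → ℝ} (hφ : PathSmooth n S φ) (hψ : PathSmooth n S ψ) :
    PathSmooth n S fun p x => φ p x * ψ p x := fun e he => (hφ e he).mul (hψ e he)

theorem PathSmooth.comp {Q : Type*} [NormedAddCommGroup Q] [NormedSpace ℝ Q] {R : Set Q}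
    {φ : P → X → ℝ} (hφ : PathSmooth n S φ) {g : Q → P} (hg : ContDiffOn ℝ ∞ g R)
    (hgR : MapsTo g R S) : PathSmooth n R fun p => φ (g p) := fun e he =>
  (hφ e he).comp ((hg.comp contDiffOn_fst fun _ hq => hq.1).prodMk contDiffOn_snd)
    fun _ hq => mk_mem_prod (hgR hq.1) hq.2

theorem PathSmooth.deriv {I : Set ℝ} (hI : IsOpen I) {φ : ℝ → X → ℝ} (hφ : PathSmooth n I φ) :
    PathSmooth n I fun t x => deriv (fun r => φ r x) t := fun e he =>
  contDiffOn_deriv_slice hI e.open_target (f := fun r y => φ r (e.symm y)) (hφ e he)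

theorem PathSmooth.hasDerivAt {I : Set ℝ} (hI : IsOpen I) {φ : ℝ → X → ℝ}
    (hφ : PathSmooth n I φ) {t : ℝ} (ht : t ∈ I) (x : X) :
    HasDerivAt (fun r => φ r x) (_root_.deriv (fun r => φ r x) t) t := by
  set c := chartAt (Fin n → ℂ) x
  have hx : x ∈ c.source := mem_chart_source _ _
  have h := hasDerivAt_slice hI c.open_target (f := fun r y => φ r (c.symm y))
    (hφ c (chart_mem_atlas _ _)) ht (c.map_source hx)
  rw [c.left_inv hx] at h
  exact h.differentiableAt.hasDerivAt

theorem continuousOn_prod_of_chart (n : ℕ) {X : Type*} [TopologicalSpace X]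
    [ChartedSpace (Fin n → ℂ) X] {P F : Type*} [TopologicalSpace P] [TopologicalSpace F]
    {S : Set P} {g : P × X → F} (hg : ∀ e ∈ atlas (Fin n → ℂ) X,
      ContinuousOn (fun q : P × (Fin n → ℂ) => g (q.1, e.symm q.2)) (S ×ˢ e.target)) :
    ContinuousOn g (S ×ˢ univ) := by
  rintro ⟨p, x⟩ hpx
  set c := chartAt (Fin n → ℂ) x
  have hx : x ∈ c.source := mem_chart_source _ _
  have h : ContinuousOn (fun q : P × X => g (q.1, c.symm (c q.2))) (S ×ˢ c.source) :=
    (hg c (chart_mem_atlas _ _)).comp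
      (continuousOn_fst.prodMk (c.continuousOn.comp continuousOn_snd fun _ hq => hq.2))
      fun _ hq => mk_mem_prod hq.1 (c.map_source hq.2)
  have h2 : ContinuousOn g (S ×ˢ c.source) := h.congr fun q hq => by simp only [c.left_inv hq.2]
  refine (h2 (p, x) ⟨hpx.1, hx⟩).mono_of_mem_nhdsWithin ?_
  exact mem_nhdsWithin_prod_iff.2 ⟨S, self_mem_nhdsWithin, c.source,
    mem_nhdsWithin_of_mem_nhds (c.open_source.mem_nhds hx), subset_rfl⟩

theorem PathSmooth.continuousOn {φ : P → X → ℝ} (hφ : PathSmooth n S φ) :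
    ContinuousOn (fun q : P × X => φ q.1 q.2) (S ×ˢ univ) :=
  continuousOn_prod_of_chart n fun e he => (hφ e he).continuousOn

theorem contDiffOn_det_chartMatrix {Ω : DForm n X 2 ℝ} (hΩ : Ω.IsSmooth)
    {e : OpenPartialHomeomorph X (Fin n → ℂ)} (he : e ∈ atlas (Fin n → ℂ) X) :
    ContDiffOn ℝ ∞ (fun q : P × (Fin n → ℂ) => (chartMatrix Ω e q.2).det) (S ×ˢ e.target) :=
  (contDiffOn_det (hΩ.contDiffOn_chartMatrix he)).comp contDiffOn_snd fun _ hq => hq.2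

variable [IsManifold 𝓘(ℂ, Fin n → ℂ) ω X] {α Ω : DForm n X 2 ℝ}

theorem cplxChart_twist {φ : X → ℝ} (hφ : ChartSmooth n φ)
    {e : OpenPartialHomeomorph X (Fin n → ℂ)} (he : e ∈ atlas (Fin n → ℂ) X) {y : Fin n → ℂ}
    (hy : y ∈ e.target) :
    cplxChart (twist α φ) Ω e y = cplxChart α Ω e y + hessC (φ ∘ e.symm) y := by
  rw [cplxChart, cplxChart, chartMatrix, twist, DForm.inChart_add, herm_add,
    herm_inChart_iddbar hφ he hy, add_right_comm, ← chartMatrix]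

theorem contDiffOn_cplxChart_twist (hα : α.IsSmooth) (hΩ : Ω.IsSmooth) (hS : UniqueDiffOn ℝ S)
    {φ : P → X → ℝ} (hφ : PathSmooth n S φ) {e : OpenPartialHomeomorph X (Fin n → ℂ)}
    (he : e ∈ atlas (Fin n → ℂ) X) (j k : Fin n) :
    ContDiffOn ℝ ∞ (fun q : P × (Fin n → ℂ) => cplxChart (twist α (φ q.1)) Ω e q.2 j k)
      (S ×ˢ e.target) := by
  have h : ContDiffOn ℝ ∞ (fun q : P × (Fin n → ℂ) => cplxChart α Ω e q.2 j k +
      hessC (φ q.1 ∘ e.symm) q.2 j k) (S ×ˢ e.target) :=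
    ((contDiffOn_cplxChart hα hΩ he j k).comp contDiffOn_snd fun _ hq => hq.2).add
      (contDiffOn_hessC_slice hS e.open_target (f := fun p => φ p ∘ e.symm) (hφ e he) j k)
  refine h.congr fun q hq => ?_
  rw [cplxChart_twist (hφ.chartSmooth hq.1) he hq.2]
  rfl

theorem continuousOn_ratio_twist (hα : ChartClosed α) (hΩ : IsKahlerForm Ω)
    (hS : UniqueDiffOn ℝ S) {φ : P → X → ℝ} (hφ : PathSmooth n S φ) :
    ContinuousOn (fun q : P × X => ratio (twist α (φ q.1)) Ω q.2) (S ×ˢ univ) := by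
  refine continuousOn_prod_of_chart n fun e he => ?_
  have h : ContinuousOn (fun q : P × (Fin n → ℂ) => (cplxChart (twist α (φ q.1)) Ω e q.2).det /
      (chartMatrix Ω e q.2).det) (S ×ˢ e.target) :=
    (contDiffOn_det (contDiffOn_cplxChart_twist hα.smooth hΩ.smooth hS hφ he)).continuousOn.div
      (contDiffOn_det_chartMatrix hΩ.smooth he).continuousOn
      fun q hq => (det_chartMatrix hΩ he hq.2).ne'
  exact h.congr fun q hq =>
    ratio_symm (hα.twist (hφ.chartSmooth hq.1)).oneOne hΩ.isOneOne he hq.2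

theorem continuousOn_linRatio_twist (hα : ChartClosed α) (hΩ : IsKahlerForm Ω)
    (hS : UniqueDiffOn ℝ S) {φ ψ : P → X → ℝ} (hφ : PathSmooth n S φ) (hψ : PathSmooth n S ψ) :
    ContinuousOn (fun q : P × X => linRatio (twist α (φ q.1)) Ω (ψ q.1) q.2) (S ×ˢ univ) := by
  refine continuousOn_prod_of_chart n fun e he => ?_
  have h : ContinuousOn (fun q : P × (Fin n → ℂ) =>
      ((cplxChart (twist α (φ q.1)) Ω e q.2).adjugate * hessC (ψ q.1 ∘ e.symm) q.2).trace /
      (chartMatrix Ω e q.2).det) (S ×ˢ e.target) :=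
    (contDiffOn_trace_mul (contDiffOn_adjugate
      (contDiffOn_cplxChart_twist hα.smooth hΩ.smooth hS hφ he))
      (contDiffOn_hessC_slice hS e.open_target (f := fun p => ψ p ∘ e.symm)
        (hψ e he))).continuousOn.div (contDiffOn_det_chartMatrix hΩ.smooth he).continuousOn
      fun q hq => (det_chartMatrix hΩ he hq.2).ne'
  exact h.congr fun q hq => linRatio_symm (hα.twist (hφ.chartSmooth hq.1)).oneOne hΩ.isOneOne
    (hψ.chartSmooth hq.1) he hq.2

/-- The variation of `(α_φ + iΩ)ⁿ` is given by the linearized operator. -/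
theorem hasDerivAt_ratio (hα : ChartClosed α) (hΩ : IsKahlerForm Ω) {I : Set ℝ} (hI : IsOpen I)
    {φ : ℝ → X → ℝ} (hφ : PathSmooth n I φ) {t : ℝ} (ht : t ∈ I) (x : X) :
    HasDerivAt (fun r => ratio (twist α (φ r)) Ω x)
      (linRatio (twist α (φ t)) Ω (fun x => deriv (fun r => φ r x) t) x) t := by
  set e := chartAt (Fin n → ℂ) x
  have he : e ∈ atlas (Fin n → ℂ) X := chart_mem_atlas _ _
  have hx : x ∈ e.source := mem_chart_source _ _
  have hy := e.map_source hx
  have hM : ∀ i j, HasFDerivAt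
      (fun r => (cplxChart α Ω e (e x) + hessC (φ r ∘ e.symm) (e x)) i j)
      (ContinuousLinearMap.toSpanSingleton ℝ
        (hessC ((fun x => deriv (fun r => φ r x) t) ∘ e.symm) (e x) i j)) t := fun i j =>
    ((hasDerivAt_hessC hI e.open_target (f := fun p => φ p ∘ e.symm) (hφ e he) ht hy i j).const_add
      (cplxChart α Ω e (e x) i j)).hasFDerivAt
  have h1 := (hasFDerivAt_det hM).hasDerivAt.div_const (chartMatrix Ω e (e x)).det
  have h2 : (fun r => ratio (twist α (φ r)) Ω x) =ᶠ[𝓝 t] fun r =>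
      (cplxChart α Ω e (e x) + hessC (φ r ∘ e.symm) (e x)).det / (chartMatrix Ω e (e x)).det := by
    filter_upwards [hI.mem_nhds ht] with r hr
    rw [← cplxChart_twist (hφ.chartSmooth hr) he hy,
      ← ratio_symm (hα.twist (hφ.chartSmooth hr)).oneOne hΩ.isOneOne he hy, e.left_inv hx]
  have h3 := linRatio_symm (hα.twist (hφ.chartSmooth ht)).oneOne hΩ.isOneOne
    ((hφ.deriv hI).chartSmooth ht) he hy
  rw [e.left_inv hx, cplxChart_twist (hφ.chartSmooth ht) he hy] at h3
  rw [h3]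
  refine (h1.congr_of_eventuallyEq h2).congr_deriv ?_
  congr 1
  simp only [sum_apply, smul_apply, ContinuousLinearMap.toSpanSingleton_apply, one_smul,
    smul_eq_mul, Matrix.trace, Matrix.diag, Matrix.mul_apply]
  rw [Finset.sum_comm]

end Paths

/-! ### First variation of the functional -/

section FunctionalVariation

/-- The two-parameter family sφ_p joins 0 to φ_p, as in the integral that defines the functional. -/
theorem PathSmooth.segment {n : ℕ} {X : Type*} [TopologicalSpace X]
    [ChartedSpace (Fin n → ℂ) X] {P : Type*} [NormedAddCommGroup P] [NormedSpace ℝ P] {S : Set P}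
    {φ : P → X → ℝ} (hφ : PathSmooth n S φ) :
    PathSmooth n (S ×ˢ (univ : Set ℝ)) fun q x => q.2 * φ q.1 x :=
  (pathSmooth_of_contDiffOn contDiffOn_snd).mul (hφ.comp contDiffOn_fst fun _ hq => hq.1)

variable {n : ℕ} {X : Type*} [TopologicalSpace X] [ChartedSpace (Fin n → ℂ) X]
  [IsManifold 𝓘(ℂ, Fin n → ℂ) ω X] [T2Space X] [CompactSpace X] {α Ω : DForm n X 2 ℝ}
  {P : Type*} [NormedAddCommGroup P] [NormedSpace ℝ P] {S : Set P}

/-- The variation of `imRatio Ω α φ` in the direction `ψ`. -/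
def imLin (Ω α : DForm n X 2 ℝ) (φ ψ : X → ℝ) (x : X) : ℝ :=
  (Complex.exp (-Complex.I * (angle Ω α : ℂ)) * linRatio (twist α φ) Ω ψ x).im

theorem continuousOn_imRatio (hα : ChartClosed α) (hΩ : IsKahlerForm Ω)
    (hS : UniqueDiffOn ℝ S) {φ : P → X → ℝ} (hφ : PathSmooth n S φ) :
    ContinuousOn (fun q : P × X => imRatio Ω α (φ q.1) q.2) (S ×ˢ univ) :=
  Complex.continuous_im.comp_continuousOn
    (continuousOn_const.mul (continuousOn_ratio_twist hα hΩ hS hφ))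

theorem continuousOn_imLin (hα : ChartClosed α) (hΩ : IsKahlerForm Ω)
    (hS : UniqueDiffOn ℝ S) {φ ψ : P → X → ℝ} (hφ : PathSmooth n S φ) (hψ : PathSmooth n S ψ) :
    ContinuousOn (fun q : P × X => imLin Ω α (φ q.1) (ψ q.1) q.2) (S ×ˢ univ) :=
  Complex.continuous_im.comp_continuousOn
    (continuousOn_const.mul (continuousOn_linRatio_twist hα hΩ hS hφ hψ))

theorem hasDerivAt_imRatio (hα : ChartClosed α) (hΩ : IsKahlerForm Ω) {I : Set ℝ} (hI : IsOpen I)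
    {φ : ℝ → X → ℝ} (hφ : PathSmooth n I φ) {t : ℝ} (ht : t ∈ I) (x : X) :
    HasDerivAt (fun r => imRatio Ω α (φ r) x)
      (imLin Ω α (φ t) (fun x => deriv (fun r => φ r x) t) x) t :=
  Complex.imCLM.hasFDerivAt.comp_hasDerivAt t ((hasDerivAt_ratio hα hΩ hI hφ ht x).const_mul _)

variable [MeasurableSpace X] [BorelSpace X]

theorem integral_im_of_continuous {μ : Measure X} [IsFiniteMeasure μ] {f : X → ℂ}
    (hf : Continuous f) : ∫ x, (f x).im ∂μ = (∫ x, f x ∂μ).im :=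
  Complex.imCLM.integral_comp_comm (integrable_of_continuous hf)

theorem integral_imLin_symm (hα : ChartClosed α) (hΩ : IsKahlerForm Ω) {φ χ ψ : X → ℝ}
    (hφ : ChartSmooth n φ) (hχ : ChartSmooth n χ) (hψ : ChartSmooth n ψ) :
    ∫ x, χ x * imLin Ω α φ ψ x ∂volMeasure Ω = ∫ x, ψ x * imLin Ω α φ χ x ∂volMeasure Ω := by
  have hfin := isFiniteMeasure_volMeasure (X := X) hΩ.smooth
  have h : ∀ {χ ψ : X → ℝ}, ChartSmooth n χ → ChartSmooth n ψ →
      ∫ x, χ x * imLin Ω α φ ψ x ∂volMeasure Ω =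
        (Complex.exp (-Complex.I * (angle Ω α : ℂ)) *
          ∫ x, (χ x : ℂ) * linRatio (twist α φ) Ω ψ x ∂volMeasure Ω).im := fun {χ ψ} hχ hψ => by
    have hc : Continuous fun x => Complex.exp (-Complex.I * (angle Ω α : ℂ)) *
        ((χ x : ℂ) * linRatio (twist α φ) Ω ψ x) := continuous_const.mul
      ((Complex.continuous_ofReal.comp hχ.continuous).mul
        (continuous_linRatio (hα.twist hφ) hΩ hψ))
    rw [← integral_const_mul, ← integral_im_of_continuous hc]
    refine integral_congr_ae (ae_of_all _ fun x => ?_)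
    simp only [imLin]
    rw [mul_left_comm, Complex.im_ofReal_mul]
  rw [h hχ hψ, h hψ hχ, integral_linRatio_symm (hα.twist hφ) hΩ hχ hψ]

theorem continuousOn_dFunctionalJ (hα : ChartClosed α) (hΩ : IsKahlerForm Ω)
    (hS : UniqueDiffOn ℝ S) {φ ψ : P → X → ℝ} (hφ : PathSmooth n S φ) (hψ : PathSmooth n S ψ) :
    ContinuousOn (fun p => dFunctionalJ Ω α (φ p) (ψ p)) S := by
  have hfin := isFiniteMeasure_volMeasure (X := X) hΩ.smooth
  have h : ContinuousOn (fun p => ∫ x, ψ p x * imRatio Ω α (φ p) x ∂volMeasure Ω) S :=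
    continuousOn_integral_of_compact_support (f := fun p x => ψ p x * imRatio Ω α (φ p) x)
      isCompact_univ (hψ.continuousOn.mul (continuousOn_imRatio hα hΩ hS hφ))
      fun p x _ hx => (hx (mem_univ x)).elim
  exact h.congr fun p hp =>
    dFunctionalJ_eq hα hΩ (hφ.chartSmooth hp) (hψ.chartSmooth hp).continuous

theorem hasDerivAt_dFunctionalJ (hα : ChartClosed α) (hΩ : IsKahlerForm Ω) {I : Set ℝ}
    (hI : IsOpen I) {φ ψ : ℝ → X → ℝ} (hφ : PathSmooth n I φ) (hψ : PathSmooth n I ψ) {t : ℝ}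
    (ht : t ∈ I) : HasDerivAt (fun r => dFunctionalJ Ω α (φ r) (ψ r))
      (∫ x, (deriv (fun r => ψ r x) t * imRatio Ω α (φ t) x +
        ψ t x * imLin Ω α (φ t) (fun x => deriv (fun r => φ r x) t) x) ∂volMeasure Ω) t := by
  have hfin := isFiniteMeasure_volMeasure (X := X) hΩ.smooth
  have hL := continuousOn_imLin hα hΩ hI.uniqueDiffOn hφ (hφ.deriv hI)
  have h1 : ContinuousOn (fun q : ℝ × X => deriv (fun r => ψ r q.2) q.1 * imRatio Ω α (φ q.1) q.2 +
      ψ q.1 q.2 * imLin Ω α (φ q.1) (fun x => deriv (fun r => φ r x) q.1) q.2) (I ×ˢ univ) :=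
    ((hψ.deriv hI).continuousOn.fun_mul (continuousOn_imRatio hα hΩ hI.uniqueDiffOn hφ)).fun_add
      (hψ.continuousOn.fun_mul hL)
  have h2 : ∀ r ∈ I, Continuous fun x => ψ r x * imRatio Ω α (φ r) x := fun r hr =>
    (hψ.chartSmooth hr).continuous.mul (continuous_imRatio hα hΩ (hφ.chartSmooth hr))
  have h3 : ∀ r ∈ I, ∀ x, HasDerivAt (fun r => ψ r x * imRatio Ω α (φ r) x)
      (deriv (fun r => ψ r x) r * imRatio Ω α (φ r) x +
        ψ r x * imLin Ω α (φ r) (fun x => deriv (fun r => φ r x) r) x) r := fun r hr x =>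
    (hψ.hasDerivAt hI hr x).fun_mul (hasDerivAt_imRatio hα hΩ hI hφ hr x)
  have h := hasDerivAt_integral_of_compact (μ := volMeasure Ω) hI h2 h1 h3 ht
  refine h.congr_of_eventuallyEq ?_
  filter_upwards [hI.mem_nhds ht] with r hr
  exact dFunctionalJ_eq hα hΩ (hφ.chartSmooth hr) (hψ.chartSmooth hr).continuous

theorem continuousOn_functionalJ (hα : ChartClosed α) (hΩ : IsKahlerForm Ω)
    (hS : UniqueDiffOn ℝ S) {φ : P → X → ℝ} (hφ : PathSmooth n S φ) :
    ContinuousOn (fun p => functionalJ Ω α (φ p)) S :=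
  continuousOn_intervalIntegral (f := fun p s => dFunctionalJ Ω α (s • φ p) (φ p))
    (continuousOn_dFunctionalJ hα hΩ (hS.prod uniqueDiffOn_univ) hφ.segment
      (hφ.comp contDiffOn_fst fun _ hq => hq.1))

/-- The common value of the mixed derivatives of `(s, t) ↦ s φₜ` under the one-form
`dFunctionalJ`. -/
def mixedVar (Ω α : DForm n X 2 ℝ) (φ φ' : X → ℝ) (s : ℝ) : ℝ :=
  ∫ x, (φ' x * imRatio Ω α (s • φ) x + φ x * imLin Ω α (s • φ) (s • φ') x) ∂volMeasure Ω

theorem continuousOn_mixedVar (hα : ChartClosed α) (hΩ : IsKahlerForm Ω)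
    (hS : UniqueDiffOn ℝ S) {φ φ' : P → X → ℝ} (hφ : PathSmooth n S φ) (hφ' : PathSmooth n S φ') :
    ContinuousOn (fun q : P × ℝ => mixedVar Ω α (φ q.1) (φ' q.1) q.2) (S ×ˢ univ) := by
  have hfin := isFiniteMeasure_volMeasure (X := X) hΩ.smooth
  have hSu : UniqueDiffOn ℝ (S ×ˢ (univ : Set ℝ)) := hS.prod uniqueDiffOn_univ
  have hfst : PathSmooth n (S ×ˢ (univ : Set ℝ)) fun q => φ q.1 :=
    hφ.comp contDiffOn_fst fun _ hq => hq.1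
  have hfst' : PathSmooth n (S ×ˢ (univ : Set ℝ)) fun q => φ' q.1 :=
    hφ'.comp contDiffOn_fst fun _ hq => hq.1
  have h1 := hfst'.continuousOn.mul (continuousOn_imRatio hα hΩ hSu hφ.segment)
  have h2 := hfst.continuousOn.mul (continuousOn_imLin hα hΩ hSu hφ.segment hφ'.segment)
  have h3 : ContinuousOn (fun q : (P × ℝ) × X => φ' q.1.1 q.2 * imRatio Ω α (q.1.2 • φ q.1.1) q.2 +
      φ q.1.1 q.2 * imLin Ω α (q.1.2 • φ q.1.1) (q.1.2 • φ' q.1.1) q.2)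
      ((S ×ˢ (univ : Set ℝ)) ×ˢ univ) := h1.add h2
  exact continuousOn_integral_of_compact_support isCompact_univ h3
    fun p x _ hx => (hx (mem_univ x)).elim

theorem hasDerivAt_mixedVar_left (hα : ChartClosed α) (hΩ : IsKahlerForm Ω) {I : Set ℝ}
    (hI : IsOpen I) {φ : ℝ → X → ℝ} (hφ : PathSmooth n I φ) {t : ℝ} (ht : t ∈ I) (s : ℝ) :
    HasDerivAt (fun r => dFunctionalJ Ω α (s • φ r) (φ r))
      (mixedVar Ω α (φ t) (fun x => deriv (fun r => φ r x) t) s) t := by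
  have hs : PathSmooth n I fun r x => s * φ r x :=
    (pathSmooth_of_contDiffOn contDiffOn_const).mul hφ
  have h := hasDerivAt_dFunctionalJ hα hΩ hI hs hφ ht
  have h1 : (fun x => deriv (fun r => s * φ r x) t) = s • fun x => deriv (fun r => φ r x) t := by
    ext x
    simp
  rw [h1] at h
  exact h

/-- This is closedness of the one-form. Direct differentiation in s gives sψ · Lφ in place of φ ·
L(sψ), and the symmetry of L identifies the integrals, so this derivative agrees with the one in
`hasDerivAt_mixedVar_left`. -/
theorem hasDerivAt_mixedVar_right (hα : ChartClosed α) (hΩ : IsKahlerForm Ω) {φ ψ : X → ℝ}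
    (hφ : ChartSmooth n φ) (hψ : ChartSmooth n ψ) (s : ℝ) :
    HasDerivAt (fun s : ℝ => dFunctionalJ Ω α (s • φ) (s • ψ)) (mixedVar Ω α φ ψ s) s := by
  have hfin := isFiniteMeasure_volMeasure (X := X) hΩ.smooth
  have hline : ∀ {ψ : X → ℝ}, ChartSmooth n ψ → PathSmooth n univ fun (s : ℝ) x => s * ψ x :=
    fun h => (pathSmooth_of_contDiffOn contDiffOn_id).mul h.pathSmooth
  have h := hasDerivAt_dFunctionalJ hα hΩ isOpen_univ (hline hφ) (hline hψ) (mem_univ s)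
  have h1 : ∀ (ψ : X → ℝ) x, deriv (fun r : ℝ => r * ψ x) s = ψ x := fun ψ x => by simp
  simp only [h1] at h
  have hs : ChartSmooth n (s • φ) := (hline hφ).chartSmooth (mem_univ s)
  have hs' : ChartSmooth n (s • ψ) := (hline hψ).chartSmooth (mem_univ s)
  have hL : ∀ {χ : X → ℝ}, ChartSmooth n χ → Continuous (imLin Ω α (s • φ) χ) := fun hχ =>
    Complex.continuous_im.comp (continuous_const.mul (continuous_linRatio (hα.twist hs) hΩ hχ))
  have hi : ∀ {χ η : X → ℝ}, Continuous χ → Continuous η →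
      Integrable (fun x => χ x * η x) (volMeasure Ω) := fun h1 h2 =>
    integrable_of_continuous (h1.mul h2)
  have hc := continuous_imRatio hα hΩ hs
  have h2 : mixedVar Ω α φ ψ s = ∫ x, (ψ x * imRatio Ω α (s • φ) x +
      (s • ψ) x * imLin Ω α (s • φ) φ x) ∂volMeasure Ω := by
    rw [mixedVar, integral_add (hi hψ.continuous hc) (hi hφ.continuous (hL hs')),
      integral_add (hi hψ.continuous hc) (hi hs'.continuous (hL hφ)),
      integral_imLin_symm hα hΩ hs hφ hs']
  rw [h2]
  exact h

/-- The first variation of the `𝒥`-functional. -/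
theorem hasDerivAt_functionalJ (hα : ChartClosed α) (hΩ : IsKahlerForm Ω) {I : Set ℝ}
    (hI : IsOpen I) {φ : ℝ → X → ℝ} (hφ : PathSmooth n I φ) {t : ℝ} (ht : t ∈ I) :
    HasDerivAt (fun r => functionalJ Ω α (φ r))
      (dFunctionalJ Ω α (φ t) fun x => deriv (fun r => φ r x) t) t := by
  have hφ' := hφ.deriv hI
  have hfst : PathSmooth n (I ×ˢ (univ : Set ℝ)) fun q => φ q.1 :=
    hφ.comp contDiffOn_fst fun _ hq => hq.1
  have hc : ∀ r ∈ I, Continuous fun s : ℝ => dFunctionalJ Ω α (s • φ r) (φ r) := fun r hr => by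
    rw [← continuousOn_univ]
    exact (continuousOn_dFunctionalJ hα hΩ (hI.uniqueDiffOn.prod uniqueDiffOn_univ) hφ.segment
      hfst).comp (f := fun s : ℝ => (r, s)) (by fun_prop) fun s hs => mk_mem_prod hr hs
  have hD := continuousOn_mixedVar hα hΩ hI.uniqueDiffOn hφ hφ'
  have hJ := hasDerivAt_intervalIntegral hI hc hD
    (fun r hr s => hasDerivAt_mixedVar_left hα hΩ hI hφ hr s) ht
  have hDt : Continuous (mixedVar Ω α (φ t) fun x => deriv (fun r => φ r x) t) := by
    rw [← continuousOn_univ]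
    exact hD.comp (f := fun s : ℝ => (t, s)) (by fun_prop) fun s hs => mk_mem_prod ht hs
  -- The derivative under the integral is recognized as an s-derivative, so the integral over [0,1]
  -- is a difference of boundary values.
  have hint := intervalIntegral.integral_eq_sub_of_hasDerivAt (a := 0) (b := 1)
    (fun s _ => hasDerivAt_mixedVar_right hα hΩ (hφ.chartSmooth ht) (hφ'.chartSmooth ht) s)
    (hDt.intervalIntegrable _ _)
  -- The boundary value at s = 0 vanishes because the direction sφ̇ does.
  have h0 : dFunctionalJ Ω α ((0 : ℝ) • φ t) ((0 : ℝ) • fun x => deriv (fun r => φ r x) t) = 0 := by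
    rw [zero_smul, zero_smul]
    have h := dFunctionalJ_eq hα hΩ (chartSmooth_const (X := X) 0) (ψ := fun _ => 0)
      continuous_const
    refine h.trans ?_
    simp
  rw [h0, one_smul, one_smul, sub_zero] at hint
  rw [hint] at hJ
  exact hJ

end FunctionalVariation

/-! ### The time interval [0, T) -/

section TimeInterval

variable {T : ENNReal}

theorem ordConnected_timeInterval : (timeInterval T).OrdConnected :=
  ⟨fun _ hx _ hz _ hy =>
    ⟨hx.1.trans hy.1, (ENNReal.ofReal_le_ofReal hy.2).trans_lt hz.2⟩⟩

theorem uniqueDiffOn_timeInterval : UniqueDiffOn ℝ (timeInterval T) := by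
  rcases (timeInterval T).eq_empty_or_nonempty with h | ⟨t, ht⟩
  · rw [h]
    exact uniqueDiffOn_empty
  -- A point t of the interval forces T > 0, so some real r > 0 lies below T and (0, r) provides
  -- interior points.
  · obtain ⟨r, -, hr0, hrT⟩ := ENNReal.lt_iff_exists_real_btwn.1 (bot_le.trans_lt ht.2)
    refine uniqueDiffOn_convex ordConnected_timeInterval.convex ⟨r / 2, ?_⟩
    have hr : 0 < r := ENNReal.ofReal_pos.1 hr0
    have hsub : Ioo 0 r ⊆ timeInterval T := fun s hs =>
      ⟨hs.1.le, (ENNReal.ofReal_le_ofReal hs.2.le).trans_lt hrT⟩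
    exact interior_maximal hsub isOpen_Ioo ⟨by linarith, by linarith⟩

end TimeInterval

/-! ### Persistence of the phase condition and convexity along the flow -/

section Flow

variable {n : ℕ} {X : Type*} [TopologicalSpace X] [ChartedSpace (Fin n → ℂ) X]
  {α Ω β : DForm n X 2 ℝ}

theorem PathSmooth.contDiffOn_apply {S : Set ℝ} {φ : ℝ → X → ℝ} (hφ : PathSmooth n S φ) (x : X) :
    ContDiffOn ℝ ∞ (fun t => φ t x) S := by
  set c := chartAt (Fin n → ℂ) x
  have hx : x ∈ c.source := mem_chart_source _ _
  have h := (hφ c (chart_mem_atlas _ _)).comp (f := fun t : ℝ => (t, c x)) (s := S)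
    (contDiffOn_id.prodMk contDiffOn_const) fun t ht => mk_mem_prod ht (c.map_source hx)
  exact h.congr fun t _ => by simp [c.left_inv hx]

theorem ratio_ne_zero_and_cot_phase (hβ : β.OneOne) (hΩ : IsKahlerForm Ω) (x : X) :
    ratio β Ω x ≠ 0 ∧ Real.cot (phase Ω β x) = (ratio β Ω x).re / (ratio β Ω x).im ∧
      (0 < Real.sin (phase Ω β x) → 0 < (ratio β Ω x).im) :=
  det_ne_zero_and_cot (isHermitian_herm (hβ x)) (posDef_hermMatrix hΩ x)

theorem gradRatio_nonneg (hβ : β.OneOne) (hΩ : IsKahlerForm Ω) {x : X}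
    (h : 0 < (ratio β Ω x).im) (u : X → ℝ) : 0 ≤ (gradRatio β Ω u x).re -
      (ratio β Ω x).re / (ratio β Ω x).im * (gradRatio β Ω u x).im :=
  gradForm_nonneg (isHermitian_herm (hβ x)) (posDef_hermMatrix hΩ x) h _

variable [IsManifold 𝓘(ℂ, Fin n → ℂ) ω X]

variable [T2Space X] [CompactSpace X]

theorem imRatio_eq (Ω α : DForm n X 2 ℝ) (φ : X → ℝ) (x : X) : imRatio Ω α φ x =
    Real.cos (angle Ω α) * (ratio (twist α φ) Ω x).im -
      Real.sin (angle Ω α) * (ratio (twist α φ) Ω x).re := by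
  have h : -Complex.I * (angle Ω α : ℂ) = ((-angle Ω α : ℝ) : ℂ) * Complex.I := by
    push_cast; ring
  rw [imRatio, Complex.mul_im, h, Complex.exp_ofReal_mul_I_re, Complex.exp_ofReal_mul_I_im,
    Real.cos_neg, Real.sin_neg]
  ring

theorem imLin_eq (Ω α : DForm n X 2 ℝ) (φ ψ : X → ℝ) (x : X) : imLin Ω α φ ψ x =
    Real.cos (angle Ω α) * (linRatio (twist α φ) Ω ψ x).im -
      Real.sin (angle Ω α) * (linRatio (twist α φ) Ω ψ x).re := by
  have h : -Complex.I * (angle Ω α : ℂ) = ((-angle Ω α : ℝ) : ℂ) * Complex.I := by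
    push_cast; ring
  rw [imLin, Complex.mul_im, h, Complex.exp_ofReal_mul_I_re, Complex.exp_ofReal_mul_I_im,
    Real.cos_neg, Real.sin_neg]
  ring

variable {T : ENNReal} {φ : ℝ → X → ℝ}

theorem IsFlow.pathSmooth (h : IsFlow Ω α T φ) : PathSmooth n (timeInterval T) φ := by
  intro e he
  have h1 : ContMDiffOn 𝓘(ℝ, Fin n → ℂ) 𝓘(ℝ, Fin n → ℂ) ∞ e.symm e.target :=
    contMDiffOn_symm_of_mem_maximalAtlas (IsManifold.subset_maximalAtlas he)
  have h2 : ContMDiffOn 𝓘(ℝ, ℝ × (Fin n → ℂ)) 𝓘(ℝ, ℝ) ∞ (Prod.fst : ℝ × (Fin n → ℂ) → ℝ)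
      (timeInterval T ×ˢ e.target) := contMDiffOn_iff_contDiffOn.2 contDiffOn_fst
  have h3 : ContMDiffOn 𝓘(ℝ, ℝ × (Fin n → ℂ)) 𝓘(ℝ, Fin n → ℂ) ∞
      (Prod.snd : ℝ × (Fin n → ℂ) → Fin n → ℂ) (timeInterval T ×ˢ e.target) :=
    contMDiffOn_iff_contDiffOn.2 contDiffOn_snd
  have h4 := h2.prodMk (h1.comp h3 fun q hq => hq.2)
  exact contMDiffOn_iff_contDiffOn.1 (h.smooth.comp h4 fun q hq => ⟨hq.1, mem_univ _⟩)

/-- Along the flow the phase stays in `(0, π)`. -/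
theorem IsFlow.im_ratio_pos (hα : ChartClosed α) (hΩ : IsKahlerForm Ω) (h : IsFlow Ω α T φ)
    (h0 : ∀ x : X, 0 < phase Ω (twist α (φ 0)) x ∧ phase Ω (twist α (φ 0)) x < Real.pi)
    {t : ℝ} (ht : t ∈ timeInterval T) (x : X) : 0 < (ratio (twist α (φ t)) Ω x).im := by
  have hφ := h.pathSmooth
  have hz : ContinuousOn (fun s => ratio (twist α (φ s)) Ω x) (timeInterval T) :=
    (continuousOn_ratio_twist hα hΩ uniqueDiffOn_timeInterval hφ).comp (f := fun s : ℝ => (s, x))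
      (by fun_prop) fun s hs => mk_mem_prod hs (mem_univ x)
  have hg : ContinuousOn (fun s => derivWithin (fun r => φ r x) (timeInterval T) s +
      Real.cot (angle Ω α)) (timeInterval T) :=
    ((hφ.contDiffOn_apply x).continuousOn_derivWithin uniqueDiffOn_timeInterval
      (by simp)).add continuousOn_const
  have hre := Complex.continuous_re.comp_continuousOn hz
  have him := Complex.continuous_im.comp_continuousOn hz
  -- With g = φ̇ + cot θ₀, continuous up to time 0, k = |Re z - g Im z| - Im z. Where Im z ≠ 0 the
  -- flow equation gives g = Re z / Im z, so k = -Im z; where Im z = 0, k = |Re z| > 0 since z ≠ 0.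
  -- Thus k is continuous without zeros and keeps its negative initial sign.
  set k : ℝ → ℝ := fun s => |(ratio (twist α (φ s)) Ω x).re -
    (derivWithin (fun r => φ r x) (timeInterval T) s + Real.cot (angle Ω α)) *
      (ratio (twist α (φ s)) Ω x).im| - (ratio (twist α (φ s)) Ω x).im with hk
  have hkc : ContinuousOn k (timeInterval T) := (hre.sub (hg.mul him)).abs.sub him
  have hval : ∀ s ∈ timeInterval T, derivWithin (fun r => φ r x) (timeInterval T) s +
      Real.cot (angle Ω α) =
        (ratio (twist α (φ s)) Ω x).re / (ratio (twist α (φ s)) Ω x).im := fun s hs => by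
    rw [(h.eq s hs x).derivWithin (uniqueDiffOn_timeInterval s hs), sub_add_cancel,
      (ratio_ne_zero_and_cot_phase (hα.twist (hφ.chartSmooth hs)).oneOne hΩ x).2.1]
  have hkv : ∀ s ∈ timeInterval T, (ratio (twist α (φ s)) Ω x).im ≠ 0 →
      k s = -(ratio (twist α (φ s)) Ω x).im := fun s hs hb => by
    simp only [hk, hval s hs, div_mul_cancel₀ _ hb, sub_self, abs_zero, zero_sub]
  have hne : ∀ s ∈ timeInterval T, k s ≠ 0 := fun s hs => by
    by_cases hb : (ratio (twist α (φ s)) Ω x).im = 0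
    · have ha : (ratio (twist α (φ s)) Ω x).re ≠ 0 := fun ha =>
        (ratio_ne_zero_and_cot_phase (hα.twist (hφ.chartSmooth hs)).oneOne hΩ x).1
          (Complex.ext ha hb)
      simpa [hk, hb] using ha
    · rw [hkv s hs hb]
      exact neg_ne_zero.2 hb
  have hT0 : (0 : ℝ) ∈ timeInterval T :=
    ⟨le_rfl, (ENNReal.ofReal_le_ofReal ht.1).trans_lt ht.2⟩
  have hb0 : 0 < (ratio (twist α (φ 0)) Ω x).im :=
    (ratio_ne_zero_and_cot_phase (hα.twist (hφ.chartSmooth hT0)).oneOne hΩ x).2.2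
      (Real.sin_pos_of_pos_of_lt_pi (h0 x).1 (h0 x).2)
  have hk0 : k 0 < 0 := by
    rw [hkv 0 hT0 hb0.ne']
    linarith
  have hkt : k t < 0 := by
    by_contra hkt
    obtain ⟨s, hs, hs0⟩ := ordConnected_timeInterval.isPreconnected.intermediate_value hT0 ht hkc
      ⟨hk0.le, not_lt.1 hkt⟩
    exact hne s hs hs0
  simp only [hk] at hkt
  linarith [abs_nonneg ((ratio (twist α (φ t)) Ω x).re -
    (derivWithin (fun r => φ r x) (timeInterval T) t + Real.cot (angle Ω α)) *
      (ratio (twist α (φ t)) Ω x).im)]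

theorem IsFlow.deriv_eq (hα : ChartClosed α) (hΩ : IsKahlerForm Ω) (h : IsFlow Ω α T φ)
    {t : ℝ} (ht : t ∈ interior (timeInterval T)) (x : X) :
    deriv (fun r => φ r x) t = (ratio (twist α (φ t)) Ω x).re / (ratio (twist α (φ t)) Ω x).im -
      Real.cot (angle Ω α) := by
  have ht' := interior_subset ht
  rw [((h.eq t ht' x).hasDerivAt (mem_interior_iff_mem_nhds.1 ht)).deriv,
    (ratio_ne_zero_and_cot_phase (hα.twist (h.pathSmooth.chartSmooth ht')).oneOne hΩ x).2.1]

theorem IsFlow.pathSmooth_interior (h : IsFlow Ω α T φ) :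
    PathSmooth n (interior (timeInterval T)) φ :=
  h.pathSmooth.comp contDiffOn_id interior_subset

/-- The quotient rule for φ̇ = Re z / Im z - cot θ₀, valid at all nearby times, with ż = Lφ̇
abbreviated by l. -/
theorem IsFlow.deriv_deriv_eq (hα : ChartClosed α) (hΩ : IsKahlerForm Ω) (h : IsFlow Ω α T φ)
    {t : ℝ} (ht : t ∈ interior (timeInterval T)) {x : X}
    (hb : (ratio (twist α (φ t)) Ω x).im ≠ 0) {l : ℂ}
    (hl : l = linRatio (twist α (φ t)) Ω (fun x => deriv (fun r => φ r x) t) x) :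
    deriv (fun r => deriv (fun r => φ r x) r) t =
      (l.re * (ratio (twist α (φ t)) Ω x).im - (ratio (twist α (φ t)) Ω x).re * l.im) /
        (ratio (twist α (φ t)) Ω x).im ^ 2 := by
  have hz := hasDerivAt_ratio hα hΩ isOpen_interior h.pathSmooth_interior ht x
  rw [← hl] at hz
  have hre : HasDerivAt (fun r => (ratio (twist α (φ r)) Ω x).re) l.re t :=
    Complex.reCLM.hasFDerivAt.comp_hasDerivAt t hz
  have him : HasDerivAt (fun r => (ratio (twist α (φ r)) Ω x).im) l.im t :=
    Complex.imCLM.hasFDerivAt.comp_hasDerivAt t hz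
  refine (((hre.fun_div him hb).sub_const (Real.cot (angle Ω α))).congr_of_eventuallyEq ?_).deriv
  filter_upwards [isOpen_interior.mem_nhds ht] with r hr using h.deriv_eq hα hΩ hr x

/-- Since cb - sa = -sbu, the first product is -su(a' - (a/b)b'); replacing a/b by u + c/s
eliminates a and b. -/
theorem second_variation_identity {a b a' b' c s u : ℝ} (hb : b ≠ 0) (hs : s ≠ 0)
    (hu : u = a / b - c / s) :
    (a' * b - a * b') / b ^ 2 * (c * b - s * a) + u * (c * b' - s * a') =
      -2 * s * (u * a') + 2 * c * (u * b') + s * (u ^ 2 * b') := by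
  subst hu
  field_simp
  ring

variable [MeasurableSpace X] [BorelSpace X]

theorem integral_re_of_continuous {μ : Measure X} [IsFiniteMeasure μ] {f : X → ℂ}
    (hf : Continuous f) : ∫ x, (f x).re ∂μ = (∫ x, f x ∂μ).re :=
  Complex.reCLM.integral_comp_comm (integrable_of_continuous hf)

/-- Integration by parts turns every second-order term into a gradient term, through ∫ uLu = -∫ G
and ∫ u²Lu = -2∫ uG with real and imaginary parts taken. -/
theorem integral_second_variation (hβ : ChartClosed β) (hΩ : IsKahlerForm Ω) {u : X → ℝ}
    (hu : ChartSmooth n u) (c s : ℝ) :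
    ∫ x, (-2 * s * (u x * (linRatio β Ω u x).re) + 2 * c * (u x * (linRatio β Ω u x).im) +
      s * (u x ^ 2 * (linRatio β Ω u x).im)) ∂volMeasure Ω =
    ∫ x, 2 * (s * (gradRatio β Ω u x).re - (s * u x + c) * (gradRatio β Ω u x).im)
      ∂volMeasure Ω := by
  have hfin := isFiniteMeasure_volMeasure (X := X) hΩ.smooth
  have huc := hu.continuous
  have hL := continuous_linRatio hβ hΩ hu
  have hG := continuous_gradRatio hβ hΩ hu
  have hLr : Continuous fun x => (linRatio β Ω u x).re := Complex.continuous_re.comp hL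
  have hLi : Continuous fun x => (linRatio β Ω u x).im := Complex.continuous_im.comp hL
  have hGr : Continuous fun x => (gradRatio β Ω u x).re := Complex.continuous_re.comp hG
  have hGi : Continuous fun x => (gradRatio β Ω u x).im := Complex.continuous_im.comp hG
  have hI : ∀ {f : X → ℝ}, Continuous f → Integrable f (volMeasure Ω) := integrable_of_continuous
  have huL : Continuous fun x => (u x : ℂ) * linRatio β Ω u x :=
    (Complex.continuous_ofReal.comp huc).mul hL
  have huuL : Continuous fun x => (u x : ℂ) ^ 2 * linRatio β Ω u x :=
    ((Complex.continuous_ofReal.comp huc).pow 2).mul hL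
  have huG : Continuous fun x => (u x : ℂ) * gradRatio β Ω u x :=
    (Complex.continuous_ofReal.comp huc).mul hG
  have e1 : ∫ x, u x * (linRatio β Ω u x).re ∂volMeasure Ω =
      -∫ x, (gradRatio β Ω u x).re ∂volMeasure Ω := by
    rw [integral_re_of_continuous hG, ← Complex.neg_re, ← integral_mul_linRatio_self hβ hΩ hu,
      ← integral_re_of_continuous huL]
    simp only [Complex.re_ofReal_mul]
  have e2 : ∫ x, u x * (linRatio β Ω u x).im ∂volMeasure Ω =
      -∫ x, (gradRatio β Ω u x).im ∂volMeasure Ω := by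
    rw [integral_im_of_continuous hG, ← Complex.neg_im, ← integral_mul_linRatio_self hβ hΩ hu,
      ← integral_im_of_continuous huL]
    simp only [Complex.im_ofReal_mul]
  have e3 : ∫ x, u x ^ 2 * (linRatio β Ω u x).im ∂volMeasure Ω =
      -2 * ∫ x, u x * (gradRatio β Ω u x).im ∂volMeasure Ω := by
    have h := congrArg Complex.im (integral_sq_mul_linRatio_self hβ hΩ hu)
    have h2 : (-2 * ∫ x, (u x : ℂ) * gradRatio β Ω u x ∂volMeasure Ω).im =
        -2 * (∫ x, (u x : ℂ) * gradRatio β Ω u x ∂volMeasure Ω).im := by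
      simp [Complex.mul_im]
    rw [h2, ← integral_im_of_continuous huuL, ← integral_im_of_continuous huG] at h
    simpa only [← Complex.ofReal_pow, Complex.im_ofReal_mul] using h
  have i1 : Integrable (fun x => -2 * s * (u x * (linRatio β Ω u x).re)) (volMeasure Ω) :=
    hI (continuous_const.mul (huc.mul hLr))
  have i2 : Integrable (fun x => 2 * c * (u x * (linRatio β Ω u x).im)) (volMeasure Ω) :=
    hI (continuous_const.mul (huc.mul hLi))
  have i3 : Integrable (fun x => s * (u x ^ 2 * (linRatio β Ω u x).im)) (volMeasure Ω) :=
    hI (continuous_const.mul ((huc.pow 2).mul hLi))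
  have i12 : Integrable (fun x => -2 * s * (u x * (linRatio β Ω u x).re) +
      2 * c * (u x * (linRatio β Ω u x).im)) (volMeasure Ω) := i1.add i2
  have j1 : Integrable (fun x => 2 * s * (gradRatio β Ω u x).re) (volMeasure Ω) :=
    hI (continuous_const.mul hGr)
  have j2 : Integrable (fun x => 2 * s * (u x * (gradRatio β Ω u x).im)) (volMeasure Ω) :=
    hI (continuous_const.mul (huc.mul hGi))
  have j3 : Integrable (fun x => 2 * c * (gradRatio β Ω u x).im) (volMeasure Ω) :=
    hI (continuous_const.mul hGi)
  have j12 : Integrable (fun x => 2 * s * (gradRatio β Ω u x).re -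
      2 * s * (u x * (gradRatio β Ω u x).im)) (volMeasure Ω) := j1.sub j2
  have hr : ∀ x, 2 * (s * (gradRatio β Ω u x).re - (s * u x + c) * (gradRatio β Ω u x).im) =
      2 * s * (gradRatio β Ω u x).re - 2 * s * (u x * (gradRatio β Ω u x).im) -
        2 * c * (gradRatio β Ω u x).im := fun x => by ring
  simp only [hr]
  rw [integral_add i12 i3, integral_add i1 i2, integral_sub j12 j3, integral_sub j1 j2]
  simp only [integral_const_mul, e1, e2, e3]
  ring

theorem IsFlow.convexOn_functionalJ (hα : ChartClosed α) (hΩ : IsKahlerForm Ω)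
    (hθ : 0 < angle Ω α ∧ angle Ω α < Real.pi) (h : IsFlow Ω α T φ)
    (h0 : ∀ x : X, 0 < phase Ω (twist α (φ 0)) x ∧ phase Ω (twist α (φ 0)) x < Real.pi) :
    ConvexOn ℝ (timeInterval T) fun t => functionalJ Ω α (φ t) := by
  have hφ := h.pathSmooth_interior
  have hs : 0 < Real.sin (angle Ω α) := Real.sin_pos_of_pos_of_lt_pi hθ.1 hθ.2
  -- Derivatives in time are needed only in the interior; the initial time enters through continuity
  -- of the functional alone.
  refine convexOn_of_hasDerivWithinAt2_nonneg ordConnected_timeInterval.convex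
    (continuousOn_functionalJ hα hΩ uniqueDiffOn_timeInterval h.pathSmooth)
    (fun t ht => (hasDerivAt_functionalJ hα hΩ isOpen_interior hφ ht).hasDerivWithinAt)
    (fun t ht => (hasDerivAt_dFunctionalJ hα hΩ isOpen_interior hφ
      (hφ.deriv isOpen_interior) ht).hasDerivWithinAt) fun t ht => ?_
  have hβ := hα.twist (hφ.chartSmooth ht)
  have hb : ∀ x, 0 < (ratio (twist α (φ t)) Ω x).im :=
    h.im_ratio_pos hα hΩ h0 (interior_subset ht)
  set u : X → ℝ := fun x => deriv (fun r => φ r x) t with hu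
  have hux : ∀ x, u x = (ratio (twist α (φ t)) Ω x).re / (ratio (twist α (φ t)) Ω x).im -
      Real.cos (angle Ω α) / Real.sin (angle Ω α) := fun x => by
    rw [← Real.cot_eq_cos_div_sin]
    exact h.deriv_eq hα hΩ ht x
  have hpt : ∀ x, deriv (fun r => deriv (fun r => φ r x) r) t * imRatio Ω α (φ t) x +
      deriv (fun r => φ r x) t * imLin Ω α (φ t) u x =
      -2 * Real.sin (angle Ω α) * (u x * (linRatio (twist α (φ t)) Ω u x).re) +
        2 * Real.cos (angle Ω α) * (u x * (linRatio (twist α (φ t)) Ω u x).im) +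
        Real.sin (angle Ω α) * (u x ^ 2 * (linRatio (twist α (φ t)) Ω u x).im) := fun x => by
    rw [h.deriv_deriv_eq hα hΩ ht (hb x).ne' rfl, imRatio_eq, imLin_eq]
    exact second_variation_identity (hb x).ne' hs.ne' (hux x)
  simp only [hpt]
  rw [integral_second_variation hβ hΩ ((hφ.deriv isOpen_interior).chartSmooth ht)]
  refine integral_nonneg fun x => ?_
  have hg := gradRatio_nonneg hβ.oneOne hΩ (hb x) u
  -- By the flow equation, s u + c = s cot θ: the coefficient of Im G is exactly the one required by
  -- the pointwise inequality.
  have hc : Real.sin (angle Ω α) * u x + Real.cos (angle Ω α) = Real.sin (angle Ω α) *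
      ((ratio (twist α (φ t)) Ω x).re / (ratio (twist α (φ t)) Ω x).im) := by
    rw [hux]
    field_simp
    ring
  have h2 := mul_nonneg hs.le hg
  change 0 ≤ 2 * (Real.sin (angle Ω α) * (gradRatio (twist α (φ t)) Ω u x).re -
    (Real.sin (angle Ω α) * u x + Real.cos (angle Ω α)) * (gradRatio (twist α (φ t)) Ω u x).im)
  rw [hc]
  linarith

end Flow

end DHYM

end

/-! ### The main theorem -/

theorem mainTheorem11 {n : ℕ} {X : Type*} [TopologicalSpace X] [T2Space X] [CompactSpace X]
    [ChartedSpace (Fin n → ℂ) X] [IsManifold 𝓘(ℂ, Fin n → ℂ) ω X]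
    (α Ω : DHYM.DForm n X 2 ℝ) (hα : DHYM.IsClosedRealOneOne α) (hΩ : DHYM.IsKahlerForm Ω)
    (hθ : 0 < DHYM.angle Ω α ∧ DHYM.angle Ω α < Real.pi) :
    (DHYM.functionalJ Ω α 0 = 0 ∧
      ∀ φ ψ : X → ℝ, DHYM.SmoothFun n φ → DHYM.SmoothFun n ψ →
        HasDerivAt (fun s : ℝ => DHYM.functionalJ Ω α (φ + s • ψ))
          (DHYM.dFunctionalJ Ω α φ ψ) 0) ∧
    ∀ (T : ENNReal) (φ : ℝ → X → ℝ), DHYM.IsFlow Ω α T φ →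
      (∀ x : X, 0 < DHYM.phase Ω (DHYM.twist α (φ 0)) x ∧
        DHYM.phase Ω (DHYM.twist α (φ 0)) x < Real.pi) →
      ConvexOn ℝ (DHYM.timeInterval T) (fun t => DHYM.functionalJ Ω α (φ t)) := by
  -- The statement involves only integrals in charts; the Borel σ-algebra on X serves the auxiliary
  -- measure of Ωⁿ.
  let _ : MeasurableSpace X := borel X
  have _ : BorelSpace X := ⟨rfl⟩
  have hα' := hα.chartClosed
  refine ⟨⟨?_, fun φ ψ hφ hψ => ?_⟩, fun T φ h h0 => h.convexOn_functionalJ hα' hΩ hθ h0⟩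
  · have h : DHYM.dFunctionalJ Ω α 0 0 = 0 := by
      have h := DHYM.dFunctionalJ_eq (φ := 0) (ψ := 0) hα' hΩ (DHYM.chartSmooth_const 0)
        continuous_const
      rw [h]
      simp
    simp [DHYM.functionalJ, h]
  · have hp : DHYM.PathSmooth n (Set.univ : Set ℝ) fun s x => φ x + s * ψ x :=
      hφ.chartSmooth.pathSmooth.add
        ((DHYM.pathSmooth_of_contDiffOn contDiffOn_id).mul hψ.chartSmooth.pathSmooth)
    have h := DHYM.hasDerivAt_functionalJ hα' hΩ isOpen_univ hp (Set.mem_univ 0)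
    have h1 : (fun x => φ x + 0 * ψ x) = φ := by
      ext x
      simp
    have h2 : (fun x => deriv (fun s : ℝ => φ x + s * ψ x) 0) = ψ := by
      ext x
      simp
    rw [h1, h2] at h
    exact h
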